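/- Consider random walk on dynamical percolation on $\mathbb{Z}^d$, with parameters $p\in[0,1]$ and $\mu>0$: independently for different edges of the nearest-neighbour lattice $\mathbb{Z}^d$, each edge refreshes its state at rate $\mu$ (at the times of a Poisson process), and at each refreshment it becomes open with probability $p$ and closed with probability $1-p$, independently of everything else; before its first refreshment, its state is that prescribed by a given deterministic initial bond configuration $\eta_0$. Independently of the edges, a walker that starts at the origin at time $0$ chooses, at the times of a rate $1$ Poisson process, one of the $2d$ neighbours of its current position uniformly at random, and moves there if and only if the connecting edge is open at that time. Let $X_t$ be its position at time $t\ge 0$. (i) Let $d\in\{1,2\}$, $\mu>0$, and let $\eta_0$ be any initial bond configuration. If $p\in(0,1]$, or if $p=0$ and all the edges at the origin are closed in $\eta_0$, then for every $s_0\ge 0$, $$\mathbb{P}\Bigl(\bigcup_{s\ge s_0}\{X_s=0\}\Bigr)=1 .$$ (ii) Let $d\ge 3$, $p\in(0,1]$, $\mu>0$, and let $\eta_0$ be any initial bond configuration. Then $\lim_{t\to\infty}X_t=\infty$ almost surely, that is, almost surely the walker eventually leaves every finite subset of $\mathbb{Z}^d$ forever. -/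

import Mathlib

open MeasureTheory ProbabilityTheory Filter
open scoped NNReal

namespace DynPerc

/-- The vertices of the lattice `ℤ^d`; two of them are neighbours when they differ by `± 1` in
exactly one coordinate. -/
abbrev Vertex (d : ℕ) : Type := Fin d → ℤ

/-- The edges (bonds) of `ℤ^d`. The pair `(x, i)` is the unoriented edge `{x, x + e_i}`, so that
every nearest-neighbour edge occurs exactly once. -/
abbrev Edge (d : ℕ) : Type := Vertex d × Fin d

/-- The `2 d` directions in `ℤ^d`: `(i, true)` is `+ e_i` and `(i, false)` is `- e_i`. -/
abbrev Direction (d : ℕ) : Type := Fin d × Bool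

/-- A bond configuration, an element of `{0,1}^E`: `true` is open and `false` is closed. -/
abbrev BondConfig (d : ℕ) : Type := Edge d → Bool

/-- The neighbour of `x` in direction `v`. -/
def neighbor {d : ℕ} (x : Vertex d) (v : Direction d) : Vertex d :=
  if v.2 then x + Pi.single v.1 1 else x - Pi.single v.1 1

/-- The edge between `x` and `neighbor x v`. -/
def edgeToward {d : ℕ} (x : Vertex d) (v : Direction d) : Edge d :=
  if v.2 then (x, v.1) else (x - Pi.single v.1 1, v.1)

/-- The time of the `n`-th arrival (counted from `n = 0`) of the clock whose successive waiting
times are `gap 0, gap 1, …`. -/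
def arrivalTime (gap : ℕ → ℝ) (n : ℕ) : ℝ := ∑ k ∈ Finset.range (n + 1), gap k

/-- The number of arrivals during `[0, t]`. -/
noncomputable def arrivalCount (gap : ℕ → ℝ) (t : ℝ) : ℕ := {n : ℕ | arrivalTime gap n ≤ t}.ncard

/-- The sample points. The first component gives, for every edge, the successive waiting times
between its refreshments and the states chosen at them. The second component gives the successive
waiting times between the attempted steps of the walker and the directions chosen at them. -/
abbrev Sample (d : ℕ) : Type := (Edge d → ℕ → ℝ × Bool) × (ℕ → ℝ × Direction d)

/-- The probability measure that drives the model: all the variables are independent, each edge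
refreshes at rate `μ` and at each refreshment becomes open with probability `p` and closed with
probability `1 - p`, and the walker attempts steps at rate `1`, in uniform directions. -/
noncomputable def law (d : ℕ) (p : unitInterval) (μ : ℝ) : Measure (Sample d) :=
  (Measure.infinitePi fun _ : Edge d => Measure.infinitePi fun _ : ℕ =>
      (expMeasure μ).prod (bernoulliMeasure true false p)).prod
    (Measure.infinitePi fun _ : ℕ => (expMeasure 1).prod (uniformOn Set.univ))

theorem isProbabilityMeasure_law {d : ℕ} [NeZero d] (p : unitInterval) {μ : ℝ} (hμ : 0 < μ) :
    IsProbabilityMeasure (law d p μ) := by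
  have h1 : IsProbabilityMeasure (expMeasure μ) := isProbabilityMeasure_expMeasure hμ
  have h2 : IsProbabilityMeasure (expMeasure 1) := isProbabilityMeasure_expMeasure one_pos
  have h3 : IsProbabilityMeasure (uniformOn (Set.univ : Set (Direction d))) :=
    isProbabilityMeasure_uniformOn Set.finite_univ Set.univ_nonempty
  unfold law
  infer_instance

/-- The state of an edge at time `t`, when its initial state is `b` and `r` are its refreshments:
the state chosen at the last refreshment during `[0, t]`, or `b` if there was none. -/
noncomputable def edgeState (b : Bool) (r : ℕ → ℝ × Bool) (t : ℝ) : Bool :=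
  match arrivalCount (fun n => (r n).1) t with
  | 0 => b
  | n + 1 => (r n).2

/-- Dynamical percolation `η_t` on `ℤ^d`, started from `η₀`. -/
noncomputable def bondConfig {d : ℕ} (η₀ : BondConfig d) (ω : Sample d) (t : ℝ) : BondConfig d :=
  fun e => edgeState (η₀ e) (ω.1 e) t

/-- The position of the walker, started at the origin, after its first `n` attempted steps: at each
attempt it moves to the chosen neighbour if the connecting edge is open at that time, and otherwise
it stays where it is. -/
noncomputable def positionAfter {d : ℕ} (η₀ : BondConfig d) (ω : Sample d) : ℕ → Vertex d
  | 0 => 0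
  | n + 1 =>
    let x := positionAfter η₀ ω n
    let t := arrivalTime (fun k => (ω.2 k).1) n
    let v := (ω.2 n).2
    if bondConfig η₀ ω t (edgeToward x v) = true then neighbor x v else x

/-- The position `X_t` at time `t` of the random walk on dynamical percolation on `ℤ^d`, when the
walker starts at the origin and the initial bond configuration is `η₀`. -/
noncomputable def walker {d : ℕ} (η₀ : BondConfig d) (ω : Sample d) (t : ℝ≥0) : Vertex d :=
  positionAfter η₀ ω (arrivalCount (fun k => (ω.2 k).1) t)

end DynPerc

/-! The walker learns about the environment only by looking at one edge per attempt. By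
memorylessness of the exponential law, a look at an edge last seen in state `b`, `a` units of time
ago, gives `b` with an extra mass `exp(-μ a)` and an independent coin otherwise, and the
refreshments after the look are as new. Only these probabilities matter for the law of the positions
(`HasKernel.measure_path_eq`). So each look may instead be given an independent exponential lifetime
during which its result stays in force, a coin being tossed at the next look after its expiry
(`clockRule_hasKernel`, `lifeRule_hasKernel`, `ae_positionAfter_mem`).

The walk is now a function of i.i.d. inputs, and it forgets everything when all lifetimes have
expired. The largest residual lifetime `load` has a negative drift when large, so the times between
such regenerations have exponential tails (`exists_iid_neverExpired_le`). The displacements between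
regenerations are i.i.d. with law `stepLaw`. This law is symmetric by reflection, has finite
variance, and charges every unit vector if `p > 0`.

If `d ≤ 2`, Chebyshev and Cauchy–Schwarz bound the return probability of such a walk after `2n`
steps below by `c / n`, so the expected number of returns is infinite and the regenerative walk is
recurrent (`tsum_convPow_zero_eq_top`, `ae_frequently_visit_zero`). If `d ≥ 3`, comparison with the
walk whose steps are uniform on `{-1, 1}^d`, with point probabilities `O(j^(-3/2))`, bounds the
Green function (`exists_tsum_convPow_le`). Summability of the survival probabilities of excursions
carries the bound over to all attempts, and Borel–Cantelli gives transience.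

The given configuration only adds initial lifetimes. Almost surely they have expired, from some
attempt on, at all edges within reach. From the next zero of `load` the walk is a translate of a
fresh one (`run_initialState_add`), so tail properties transfer. For `p = 0` with closed edges at
the origin the walker never moves. -/

namespace DynPerc

open scoped ENNReal

/-! ### Sequences of independent, identically distributed variables -/

section Sequences

variable {S T : Type*}

/-- The sequence that starts with `s` and continues with `ζ`. -/
def seqCons (s : S) (ζ : ℕ → S) : ℕ → S
  | 0 => s
  | n + 1 => ζ n

/-- The sequence without its first `n` terms. -/
def seqShift (n : ℕ) (ζ : ℕ → S) : ℕ → S := fun k => ζ (n + k)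

@[simp] lemma seqCons_zero (s : S) (ζ : ℕ → S) : seqCons s ζ 0 = s := rfl
@[simp] lemma seqCons_succ (s : S) (ζ : ℕ → S) (n : ℕ) : seqCons s ζ (n + 1) = ζ n := rfl
@[simp] lemma seqShift_apply (n k : ℕ) (ζ : ℕ → S) : seqShift n ζ k = ζ (n + k) := rfl

@[simp] lemma seqShift_zero (ζ : ℕ → S) : seqShift 0 ζ = ζ := by
  funext k; simp

lemma seqShift_seqShift (n m : ℕ) (ζ : ℕ → S) :
    seqShift m (seqShift n ζ) = seqShift (n + m) ζ := by
  funext k; simp [add_assoc]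

@[simp] lemma seqShift_succ_seqCons (n : ℕ) (s : S) (ζ : ℕ → S) :
    seqShift (n + 1) (seqCons s ζ) = seqShift n ζ := by
  funext k
  simp [show n + 1 + k = (n + k) + 1 by omega]

variable [MeasurableSpace S] [MeasurableSpace T]

lemma measurable_seqCons : Measurable fun q : S × (ℕ → S) => seqCons q.1 q.2 := by
  refine measurable_pi_iff.2 fun n => ?_
  cases n with
  | zero => exact measurable_fst
  | succ n => exact (measurable_pi_apply n).comp measurable_snd

lemma measurable_seqShift (n : ℕ) : Measurable (seqShift (S := S) n) :=
  measurable_pi_iff.2 fun k => measurable_pi_apply (n + k)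

/-- The law of a sequence of independent variables with law `m`. -/
noncomputable abbrev iid (m : Measure S) : Measure (ℕ → S) := Measure.infinitePi fun _ => m

variable (m : Measure S) [IsProbabilityMeasure m] (m' : Measure T) [IsProbabilityMeasure m']

/-- This is first-step analysis; `iid_apply_eq_lintegral` and `lintegral_iid` are its integral
forms. It is checked on finite boxes, whose preimage splits into the constraint at index `0` and
those at successors. -/
lemma measurePreserving_seqCons :
    MeasurePreserving (fun q : S × (ℕ → S) => seqCons q.1 q.2) (m.prod (iid m)) (iid m) := by
  refine ⟨measurable_seqCons, Measure.eq_infinitePi _ fun s t ht => ?_⟩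
  classical
  rw [Measure.map_apply measurable_seqCons (.pi s.countable_toSet fun _ _ => ht _)]
  have hinj : Set.InjOn Nat.succ (Nat.succ ⁻¹' (s : Set ℕ)) := Nat.succ_injective.injOn
  have : (fun q : S × (ℕ → S) => seqCons q.1 q.2) ⁻¹' (s : Set ℕ).pi t =
      (if 0 ∈ s then t 0 else Set.univ) ×ˢ
        (s.preimage Nat.succ hinj : Set ℕ).pi (fun k => t (k + 1)) := by
    ext ⟨a, ζ⟩
    simp only [Set.mem_preimage, Set.mem_pi, Set.mem_prod, Finset.mem_coe, Finset.mem_preimage]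
    constructor
    · intro h
      refine ⟨?_, fun k hk => h (k + 1) hk⟩
      split_ifs with h0
      · exact h 0 h0
      · trivial
    · rintro ⟨h0, h1⟩ k hk
      cases k with
      | zero => simpa [hk] using h0
      | succ k => exact h1 k hk
  rw [this, Measure.prod_prod, Measure.infinitePi_pi _ fun _ _ => ht _]
  have hs : s = (if 0 ∈ s then {0} else ∅) ∪ (s.preimage Nat.succ hinj).map ⟨_, Nat.succ_injective⟩ := by
    ext k
    cases k with
    | zero => split_ifs with h <;> simp [h]
    | succ k => split_ifs with h <;> simp
  conv_rhs => rw [hs]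
  rw [Finset.prod_union, Finset.prod_map]
  · congr 1
    split_ifs <;> simp
  · rw [Finset.disjoint_left]
    intro k hk
    split_ifs at hk with h
    · simp at hk; simp [hk]
    · simp at hk

/-- Resampling one coordinate from its own law is harmless. This allows conditioning on the
randomness of a single edge. -/
lemma measurePreserving_update {ι : Type*} [DecidableEq ι] (e : ι) :
    MeasurePreserving (fun q : S × (ι → S) => Function.update q.2 e q.1)
      (m.prod (Measure.infinitePi fun _ : ι => m)) (Measure.infinitePi fun _ : ι => m) := by
  have hm : Measurable (fun q : S × (ι → S) => Function.update q.2 e q.1) := by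
    refine measurable_pi_iff.2 fun i => ?_
    by_cases h : i = e
    · subst h; simpa using measurable_fst
    · simp only [Function.update_of_ne h]
      exact (measurable_pi_apply i).comp measurable_snd
  refine ⟨hm, Measure.eq_infinitePi _ fun s t ht => ?_⟩
  rw [Measure.map_apply hm (.pi s.countable_toSet fun _ _ => ht _)]
  have : (fun q : S × (ι → S) => Function.update q.2 e q.1) ⁻¹' (s : Set ι).pi t =
      (if e ∈ s then t e else Set.univ) ×ˢ ((s.erase e : Finset ι) : Set ι).pi t := by
    ext ⟨a, ζ⟩
    simp only [Set.mem_preimage, Set.mem_pi, Set.mem_prod, Finset.mem_coe, Finset.mem_erase]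
    constructor
    · intro h
      refine ⟨?_, fun k hk => by simpa [hk.1] using h k hk.2⟩
      split_ifs with h0
      · simpa using h e h0
      · trivial
    · rintro ⟨h0, h1⟩ k hk
      by_cases hke : k = e
      · subst hke; simpa [hk] using h0
      · simpa [hke] using h1 k ⟨hke, hk⟩
  rw [this, Measure.prod_prod, Measure.infinitePi_pi _ fun _ _ => ht _]
  split_ifs with h
  · exact Finset.mul_prod_erase s (fun i => m (t i)) h
  · rw [Finset.erase_eq_of_notMem h, measure_univ, one_mul]

lemma iid_apply_eq_lintegral {A : Set (ℕ → S)} (hA : MeasurableSet A) :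
    iid m A = ∫⁻ s, iid m {ζ | seqCons s ζ ∈ A} ∂m := by
  rw [← (measurePreserving_seqCons m).measure_preimage hA.nullMeasurableSet,
    Measure.prod_apply (measurable_seqCons hA)]
  rfl

lemma lintegral_iid {f : (ℕ → S) → ℝ≥0∞} (hf : Measurable f) :
    ∫⁻ ζ, f ζ ∂iid m = ∫⁻ s, ∫⁻ ζ, f (seqCons s ζ) ∂iid m ∂m := by
  rw [← (measurePreserving_seqCons m).lintegral_comp hf]
  exact lintegral_prod _ (hf.comp measurable_seqCons).aemeasurable

lemma measurePreserving_seqShift (n : ℕ) : MeasurePreserving (seqShift n) (iid m) (iid m) := by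
  refine ⟨measurable_seqShift n, Measure.eq_infinitePi _ fun s t ht => ?_⟩
  rw [Measure.map_apply (measurable_seqShift n) (.pi s.countable_toSet fun _ _ => ht _)]
  have : seqShift n ⁻¹' (s : Set ℕ).pi t =
      (s.map (addLeftEmbedding n) : Set ℕ).pi (fun k => t (k - n)) := by
    ext ζ; simp [Set.mem_pi]
  rw [this, Measure.infinitePi_pi _ fun _ _ => ht _]
  simp

/-- The shifted sequence is independent of the events that depend on the first terms only. -/
lemma iid_inter_seqShift (n : ℕ) {A B : Set (ℕ → S)} (hA : MeasurableSet A) (hB : MeasurableSet B)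
    (hAn : ∀ ζ ζ' : ℕ → S, (∀ k < n, ζ k = ζ' k) → ζ ∈ A → ζ' ∈ A) :
    iid m (A ∩ seqShift n ⁻¹' B) = iid m A * iid m B := by
  induction n generalizing A with
  | zero =>
    rcases A.eq_empty_or_nonempty with rfl | ⟨ζ, hζ⟩
    · simp
    · have : A = Set.univ := Set.eq_univ_of_forall fun ζ' => hAn ζ ζ' (by simp) hζ
      subst this
      have h0 : seqShift (S := S) 0 = id := funext seqShift_zero
      simp [h0]
  | succ n ih =>
    have hs : ∀ s, MeasurableSet {ζ | seqCons s ζ ∈ A} := fun s =>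
      (measurable_seqCons.comp measurable_prodMk_left) hA
    rw [iid_apply_eq_lintegral m (hA.inter (measurable_seqShift _ hB)),
      iid_apply_eq_lintegral m hA, ← lintegral_mul_const]
    · refine lintegral_congr fun s => ?_
      rw [← ih (hs s)]
      · congr 1
        ext ζ
        simp
      · intro ζ ζ' h hζ
        refine hAn _ _ (fun k hk => ?_) hζ
        cases k with
        | zero => rfl
        | succ k => exact h k (by omega)
    · exact measurable_measure_prodMk_left (measurable_seqCons hA)

/-- Fubini on a finite box: each section is again a box, and its probability is a product of
functions of different coordinates, which are independent. -/
lemma measurePreserving_zip :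
    MeasurePreserving (fun (q : (ℕ → S) × (ℕ → T)) n => (q.1 n, q.2 n))
      ((iid m).prod (iid m')) (iid (m.prod m')) := by
  have hm : Measurable (fun (q : (ℕ → S) × (ℕ → T)) n => (q.1 n, q.2 n)) := by fun_prop
  refine ⟨hm, Measure.eq_infinitePi _ fun s t ht => ?_⟩
  have hbox := MeasurableSet.pi s.countable_toSet fun k (_ : k ∈ (s : Set ℕ)) => ht k
  rw [Measure.map_apply hm hbox, Measure.prod_apply (hm hbox)]
  have hsec : ∀ x : ℕ → S, iid m' (Prod.mk x ⁻¹'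
      ((fun (q : (ℕ → S) × (ℕ → T)) n => (q.1 n, q.2 n)) ⁻¹' (s : Set ℕ).pi t)) =
      ∏ k ∈ s, m' (Prod.mk (x k) ⁻¹' t k) := by
    intro x
    rw [← Measure.infinitePi_pi (fun _ => m') fun k _ => measurable_prodMk_left (ht k)]
    rfl
  have hmk : ∀ k, Measurable fun a => m' (Prod.mk a ⁻¹' t k) := fun k =>
    measurable_measure_prodMk_left (ht k)
  simp_rw [hsec, Measure.prod_apply (ht _)]
  have hind : iIndepFun (fun k (x : ℕ → S) => m' (Prod.mk (x k) ⁻¹' t k)) (iid m) :=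
    iIndepFun_infinitePi (X := fun k a => m' (Prod.mk a ⁻¹' t k)) hmk
  rw [lintegral_prod_eq_prod_lintegral_of_indepFun s _ hind
    fun k => (hmk k).comp (measurable_pi_apply k)]
  refine Finset.prod_congr rfl fun k _ => ?_
  exact (measurePreserving_eval_infinitePi (fun _ : ℕ => m) k).lintegral_comp (hmk k)

end Sequences

/-- Prescribed initial segments form a π-system, and it generates the product σ-algebra because `V`
is countable. -/
lemma measure_ext_of_cylinder {V : Type*} [Countable V] [MeasurableSpace V]
    [MeasurableSingletonClass V] {ν ν' : Measure (ℕ → V)} [IsProbabilityMeasure ν]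
    [IsProbabilityMeasure ν']
    (h : ∀ (n : ℕ) (c : ℕ → V), ν {y | ∀ k < n, y k = c k} = ν' {y | ∀ k < n, y k = c k}) :
    ν = ν' := by
  refine ext_of_generate_finite {s | ∃ (n : ℕ) (c : ℕ → V), s = {y : ℕ → V | ∀ k < n, y k = c k}} ?_ ?_ ?_
    (by simp)
  · refine le_antisymm ?_ (MeasurableSpace.generateFrom_le ?_)
    · refine iSup_le fun k => measurable_iff_comap_le.1 ?_
      refine @measurable_to_countable' _ _ _ _ (_) _ fun v => ?_
      have : (fun y : ℕ → V => y k) ⁻¹' {v} = ⋃ c : {c : Fin (k + 1) → V // c (Fin.last k) = v},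
          {y | ∀ j < k + 1, y j = if h : j < k + 1 then c.1 ⟨j, h⟩ else v} := by
        ext y
        simp only [Set.mem_preimage, Set.mem_singleton_iff, Set.mem_iUnion, Set.mem_ofPred_eq]
        constructor
        · intro hy
          exact ⟨⟨fun j => y j, hy⟩, fun j hj => by simp [hj]⟩
        · rintro ⟨c, hc⟩
          rw [hc k (by omega), dif_pos (by omega)]
          exact c.2
      rw [this]
      exact MeasurableSet.iUnion fun c => MeasurableSpace.measurableSet_generateFrom ⟨_, _, rfl⟩
    · rintro _ ⟨n, c, rfl⟩
      simp only [Set.ofPred_forall]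
      exact .iInter fun k => .iInter fun _ => measurable_pi_apply k (measurableSet_singleton _)
  · rintro _ ⟨n, c, rfl⟩ _ ⟨n', c', rfl⟩ ⟨z, hz, hz'⟩
    -- Two cylinders with a common point `z` intersect in the cylinder around `z` of the larger
    -- length.
    refine ⟨max n n', z, ?_⟩
    ext y
    simp only [Set.mem_inter_iff, Set.mem_ofPred_eq, lt_max_iff] at hz hz' ⊢
    constructor
    · rintro ⟨h1, h2⟩ k (hk | hk)
      · rw [h1 k hk, hz k hk]
      · rw [h2 k hk, hz' k hk]
    · intro h'
      exact ⟨fun k hk => by rw [h' k (.inl hk), hz k hk],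
        fun k hk => by rw [h' k (.inr hk), hz' k hk]⟩
  · rintro _ ⟨n, c, rfl⟩
    exact h n c

/-! ### Tails of the exponential law -/

section Exponential

variable {r : ℝ}

lemma expMeasure_Iic (hr : 0 < r) (a : ℝ) (ha : 0 ≤ a) :
    expMeasure r (Set.Iic a) = ENNReal.ofReal (1 - Real.exp (-(r * a))) := by
  have := isProbabilityMeasure_expMeasure hr
  rw [← ofReal_cdf, cdf_expMeasure_eq hr, if_pos ha]

lemma expMeasure_Ioi (hr : 0 < r) (a : ℝ) (ha : 0 ≤ a) :
    expMeasure r (Set.Ioi a) = ENNReal.ofReal (Real.exp (-(r * a))) := by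
  have := isProbabilityMeasure_expMeasure hr
  rw [← Set.compl_Iic, prob_compl_eq_one_sub measurableSet_Iic, expMeasure_Iic hr a ha,
    ← ENNReal.ofReal_one, ← ENNReal.ofReal_sub]
  · congr 1; ring
  · have : Real.exp (-(r * a)) ≤ 1 := Real.exp_le_one_iff.2 (by nlinarith)
    linarith

lemma ae_pos_expMeasure (hr : 0 < r) : ∀ᵐ x ∂expMeasure r, 0 < x := by
  rw [ae_iff]
  have : {x : ℝ | ¬ 0 < x} = Set.Iic 0 := by ext; simp
  rw [this, expMeasure_Iic hr 0 le_rfl]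
  simp

end Exponential

end DynPerc

/-! ### Walks that look at evolving edges, and the kernel that determines their law -/

namespace DynPerc

open scoped ENNReal

/-- A rule for looking at an edge of a percolation that evolves in time. When the edge was in state
`b` at the previous look, `a` units of time ago, its randomness since then is `r` and the
randomness of the present look is `s`, then `look b a r s` is its present state and `next a r s` is
its randomness from now on. -/
structure LookRule (R S : Type*) where
  look : Bool → ℝ → R → S → Bool
  next : ℝ → R → S → R

/-- A vertex, and for every edge its state at the last look, the time since the last look and its
randomness since then. -/
abbrev State (d : ℕ) (R : Type*) : Type _ := Vertex d × (Edge d → Bool × ℝ × R)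

/-- The direction of an attempted step, the randomness of the corresponding look and the waiting
time until the next attempt. -/
abbrev Input (d : ℕ) (S : Type*) : Type _ := Direction d × S × ℝ

/-- The position after an attempted step from `x` in direction `v` along an edge of state `o`. -/
def moved {d : ℕ} (o : Bool) (x : Vertex d) (v : Direction d) : Vertex d :=
  if o = true then neighbor x v else x

/-- The states at the last looks and the times since then, after a look at `e` with result `o`
that is followed by a waiting time `|g|`. -/
def nextHistory {d : ℕ} (h : Edge d → Bool × ℝ) (e : Edge d) (o : Bool) (g : ℝ) :
    Edge d → Bool × ℝ :=
  fun e' => if e' = e then (o, |g|) else ((h e').1, (h e').2 + |g|)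

namespace LookRule

variable {R S : Type*} (ρ : LookRule R S) {d : ℕ}

/-- The state of the edge along which the next step is attempted. -/
def outcome (z : State d R) (i : Input d S) : Bool :=
  ρ.look (z.2 (edgeToward z.1 i.1)).1 (z.2 (edgeToward z.1 i.1)).2.1
    (z.2 (edgeToward z.1 i.1)).2.2 i.2.1

/-- One attempted step, followed by a waiting time. -/
def step (z : State d R) (i : Input d S) : State d R :=
  (moved (ρ.outcome z i) z.1 i.1, fun e =>
    -- The absolute value keeps ages nonnegative for every input, as `HasKernel` demands; almost
    -- surely it changes nothing.
    if e = edgeToward z.1 i.1 then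
      (ρ.outcome z i, |i.2.2|, ρ.next (z.2 e).2.1 (z.2 e).2.2 i.2.1)
    else ((z.2 e).1, (z.2 e).2.1 + |i.2.2|, (z.2 e).2.2))

/-- The state after `n` attempted steps. -/
def run : ℕ → State d R → (ℕ → Input d S) → State d R
  | 0, z, _ => z
  | n + 1, z, ζ => run n (ρ.step z (ζ 0)) (seqShift 1 ζ)

@[simp] lemma run_zero (z : State d R) (ζ : ℕ → Input d S) : ρ.run 0 z ζ = z := rfl

lemma run_succ (n : ℕ) (z : State d R) (ζ : ℕ → Input d S) :
    ρ.run (n + 1) z ζ = ρ.run n (ρ.step z (ζ 0)) (seqShift 1 ζ) := rfl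

lemma run_add (n m : ℕ) (z : State d R) (ζ : ℕ → Input d S) :
    ρ.run (n + m) z ζ = ρ.run m (ρ.run n z ζ) (seqShift n ζ) := by
  induction n generalizing z ζ with
  | zero => simp
  | succ n ih => rw [show n + 1 + m = (n + m) + 1 by omega, run_succ, ih, run_succ,
      seqShift_seqShift, add_comm 1 n]

lemma run_succ' (n : ℕ) (z : State d R) (ζ : ℕ → Input d S) :
    ρ.run (n + 1) z ζ = ρ.step (ρ.run n z ζ) (ζ n) := by
  rw [run_add, run_succ]; simp

lemma run_congr (n : ℕ) (z : State d R) {ζ ζ' : ℕ → Input d S} (h : ∀ k < n, ζ k = ζ' k) :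
    ρ.run n z ζ = ρ.run n z ζ' := by
  induction n with
  | zero => rfl
  | succ n ih => rw [run_succ', run_succ', ih fun k hk => h k (by omega), h n (by omega)]

/-- The successive positions, as a function of the randomness of the edges and of the looks. -/
def path (x : Vertex d) (h : Edge d → Bool × ℝ) (v : ℕ → Direction d) (g : ℕ → ℝ)
    (q : (Edge d → R) × (ℕ → S)) : ℕ → Vertex d :=
  fun n => (ρ.run n (x, fun e => ((h e).1, (h e).2, q.1 e)) fun k => (v k, q.2 k, g k)).1

/-- A look changes the randomness of one edge only, so the rest of the path is again a `path`, with
an updated history. This self-similarity makes induction on the length possible. -/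
lemma path_eq_seqCons (x : Vertex d) (h : Edge d → Bool × ℝ) (v : ℕ → Direction d) (g : ℕ → ℝ)
    (q : (Edge d → R) × (ℕ → S)) (o : Bool)
    (ho : ρ.look (h (edgeToward x (v 0))).1 (h (edgeToward x (v 0))).2
      (q.1 (edgeToward x (v 0))) (q.2 0) = o) :
    ρ.path x h v g q = seqCons x (ρ.path (moved o x (v 0))
      (nextHistory h (edgeToward x (v 0)) o (g 0)) (seqShift 1 v) (seqShift 1 g)
      (Function.update q.1 (edgeToward x (v 0)) (ρ.next (h (edgeToward x (v 0))).2
        (q.1 (edgeToward x (v 0))) (q.2 0)), seqShift 1 q.2)) := by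
  funext n
  cases n with
  | zero => rfl
  | succ n =>
    simp only [path, run_succ, seqCons_succ]
    congr 2
    simp only [step, outcome, ho, Prod.mk.injEq, true_and]
    funext e
    by_cases he : e = edgeToward x (v 0)
    · subst he; simp [nextHistory]
    · simp [nextHistory, he]

section Law

variable [MeasurableSpace R] [MeasurableSpace S]

/-- The rule depends measurably on its arguments. -/
structure IsMeasurable : Prop where
  look : Measurable fun q : Bool × ℝ × R × S => ρ.look q.1 q.2.1 q.2.2.1 q.2.2.2
  next : Measurable fun q : ℝ × R × S => ρ.next q.1 q.2.1 q.2.2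

/-- The state seen has law `κ a b`, and it is independent of the randomness of the edge from
then on, whose law does not change. -/
def HasKernel (m : Measure R) (σ : Measure S) (κ : ℝ → Bool → Bool → ℝ≥0∞) : Prop :=
  ∀ (b o : Bool) (a : ℝ), 0 ≤ a → ∀ D : Set R, MeasurableSet D →
    (m.prod σ) {q | ρ.look b a q.1 q.2 = o ∧ ρ.next a q.1 q.2 ∈ D} = κ a b o * m D

variable {ρ}

lemma IsMeasurable.step (hρ : ρ.IsMeasurable) :
    Measurable fun q : State d R × Input d S => ρ.step q.1 q.2 := by
  have he : Measurable fun q : State d R × Input d S => edgeToward q.1.1 q.2.1 :=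
    (Measurable.of_discrete (f := fun q : Vertex d × Direction d => edgeToward q.1 q.2)).comp
      (by fun_prop : Measurable fun q : State d R × Input d S => (q.1.1, q.2.1))
  have hev : Measurable fun q : Edge d × (Edge d → Bool × ℝ × R) => q.2 q.1 :=
    measurable_from_prod_countable_right fun e => measurable_pi_apply e
  have hmem : Measurable fun q : State d R × Input d S => q.1.2 (edgeToward q.1.1 q.2.1) :=
    hev.comp (he.prodMk (by fun_prop))
  have ho : Measurable fun q : State d R × Input d S => ρ.outcome q.1 q.2 :=
    hρ.look.comp (by fun_prop : Measurable fun q : State d R × Input d S =>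
      ((q.1.2 (edgeToward q.1.1 q.2.1)).1, (q.1.2 (edgeToward q.1.1 q.2.1)).2.1,
        (q.1.2 (edgeToward q.1.1 q.2.1)).2.2, q.2.2.1))
  refine Measurable.prodMk ?_ (measurable_pi_iff.2 fun e => ?_)
  · exact (Measurable.of_discrete
      (f := fun q : Bool × Vertex d × Direction d => moved q.1 q.2.1 q.2.2)).comp
      (ho.prodMk (by fun_prop : Measurable fun q : State d R × Input d S => (q.1.1, q.2.1)))
  · refine Measurable.ite (he (measurableSet_singleton e) |>.congr ?_) ?_ (by fun_prop)
    · ext q; simp [eq_comm]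
    · refine ho.prodMk (Measurable.prodMk (by fun_prop) ?_)
      exact hρ.next.comp (by fun_prop : Measurable fun q : State d R × Input d S =>
        ((q.1.2 e).2.1, (q.1.2 e).2.2, q.2.2.1))

lemma IsMeasurable.run (hρ : ρ.IsMeasurable) (n : ℕ) :
    Measurable fun q : State d R × (ℕ → Input d S) => ρ.run n q.1 q.2 := by
  induction n with
  | zero => exact measurable_fst
  | succ n ih =>
    simp_rw [run_succ']
    exact hρ.step.comp (ih.prodMk (by fun_prop))

lemma IsMeasurable.path (hρ : ρ.IsMeasurable) (x : Vertex d) (h : Edge d → Bool × ℝ)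
    (v : ℕ → Direction d) (g : ℕ → ℝ) : Measurable (ρ.path x h v g) := by
  refine measurable_pi_iff.2 fun n => measurable_fst.comp ((hρ.run n).comp
    (by fun_prop : Measurable fun q : (Edge d → R) × (ℕ → S) =>
      ((x, fun e => ((h e).1, (h e).2, q.1 e)), fun k => (v k, q.2 k, g k))))

variable {m : Measure R} {σ : Measure S} [IsProbabilityMeasure m] [IsProbabilityMeasure σ]
  {κ : ℝ → Bool → Bool → ℝ≥0∞}

lemma prod_iid_apply_eq_lintegral_update {ι : Type*} [DecidableEq ι] (e : ι)
    {E : Set ((ι → R) × (ℕ → S))} (hE : MeasurableSet E) :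
    (Measure.infinitePi fun _ : ι => m).prod (iid σ) E =
      ∫⁻ r, (Measure.infinitePi fun _ : ι => m).prod (iid σ)
        {q | (Function.update q.1 e r, q.2) ∈ E} ∂m := by
  have h1 := ((measurePreserving_update m e).prod (MeasurePreserving.id (iid σ))).comp
    (measurePreserving_prodAssoc m (Measure.infinitePi fun _ : ι => m) (iid σ)).symm
  rw [← h1.measure_preimage hE.nullMeasurableSet, Measure.prod_apply (h1.measurable hE)]
  rfl

lemma prod_iid_apply_eq_lintegral_seqCons {Ω : Type*} [MeasurableSpace Ω] {P : Measure Ω}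
    [IsProbabilityMeasure P] {E : Set (Ω × (ℕ → S))} (hE : MeasurableSet E) :
    P.prod (iid σ) E = ∫⁻ s, P.prod (iid σ) {q | (q.1, seqCons s q.2) ∈ E} ∂σ := by
  have hmap : Measurable fun w : S × Ω × (ℕ → S) => (w.2.1, seqCons w.1 w.2.2) :=
    Measurable.prodMk (by fun_prop) (measurable_seqCons.comp
      (by fun_prop : Measurable fun w : S × Ω × (ℕ → S) => (w.1, w.2.2)))
  have hE' : ∀ s, MeasurableSet {q : Ω × (ℕ → S) | (q.1, seqCons s q.2) ∈ E} := fun s =>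
    (hmap.comp (measurable_prodMk_left (x := s))) hE
  simp_rw [Measure.prod_apply hE, Measure.prod_apply (hE' _)]
  rw [lintegral_lintegral_swap]
  · refine lintegral_congr fun x => ?_
    rw [iid_apply_eq_lintegral σ (measurable_prodMk_left hE)]
    rfl
  · have : Measurable fun w : (S × Ω) × (ℕ → S) => (w.1.2, seqCons w.1.1 w.2) :=
      Measurable.prodMk (by fun_prop) (measurable_seqCons.comp
        (by fun_prop : Measurable fun w : (S × Ω) × (ℕ → S) => (w.1.1, w.2)))
    exact (measurable_measure_prodMk_left (this hE)).aemeasurable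

/-- Everything is frozen except the randomness `r` of `e` and `s` of the first look. On the event
that the look gives `o`, the new randomness of `e` has law `κ a b o • m` (`hlaw`), and integrating
against `m` undoes the freezing of `e`. -/
lemma HasKernel.measure_look (hκ : ρ.HasKernel m σ κ) (hρ : ρ.IsMeasurable) {ι : Type*}
    [DecidableEq ι] (e : ι) (b o : Bool) {a : ℝ} (ha : 0 ≤ a) {A : Set ((ι → R) × (ℕ → S))}
    (hA : MeasurableSet A) :
    (Measure.infinitePi fun _ : ι => m).prod (iid σ)
      {q | ρ.look b a (q.1 e) (q.2 0) = o ∧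
        (Function.update q.1 e (ρ.next a (q.1 e) (q.2 0)), seqShift 1 q.2) ∈ A} =
    κ a b o * (Measure.infinitePi fun _ : ι => m).prod (iid σ) A := by
  set P := Measure.infinitePi fun _ : ι => m
  have hlook : Measurable fun q : R × S => ρ.look b a q.1 q.2 :=
    hρ.look.comp (by fun_prop : Measurable fun q : R × S => (b, a, q.1, q.2))
  have hnext : Measurable fun q : R × S => ρ.next a q.1 q.2 :=
    hρ.next.comp (by fun_prop : Measurable fun q : R × S => (a, q.1, q.2))
  have hupd : Measurable fun w : R × (ι → R) × (ℕ → S) => (Function.update w.2.1 e w.1, w.2.2) :=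
    Measurable.prodMk ((measurePreserving_update m e).measurable.comp
      (by fun_prop : Measurable fun w : R × (ι → R) × (ℕ → S) => (w.1, w.2.1))) (by fun_prop)
  have hmap : Measurable fun q : (ι → R) × (ℕ → S) =>
      (Function.update q.1 e (ρ.next a (q.1 e) (q.2 0)), seqShift 1 q.2) :=
    hupd.comp (Measurable.prodMk (hnext.comp
      (by fun_prop : Measurable fun q : (ι → R) × (ℕ → S) => (q.1 e, q.2 0)))
      (Measurable.prodMk (by fun_prop) ((measurable_seqShift 1).comp measurable_snd)))
  have hE : MeasurableSet {q : (ι → R) × (ℕ → S) | ρ.look b a (q.1 e) (q.2 0) = o ∧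
        (Function.update q.1 e (ρ.next a (q.1 e) (q.2 0)), seqShift 1 q.2) ∈ A} := by
    refine MeasurableSet.inter ?_ (hmap hA)
    exact (hlook.comp (by fun_prop : Measurable fun q : (ι → R) × (ℕ → S) => (q.1 e, q.2 0)))
      (measurableSet_singleton o)
  set G : R → ℝ≥0∞ := fun r => P.prod (iid σ) {q | (Function.update q.1 e r, q.2) ∈ A}
  have hG : Measurable G := measurable_measure_prodMk_left (hupd hA)
  have hlaw : ((m.prod σ).restrict {q | ρ.look b a q.1 q.2 = o}).map
      (fun q => ρ.next a q.1 q.2) = κ a b o • m := by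
    ext D hD
    rw [Measure.map_apply hnext hD, Measure.restrict_apply (hnext hD), Measure.smul_apply,
      smul_eq_mul, ← hκ b o a ha D hD]
    congr 1
    ext q
    simp [and_comm]
  rw [prod_iid_apply_eq_lintegral_update e hE, prod_iid_apply_eq_lintegral_update e hA]
  have h1 : ∀ r, P.prod (iid σ) {q | (Function.update q.1 e r, q.2) ∈
      {q : (ι → R) × (ℕ → S) | ρ.look b a (q.1 e) (q.2 0) = o ∧
        (Function.update q.1 e (ρ.next a (q.1 e) (q.2 0)), seqShift 1 q.2) ∈ A}} =
      ∫⁻ s, {q : R × S | ρ.look b a q.1 q.2 = o}.indicator (fun q => G (ρ.next a q.1 q.2))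
        (r, s) ∂σ := by
    intro r
    have hEr : MeasurableSet {q : (ι → R) × (ℕ → S) | (Function.update q.1 e r, q.2) ∈
        {q : (ι → R) × (ℕ → S) | ρ.look b a (q.1 e) (q.2 0) = o ∧
          (Function.update q.1 e (ρ.next a (q.1 e) (q.2 0)), seqShift 1 q.2) ∈ A}} :=
      (hupd.comp (measurable_prodMk_left (x := r))) hE
    rw [prod_iid_apply_eq_lintegral_seqCons hEr]
    refine lintegral_congr fun s => ?_
    by_cases hs : ρ.look b a r s = o
    · rw [Set.indicator_of_mem (by exact hs)]
      simp [G, hs]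
    · rw [Set.indicator_of_notMem (by exact hs)]
      simp [hs]
  have hset : MeasurableSet {q : R × S | ρ.look b a q.1 q.2 = o} :=
    hlook (measurableSet_singleton o)
  have hGn : Measurable fun q : R × S => G (ρ.next a q.1 q.2) := hG.comp hnext
  rw [lintegral_congr h1, ← lintegral_prod _ (hGn.indicator hset).aemeasurable,
    lintegral_indicator hset, ← lintegral_map hG hnext, hlaw, lintegral_smul_measure, smul_eq_mul]

lemma measurableSet_cylinder (n : ℕ) (c : ℕ → Vertex d) :
    MeasurableSet {y : ℕ → Vertex d | ∀ k < n, y k = c k} := by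
  simp only [Set.ofPred_forall]
  exact .iInter fun k => .iInter fun _ => measurable_pi_apply k (measurableSet_singleton _)

/-- The recursion for cylinder probabilities: the rule enters through `κ` and through shorter
cylinders only. -/
lemma HasKernel.measure_path_succ (hκ : ρ.HasKernel m σ κ) (hρ : ρ.IsMeasurable)
    (x : Vertex d) (h : Edge d → Bool × ℝ) (hh : ∀ e, 0 ≤ (h e).2) (v : ℕ → Direction d)
    (g : ℕ → ℝ) (n : ℕ) (c : ℕ → Vertex d) :
    (Measure.infinitePi fun _ : Edge d => m).prod (iid σ)
        (ρ.path x h v g ⁻¹' {y | ∀ k < n + 1, y k = c k}) =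
      if x = c 0 then ∑ o : Bool, κ (h (edgeToward x (v 0))).2 (h (edgeToward x (v 0))).1 o *
        (Measure.infinitePi fun _ : Edge d => m).prod (iid σ)
        (ρ.path (moved o x (v 0)) (nextHistory h (edgeToward x (v 0)) o (g 0)) (seqShift 1 v)
          (seqShift 1 g) ⁻¹' {y | ∀ k < n, y k = c (k + 1)}) else 0 := by
  set e := edgeToward x (v 0) with he
  split_ifs with hx
  · have hA : ∀ o, MeasurableSet (ρ.path (moved o x (v 0)) (nextHistory h e o (g 0))
        (seqShift 1 v) (seqShift 1 g) ⁻¹' {y | ∀ k < n, y k = c (k + 1)}) := fun o =>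
      (hρ.path _ _ _ _) (measurableSet_cylinder n fun k => c (k + 1))
    have hsplit : ∀ o, ρ.path x h v g ⁻¹' {y | ∀ k < n + 1, y k = c k} ∩
        {q | ρ.look (h e).1 (h e).2 (q.1 e) (q.2 0) = o} =
        {q | ρ.look (h e).1 (h e).2 (q.1 e) (q.2 0) = o ∧
          (Function.update q.1 e (ρ.next (h e).2 (q.1 e) (q.2 0)), seqShift 1 q.2) ∈
          ρ.path (moved o x (v 0)) (nextHistory h e o (g 0)) (seqShift 1 v)
            (seqShift 1 g) ⁻¹' {y | ∀ k < n, y k = c (k + 1)}} := by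
      intro o
      ext q
      simp only [Set.mem_inter_iff, Set.mem_preimage, Set.mem_ofPred_eq]
      rw [and_comm]
      refine and_congr_right fun ho => ?_
      rw [path_eq_seqCons ρ x h v g q o ho]
      constructor
      · exact fun H k hk => H (k + 1) (by omega)
      · rintro H (_ | k) hk
        · exact hx
        · exact H k (by omega)
    have hm : MeasurableSet {q : (Edge d → R) × (ℕ → S) |
        ρ.look (h e).1 (h e).2 (q.1 e) (q.2 0) = true} :=
      (hρ.look.comp (by fun_prop : Measurable fun q : (Edge d → R) × (ℕ → S) =>
        ((h e).1, (h e).2, q.1 e, q.2 0))) (measurableSet_singleton true)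
    rw [← measure_inter_add_sdiff _ hm]
    have hdiff : ∀ B : Set ((Edge d → R) × (ℕ → S)),
        B \ {q | ρ.look (h e).1 (h e).2 (q.1 e) (q.2 0) = true} =
        B ∩ {q | ρ.look (h e).1 (h e).2 (q.1 e) (q.2 0) = false} := by
      intro B; ext q; simp
    rw [hdiff, hsplit, hsplit, hκ.measure_look hρ e _ _ (hh e) (hA true),
      hκ.measure_look hρ e _ _ (hh e) (hA false)]
    simp
  · convert measure_empty (μ := (Measure.infinitePi fun _ : Edge d => m).prod (iid σ))
    ext q
    simp only [Set.mem_preimage, Set.mem_ofPred_eq, Set.mem_empty_iff_false, iff_false]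
    exact fun H => hx (H 0 (by omega))

/-- The law of the successive positions depends on the rule through its kernel only. -/
lemma HasKernel.measure_path_eq {R' S' : Type*} [MeasurableSpace R'] [MeasurableSpace S']
    {ρ' : LookRule R' S'} {m' : Measure R'} {σ' : Measure S'} [IsProbabilityMeasure m']
    [IsProbabilityMeasure σ'] (hκ : ρ.HasKernel m σ κ) (hρ : ρ.IsMeasurable)
    (hκ' : ρ'.HasKernel m' σ' κ) (hρ' : ρ'.IsMeasurable)
    (x : Vertex d) (h : Edge d → Bool × ℝ) (hh : ∀ e, 0 ≤ (h e).2) (v : ℕ → Direction d)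
    (g : ℕ → ℝ) :
    ((Measure.infinitePi fun _ : Edge d => m).prod (iid σ)).map (ρ.path x h v g) =
    ((Measure.infinitePi fun _ : Edge d => m').prod (iid σ')).map (ρ'.path x h v g) := by
  have hcyl : ∀ (n : ℕ) (c : ℕ → Vertex d), (Measure.infinitePi fun _ : Edge d => m).prod (iid σ)
      (ρ.path x h v g ⁻¹' {y | ∀ k < n, y k = c k}) =
      (Measure.infinitePi fun _ : Edge d => m').prod (iid σ')
      (ρ'.path x h v g ⁻¹' {y | ∀ k < n, y k = c k}) := by
    intro n c
    -- Both rules satisfy the recursion of `measure_path_succ` with the same coefficients.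
    induction n generalizing x h v g c with
    | zero => simp
    | succ n ih =>
      rw [hκ.measure_path_succ hρ x h hh, hκ'.measure_path_succ hρ' x h hh]
      split_ifs
      · refine Finset.sum_congr rfl fun o _ => ?_
        rw [ih]
        intro e
        unfold nextHistory
        split_ifs
        · exact abs_nonneg _
        · exact add_nonneg (hh e) (abs_nonneg _)
      · rfl
  have := Measure.isProbabilityMeasure_map
    (μ := (Measure.infinitePi fun _ : Edge d => m).prod (iid σ)) (hρ.path x h v g).aemeasurable
  have := Measure.isProbabilityMeasure_map
    (μ := (Measure.infinitePi fun _ : Edge d => m').prod (iid σ')) (hρ'.path x h v g).aemeasurable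
  refine measure_ext_of_cylinder fun n c => ?_
  rw [Measure.map_apply (hρ.path x h v g) (measurableSet_cylinder n c),
    Measure.map_apply (hρ'.path x h v g) (measurableSet_cylinder n c), hcyl]

end Law

end LookRule

end DynPerc

namespace DynPerc

open scoped ENNReal

/-! ### Arrival times, and restarting a clock at a given time -/

section Clock

/-- The waiting times are positive and there are finitely many arrivals in bounded time. -/
structure IsClock (gap : ℕ → ℝ) : Prop where
  pos : ∀ n, 0 < gap n
  tendsto : Tendsto (arrivalTime gap) atTop atTop

lemma arrivalTime_zero (gap : ℕ → ℝ) : arrivalTime gap 0 = gap 0 := by simp [arrivalTime]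

lemma arrivalTime_succ (gap : ℕ → ℝ) (n : ℕ) :
    arrivalTime gap (n + 1) = arrivalTime gap n + gap (n + 1) := by
  simp [arrivalTime, Finset.sum_range_succ]

lemma arrivalTime_succ' (gap : ℕ → ℝ) (n : ℕ) :
    arrivalTime gap (n + 1) = gap 0 + arrivalTime (seqShift 1 gap) n := by
  rw [arrivalTime, Finset.sum_range_succ', add_comm]
  simp [arrivalTime, add_comm 1]

lemma IsClock.strictMono {gap : ℕ → ℝ} (h : IsClock gap) : StrictMono (arrivalTime gap) :=
  strictMono_nat_of_lt_succ fun n => by rw [arrivalTime_succ]; linarith [h.pos (n + 1)]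

lemma isClock_iff_seqShift {gap : ℕ → ℝ} :
    IsClock gap ↔ 0 < gap 0 ∧ IsClock (seqShift 1 gap) := by
  have hs : (fun n => arrivalTime gap (n + 1)) =
      fun n => gap 0 + arrivalTime (seqShift 1 gap) n := funext (arrivalTime_succ' gap)
  constructor
  · intro h
    refine ⟨h.pos 0, fun n => h.pos _, ?_⟩
    have := (tendsto_add_atTop_iff_nat 1).2 h.tendsto
    rw [hs] at this
    exact (tendsto_atTop_add_const_left _ (-gap 0) this).congr fun n => by ring
  · rintro ⟨h0, h⟩
    refine ⟨fun n => ?_, ?_⟩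
    · cases n with
      | zero => exact h0
      | succ n => simpa [add_comm] using h.pos n
    · refine (tendsto_add_atTop_iff_nat 1).1 ?_
      rw [hs]
      exact tendsto_atTop_add_const_left _ _ h.tendsto

lemma IsClock.finite {gap : ℕ → ℝ} (h : IsClock gap) (t : ℝ) :
    {n : ℕ | arrivalTime gap n ≤ t}.Finite := by
  obtain ⟨N, hN⟩ := (h.tendsto.eventually_gt_atTop t).exists
  exact (Set.finite_lt_nat N).subset fun n hn =>
    h.strictMono.lt_iff_lt.1 (lt_of_le_of_lt hn hN)

lemma arrivalCount_of_lt {gap : ℕ → ℝ} (h : IsClock gap) {t : ℝ} (ht : t < gap 0) :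
    arrivalCount gap t = 0 := by
  have : {n : ℕ | arrivalTime gap n ≤ t} = ∅ := by
    ext n
    simp only [Set.mem_ofPred_eq, Set.mem_empty_iff_false, iff_false, not_le]
    have := h.strictMono.monotone (Nat.zero_le n)
    rw [arrivalTime_zero] at this
    linarith
  rw [arrivalCount, this, Set.ncard_empty]

lemma arrivalCount_of_le {gap : ℕ → ℝ} (h : IsClock gap) {t : ℝ} (ht : gap 0 ≤ t) :
    arrivalCount gap t = arrivalCount (seqShift 1 gap) (t - gap 0) + 1 := by
  have hs := (isClock_iff_seqShift.1 h).2
  have : {n : ℕ | arrivalTime gap n ≤ t} =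
      insert 0 (Nat.succ '' {n : ℕ | arrivalTime (seqShift 1 gap) n ≤ t - gap 0}) := by
    ext n
    cases n with
    | zero => simp [arrivalTime_zero, ht]
    | succ n =>
      simp only [Set.mem_ofPred_eq, arrivalTime_succ', Set.mem_insert_iff, Set.mem_image]
      constructor
      · exact fun h => .inr ⟨n, by linarith, rfl⟩
      · rintro (h | ⟨k, hk, hkn⟩)
        · omega
        · obtain rfl : k = n := by omega
          linarith
  rw [arrivalCount, this, Set.ncard_insert_of_notMem (by simp) ((hs.finite _).image _),
    Set.ncard_image_of_injective _ Nat.succ_injective, arrivalCount]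

lemma arrivalCount_eq_of_lt {gap : ℕ → ℝ} (h : IsClock gap) {n : ℕ} {t : ℝ}
    (ht : arrivalTime gap n ≤ t) (ht' : t < arrivalTime gap (n + 1)) :
    arrivalCount gap t = n + 1 := by
  have : {k : ℕ | arrivalTime gap k ≤ t} = Set.Iio (n + 1) := by
    ext k
    simp only [Set.mem_ofPred_eq, Set.mem_Iio]
    constructor
    · exact fun hk => h.strictMono.lt_iff_lt.1 (lt_of_le_of_lt hk ht')
    · exact fun hk => (h.strictMono.monotone (by omega)).trans ht
  rw [arrivalCount, this, ← Finset.coe_Iio, Set.ncard_coe_finset, Nat.card_Iio]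

lemma le_arrivalCount {gap : ℕ → ℝ} (h : IsClock gap) {n : ℕ} {t : ℝ}
    (ht : arrivalTime gap n ≤ t) : n + 1 ≤ arrivalCount gap t := by
  have : Set.Iio (n + 1) ⊆ {k : ℕ | arrivalTime gap k ≤ t} := fun k hk =>
    (h.strictMono.monotone (Nat.lt_succ_iff.1 hk)).trans ht
  have := Set.ncard_le_ncard this (h.finite t)
  rwa [← Finset.coe_Iio, Set.ncard_coe_finset, Nat.card_Iio] at this

/-- The waiting times of a sequence of marked arrivals. -/
def gaps {T : Type*} (r : ℕ → ℝ × T) : ℕ → ℝ := fun n => (r n).1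

lemma edgeState_of_lt (b : Bool) {r : ℕ → ℝ × Bool} (h : IsClock (gaps r)) {t : ℝ}
    (ht : t < (r 0).1) : edgeState b r t = b := by
  have := arrivalCount_of_lt h ht
  unfold gaps at this
  simp [edgeState, this]

lemma edgeState_of_le (b : Bool) {r : ℕ → ℝ × Bool} (h : IsClock (gaps r)) {t : ℝ}
    (ht : (r 0).1 ≤ t) :
    edgeState b r t = edgeState (r 0).2 (seqShift 1 r) (t - (r 0).1) := by
  have h1 := arrivalCount_of_le h ht
  have h2 : seqShift 1 (gaps r) = fun n => (seqShift 1 r n).1 := rfl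
  rw [h2] at h1
  unfold gaps at h1
  unfold edgeState
  rw [h1]
  rcases arrivalCount (fun n => (seqShift 1 r n).1) (t - (r 0).1) with _ | n
  · rfl
  · simp [add_comm]

/-- The sequence of marked arrivals after time `a`. -/
noncomputable def arrivalsAfter {T : Type*} (a : ℝ) (r : ℕ → ℝ × T) : ℕ → ℝ × T :=
  let N := arrivalCount (gaps r) a
  seqCons (arrivalTime (gaps r) N - a, (r N).2) (seqShift (N + 1) r)

lemma arrivalsAfter_of_lt {T : Type*} {r : ℕ → ℝ × T} (h : IsClock (gaps r)) {a : ℝ}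
    (ha : a < (r 0).1) :
    arrivalsAfter a r = seqCons ((r 0).1 - a, (r 0).2) (seqShift 1 r) := by
  simp only [arrivalsAfter, arrivalCount_of_lt h ha, arrivalTime_zero]
  rfl

lemma arrivalsAfter_of_le {T : Type*} {r : ℕ → ℝ × T} (h : IsClock (gaps r)) {a : ℝ}
    (ha : (r 0).1 ≤ a) : arrivalsAfter a r = arrivalsAfter (a - (r 0).1) (seqShift 1 r) := by
  have h1 := arrivalCount_of_le h ha
  have h2 : gaps (seqShift 1 r) = seqShift 1 (gaps r) := rfl
  simp only [arrivalsAfter, h1, h2, arrivalTime_succ', seqShift_seqShift]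
  have h3 : arrivalCount (seqShift 1 (gaps r)) (a - gaps r 0) =
    arrivalCount (seqShift 1 (gaps r)) (a - (r 0).1) := rfl
  rw [h3]
  congr 1
  · simp [gaps, add_comm]; ring
  · rw [show ∀ n : ℕ, 1 + (n + 1) = n + 1 + 1 by intro n; omega]

/-- The flow property of an edge: the state at time `a` and the arrivals after `a` determine its
future. Induction on the number of arrivals up to `a` removes the first arrival at each stage. -/
lemma edgeState_add (b : Bool) {r : ℕ → ℝ × Bool} (h : IsClock (gaps r)) {a : ℝ} :
    IsClock (gaps (arrivalsAfter a r)) ∧ ∀ t, 0 ≤ t →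
      edgeState b r (a + t) = edgeState (edgeState b r a) (arrivalsAfter a r) t := by
  induction hN : arrivalCount (gaps r) a generalizing b r a with
  | zero =>
    have ha : a < (r 0).1 := by
      by_contra! ha
      have := arrivalCount_of_le h ha
      omega
    have hc : IsClock (gaps (seqCons ((r 0).1 - a, (r 0).2) (seqShift 1 r))) :=
      isClock_iff_seqShift.2 ⟨by simpa [gaps] using ha, by
        convert (isClock_iff_seqShift.1 h).2 using 1
        funext k; simp [gaps, add_comm 1 k]⟩
    rw [arrivalsAfter_of_lt h ha, edgeState_of_lt b h ha]
    refine ⟨hc, fun t ht => ?_⟩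
    rcases lt_or_ge (a + t) (r 0).1 with hat | hat
    · rw [edgeState_of_lt b h hat, edgeState_of_lt b hc (by simp; linarith)]
    · rw [edgeState_of_le b h hat, edgeState_of_le b hc (by simp; linarith)]
      have : seqShift 1 (seqCons ((r 0).1 - a, (r 0).2) (seqShift 1 r)) = seqShift 1 r := by
        funext k; simp [add_comm 1 k]
      rw [this]
      simp only [seqCons_zero]
      congr 1; ring
  | succ N ih =>
    have ha : (r 0).1 ≤ a := by
      by_contra! ha
      have := arrivalCount_of_lt h ha
      omega
    have hs : IsClock (gaps (seqShift 1 r)) := (isClock_iff_seqShift.1 h).2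
    obtain ⟨h1, h2⟩ := ih (r 0).2 hs (a := a - (r 0).1) (by
      have := arrivalCount_of_le h ha
      have e : arrivalCount (gaps (seqShift 1 r)) (a - (r 0).1) =
        arrivalCount (seqShift 1 (gaps r)) (a - gaps r 0) := rfl
      omega)
    rw [arrivalsAfter_of_le h ha, edgeState_of_le b h ha]
    refine ⟨h1, fun t ht => ?_⟩
    rw [edgeState_of_le b h (by linarith), ← h2 t ht]
    congr 1; ring

lemma measurable_arrivalCount {Ω : Type*} [MeasurableSpace Ω] {gap : Ω → ℕ → ℝ} {t : Ω → ℝ}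
    (hgap : Measurable gap) (ht : Measurable t) :
    Measurable fun ω => arrivalCount (gap ω) (t ω) := by
  refine measurable_ncard.comp (measurable_set_iff.2 fun n => ?_)
  refine measurableSet_setOfPred.1 (measurableSet_le ?_ ht)
  unfold arrivalTime
  fun_prop

end Clock

end DynPerc

namespace DynPerc

open scoped ENNReal

/-! ### Poisson clocks, memorylessness and the renewal equation -/

section ExpClock

variable {r : ℝ}

lemma lintegral_exp_neg_lt_one (hr : 0 < r) {c : ℝ} (hc : 0 < c) :
    ∫⁻ x, ENNReal.ofReal (Real.exp (-(c * x))) ∂expMeasure r < 1 := by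
  have := isProbabilityMeasure_expMeasure hr
  have hle : (fun x => ENNReal.ofReal (Real.exp (-(c * x)))) ≤ᵐ[expMeasure r] fun _ => 1 := by
    filter_upwards [ae_pos_expMeasure hr] with x hx
    exact ENNReal.ofReal_le_one.2 (Real.exp_le_one_iff.2 (by nlinarith))
  have hint : ∫⁻ x, ENNReal.ofReal (Real.exp (-(c * x))) ∂expMeasure r ≤ 1 := by
    simpa using lintegral_mono_ae hle
  calc _ < ∫⁻ _, 1 ∂expMeasure r := by
        refine lintegral_strict_mono (IsProbabilityMeasure.ne_zero _) aemeasurable_const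
          (ne_top_of_le_ne_top ENNReal.one_ne_top hint) ?_
        filter_upwards [ae_pos_expMeasure hr] with x hx
        rw [ENNReal.ofReal_lt_one, ← Real.exp_zero]
        exact Real.exp_lt_exp.2 (by nlinarith)
    _ = 1 := by simp

lemma measurable_arrivalTime (n : ℕ) : Measurable fun gap : ℕ → ℝ => arrivalTime gap n := by
  unfold arrivalTime
  fun_prop

lemma lintegral_exp_neg_arrivalTime (hr : 0 < r) (c : ℝ) (n : ℕ) :
    ∫⁻ gap, ENNReal.ofReal (Real.exp (-(c * arrivalTime gap n))) ∂iid (expMeasure r) =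
      (∫⁻ x, ENNReal.ofReal (Real.exp (-(c * x))) ∂expMeasure r) ^ (n + 1) := by
  have := isProbabilityMeasure_expMeasure hr
  induction n with
  | zero =>
    simp_rw [arrivalTime_zero]
    rw [zero_add, pow_one]
    exact (measurePreserving_eval_infinitePi (fun _ : ℕ => expMeasure r) 0).lintegral_comp
      (f := fun x => ENNReal.ofReal (Real.exp (-(c * x)))) (by fun_prop)
  | succ n ih =>
    have hm : Measurable fun gap : ℕ → ℝ => ENNReal.ofReal (Real.exp (-(c * arrivalTime gap n))) :=
      ((measurable_arrivalTime n).const_mul c).neg.exp.ennreal_ofReal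
    rw [lintegral_iid (f := fun gap => ENNReal.ofReal (Real.exp (-(c * arrivalTime gap (n + 1))))) _
        ((measurable_arrivalTime _).const_mul c).neg.exp.ennreal_ofReal,
      pow_succ', ← lintegral_mul_const _ (by fun_prop), ← ih]
    refine lintegral_congr fun x => ?_
    rw [← lintegral_const_mul _ hm]
    refine lintegral_congr fun gap => ?_
    rw [arrivalTime_succ', ← ENNReal.ofReal_mul (Real.exp_nonneg _), ← Real.exp_add]
    have : seqShift 1 (seqCons x gap) = gap := by
      simp
    rw [this, seqCons_zero]
    congr 2; ring

/-- The expectations of `exp(-T n)`, with `T n` the arrival times, are powers of a number below one.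
Hence their sum is finite, and `exp(-T n)` tends to zero almost surely. -/
lemma ae_isClock_iid (hr : 0 < r) : ∀ᵐ gap ∂iid (expMeasure r), IsClock gap := by
  have := isProbabilityMeasure_expMeasure hr
  have h1 : ∀ᵐ gap ∂iid (expMeasure r), ∀ n, 0 < gap n := ae_all_iff.2 fun n =>
    (measurePreserving_eval_infinitePi (fun _ : ℕ => expMeasure r) n).quasiMeasurePreserving.ae
      (ae_pos_expMeasure hr)
  have hm : ∀ n, Measurable fun gap : ℕ → ℝ => ENNReal.ofReal (Real.exp (-(1 * arrivalTime gap n))) :=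
    fun n => ((measurable_arrivalTime n).const_mul 1).neg.exp.ennreal_ofReal
  have h2 : ∫⁻ gap, ∑' n, ENNReal.ofReal (Real.exp (-(1 * arrivalTime gap n)))
      ∂iid (expMeasure r) ≠ ∞ := by
    rw [lintegral_tsum fun n => (hm n).aemeasurable]
    simp_rw [lintegral_exp_neg_arrivalTime hr]
    have hlt := lintegral_exp_neg_lt_one hr one_pos
    rw [ENNReal.tsum_geometric_add_one]
    refine ENNReal.mul_ne_top (ne_top_of_lt (hlt.trans ENNReal.one_lt_top)) ?_
    exact ENNReal.inv_ne_top.2 (tsub_pos_of_lt hlt).ne'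
  filter_upwards [h1, ae_lt_top (Measurable.tsum fun n => hm n) h2] with gap hpos hsum
  refine ⟨hpos, ?_⟩
  have h3 := ENNReal.tendsto_atTop_zero_of_tsum_ne_top hsum.ne
  have h4 : Tendsto (fun n => Real.exp (-(1 * arrivalTime gap n))) atTop (nhds 0) := by
    have := (ENNReal.tendsto_toReal ENNReal.zero_ne_top).comp h3
    simpa [Function.comp_def, ENNReal.toReal_ofReal (Real.exp_nonneg _)] using this
  have h5 := Real.tendsto_exp_comp_nhds_zero.1 h4
  simpa using tendsto_neg_atBot_iff.1 h5

lemma measurePreserving_gaps {T : Type*} [MeasurableSpace T] (hr : 0 < r) (β : Measure T)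
    [IsProbabilityMeasure β] :
    MeasurePreserving (gaps (T := T)) (iid ((expMeasure r).prod β)) (iid (expMeasure r)) := by
  have := isProbabilityMeasure_expMeasure hr
  refine ⟨by unfold gaps; fun_prop, ?_⟩
  refine (Measure.infinitePi_map_pi (fun _ : ℕ => (expMeasure r).prod β)
    (f := fun _ x => x.1) fun _ => measurable_fst).trans ?_
  simp [iid]

lemma ae_isClock_gaps {T : Type*} [MeasurableSpace T] (hr : 0 < r) (β : Measure T)
    [IsProbabilityMeasure β] : ∀ᵐ q ∂iid ((expMeasure r).prod β), IsClock (gaps q) :=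
  (measurePreserving_gaps hr β).quasiMeasurePreserving.ae (ae_isClock_iid hr)

/-- Memorylessness, tested on half-lines. -/
lemma map_sub_restrict_expMeasure (hr : 0 < r) {t : ℝ} (ht : 0 ≤ t) :
    ((expMeasure r).restrict (Set.Ioi t)).map (fun x => x - t) =
      ENNReal.ofReal (Real.exp (-(r * t))) • expMeasure r := by
  have := isProbabilityMeasure_expMeasure hr
  have hm : Measurable fun x : ℝ => x - t := by fun_prop
  refine Measure.ext_of_Iic _ _ fun a => ?_
  rw [Measure.map_apply hm measurableSet_Iic, Measure.restrict_apply (hm measurableSet_Iic),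
    Measure.smul_apply, smul_eq_mul]
  rcases lt_or_ge a 0 with ha | ha
  · have h1 : (fun x => x - t) ⁻¹' Set.Iic a ∩ Set.Ioi t = ∅ := by
      ext x; simp only [Set.mem_inter_iff, Set.mem_preimage, Set.mem_Iic, Set.mem_Ioi,
        Set.mem_empty_iff_false, iff_false]; rintro ⟨h, h'⟩; linarith
    have h2 : expMeasure r (Set.Iic a) = 0 :=
      measure_mono_null (Set.Iic_subset_Iic.2 ha.le) (by rw [expMeasure_Iic hr 0 le_rfl]; simp)
    rw [h1, h2, measure_empty, mul_zero]
  · have h1 : (fun x => x - t) ⁻¹' Set.Iic a ∩ Set.Ioi t = Set.Iic (t + a) \ Set.Iic t := by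
      ext x; simp only [Set.mem_inter_iff, Set.mem_preimage, Set.mem_Iic, Set.mem_Ioi,
        Set.mem_sdiff, not_le]
      constructor <;> rintro ⟨h, h'⟩ <;> constructor <;> linarith
    rw [h1, measure_sdiff (Set.Iic_subset_Iic.2 (by linarith)) measurableSet_Iic.nullMeasurableSet
      (measure_ne_top _ _), expMeasure_Iic hr _ (by linarith), expMeasure_Iic hr _ ht,
      expMeasure_Iic hr _ ha, ← ENNReal.ofReal_sub, ← ENNReal.ofReal_mul (Real.exp_nonneg _)]
    · congr 1
      rw [mul_add, neg_add, Real.exp_add]; ring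
    · have : Real.exp (-(r * t)) ≤ 1 := Real.exp_le_one_iff.2 (by nlinarith)
      linarith

lemma setLIntegral_sub_expMeasure (hr : 0 < r) {t : ℝ} (ht : 0 ≤ t) {f : ℝ → ℝ≥0∞}
    (hf : Measurable f) :
    ∫⁻ x in Set.Ioi t, f (x - t) ∂expMeasure r =
      ENNReal.ofReal (Real.exp (-(r * t))) * ∫⁻ x, f x ∂expMeasure r := by
  rw [← lintegral_map hf (by fun_prop : Measurable fun x : ℝ => x - t),
    map_sub_restrict_expMeasure hr ht, lintegral_smul_measure, smul_eq_mul]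

lemma expMeasure_Ioc {μ : ℝ} (hμ : 0 < μ) (s : ℝ) :
    expMeasure μ (Set.Ioc 0 s) = expMeasure μ (Set.Iic s) := by
  refine measure_congr ?_
  filter_upwards [ae_pos_expMeasure hμ] with x hx
  exact propext ⟨fun h => h.2, fun h => ⟨hx, h⟩⟩

/-- Bounded solutions of this renewal equation are constant. -/
lemma eq_of_renewal_equation (hr : 0 < r) {w : ℝ → ℝ≥0∞} {c : ℝ≥0∞} (hw : ∀ t, w t ≤ 1)
    (hc : c ≤ 1)
    (h : ∀ t, 0 ≤ t → w t = c * expMeasure r (Set.Ioi t) +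
      ∫⁻ x in Set.Ioc 0 t, w (t - x) ∂expMeasure r) {t : ℝ} (ht : 0 ≤ t) : w t = c := by
  have := isProbabilityMeasure_expMeasure hr
  set q := expMeasure r (Set.Iic t) with hq
  have hq1 : q < 1 := by
    rw [hq, expMeasure_Iic hr t ht, ENNReal.ofReal_lt_one]
    linarith [Real.exp_pos (-(r * t))]
  have hadd : ∀ s, expMeasure r (Set.Ioi s) + expMeasure r (Set.Iic s) = 1 := by
    intro s
    rw [add_comm, ← Set.compl_Iic, measure_add_measure_compl measurableSet_Iic, measure_univ]
  -- The constant `c` solves the equation too. Each application of the equation on `[0, t]` shrinks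
  -- the distance to `c` by the factor `q < 1`. Two one-sided bounds avoid subtraction in `ℝ≥0∞`.
  have key : ∀ k : ℕ, ∀ s, 0 ≤ s → s ≤ t → w s ≤ c + q ^ k ∧ c ≤ w s + q ^ k := by
    intro k
    induction k with
    | zero => exact fun s _ _ => ⟨by rw [pow_zero]; exact (hw s).trans le_add_self,
      by rw [pow_zero]; exact hc.trans le_add_self⟩
    | succ k ih =>
      intro s hs hst
      have hqs : expMeasure r (Set.Iic s) ≤ q := measure_mono (Set.Iic_subset_Iic.2 hst)
      constructor
      · calc w s = c * expMeasure r (Set.Ioi s) +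
            ∫⁻ x in Set.Ioc 0 s, w (s - x) ∂expMeasure r := h s hs
          _ ≤ c * expMeasure r (Set.Ioi s) + ∫⁻ x in Set.Ioc 0 s, (c + q ^ k) ∂expMeasure r := by
            refine add_le_add le_rfl (setLIntegral_mono' measurableSet_Ioc fun x hx => ?_)
            exact (ih (s - x) (by linarith [hx.2]) (by linarith [hx.1])).1
          _ = c * (expMeasure r (Set.Ioi s) + expMeasure r (Set.Iic s)) +
              expMeasure r (Set.Iic s) * q ^ k := by
            rw [setLIntegral_const, expMeasure_Ioc hr s]; ring
          _ ≤ c + q ^ (k + 1) := by rw [hadd, mul_one, pow_succ']; gcongr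
      · calc c = c * (expMeasure r (Set.Ioi s) + expMeasure r (Set.Iic s)) := by
              rw [hadd, mul_one]
          _ = c * expMeasure r (Set.Ioi s) + ∫⁻ x in Set.Ioc 0 s, c ∂expMeasure r := by
              rw [setLIntegral_const, expMeasure_Ioc hr s]; ring
          _ ≤ c * expMeasure r (Set.Ioi s) +
              ∫⁻ x in Set.Ioc 0 s, (w (s - x) + q ^ k) ∂expMeasure r := by
              refine add_le_add le_rfl (setLIntegral_mono' measurableSet_Ioc fun x hx => ?_)
              exact (ih (s - x) (by linarith [hx.2]) (by linarith [hx.1])).2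
          _ = w s + expMeasure r (Set.Iic s) * q ^ k := by
              rw [lintegral_add_right _ measurable_const, setLIntegral_const, expMeasure_Ioc hr s,
                ← add_assoc, ← h s hs]
              ring
          _ ≤ w s + q ^ (k + 1) := by rw [pow_succ']; gcongr
  have hlim := ENNReal.tendsto_pow_atTop_nhds_zero_of_lt_one hq1
  refine le_antisymm ?_ ?_
  · refine ge_of_tendsto' (b := w t) (x := atTop) (f := fun k : ℕ => c + q ^ k) ?_
      fun k => (key k t ht le_rfl).1
    simpa using tendsto_const_nhds.add hlim
  · refine ge_of_tendsto' (b := c) (x := atTop) (f := fun k : ℕ => w t + q ^ k) ?_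
      fun k => (key k t ht le_rfl).2
    simpa using tendsto_const_nhds.add hlim

end ExpClock

/-! ### The kernel of dynamical percolation -/

/-- The transition probabilities of the state of an edge. -/
noncomputable def edgeKernel (p : unitInterval) (μ : ℝ) (a : ℝ) (b o : Bool) : ℝ≥0∞ :=
  (if b = o then ENNReal.ofReal (Real.exp (-(μ * a))) else 0) +
    ENNReal.ofReal (1 - Real.exp (-(μ * a))) * bernoulliMeasure true false p {o}

/-- The rule of dynamical percolation: the randomness of an edge consists of its refreshments. -/
noncomputable def clockRule : LookRule (ℕ → ℝ × Bool) Unit where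
  look b a r _ := edgeState b r a
  next a r _ := arrivalsAfter a r

lemma measurable_edgeState : Measurable fun q : Bool × ℝ × (ℕ → ℝ × Bool) =>
    edgeState q.1 q.2.2 q.2.1 := by
  have hN : Measurable fun q : Bool × ℝ × (ℕ → ℝ × Bool) =>
      arrivalCount (fun n => (q.2.2 n).1) q.2.1 :=
    measurable_arrivalCount (by fun_prop) (by fun_prop)
  have hF : Measurable fun w : ℕ × (Bool × ℝ × (ℕ → ℝ × Bool)) =>
      (match w.1 with
        | 0 => w.2.1
        | n + 1 => (w.2.2.2 n).2 : Bool) := by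
    refine measurable_from_prod_countable_right fun n => ?_
    cases n with
    | zero => exact measurable_fst
    | succ n => exact (by fun_prop : Measurable fun q : Bool × ℝ × (ℕ → ℝ × Bool) => (q.2.2 n).2)
  exact hF.comp (hN.prodMk measurable_id)

lemma measurable_arrivalsAfter : Measurable fun q : ℝ × (ℕ → ℝ × Bool) =>
    arrivalsAfter q.1 q.2 := by
  have hN : Measurable fun q : ℝ × (ℕ → ℝ × Bool) => arrivalCount (gaps q.2) q.1 :=
    measurable_arrivalCount (by unfold gaps; fun_prop) (by fun_prop)
  have hF : Measurable fun w : ℕ × ℝ × (ℕ → ℝ × Bool) =>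
      seqCons (arrivalTime (gaps w.2.2) w.1 - w.2.1, (w.2.2 w.1).2)
        (seqShift (w.1 + 1) w.2.2) := by
    refine measurable_from_prod_countable_right fun n => ?_
    refine measurable_seqCons.comp (Measurable.prodMk (Measurable.prodMk ?_
      (by dsimp only; fun_prop)) ((measurable_seqShift (n + 1)).comp measurable_snd))
    unfold arrivalTime gaps
    dsimp only
    fun_prop
  exact hF.comp (hN.prodMk measurable_id)

lemma clockRule_isMeasurable : clockRule.IsMeasurable where
  look := by
    have h : Measurable fun q : Bool × ℝ × (ℕ → ℝ × Bool) × Unit => (q.1, q.2.1, q.2.2.1) := by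
      fun_prop
    have := measurable_edgeState.comp h
    simp only [Function.comp_def] at this
    exact this
  next := by
    have h : Measurable fun q : ℝ × (ℕ → ℝ × Bool) × Unit => (q.1, q.2.1) := by fun_prop
    have := measurable_arrivalsAfter.comp h
    simp only [Function.comp_def] at this
    exact this

/-- The probability that the state of an edge is `o` at time `t` and that its refreshments after
time `t` are in `D`. -/
noncomputable def lookMass (μ : ℝ) (β : Measure Bool) (o : Bool) (D : Set (ℕ → ℝ × Bool))
    (b : Bool) (t : ℝ) : ℝ≥0∞ :=
  iid ((expMeasure μ).prod β) {r | edgeState b r t = o ∧ arrivalsAfter t r ∈ D}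

lemma measurableSet_look' (o : Bool) {D : Set (ℕ → ℝ × Bool)} (hD : MeasurableSet D) :
    MeasurableSet {w : (Bool × ℝ) × (ℕ → ℝ × Bool) |
      edgeState w.1.1 w.2 w.1.2 = o ∧ arrivalsAfter w.1.2 w.2 ∈ D} := by
  have hE : MeasurableSet {w : Bool × ℝ × (ℕ → ℝ × Bool) |
      edgeState w.1 w.2.2 w.2.1 = o ∧ arrivalsAfter w.2.1 w.2.2 ∈ D} :=
    (measurable_edgeState (measurableSet_singleton o)).inter
      ((measurable_arrivalsAfter.comp measurable_snd) hD)
  exact (by fun_prop : Measurable fun w : (Bool × ℝ) × (ℕ → ℝ × Bool) => (w.1.1, w.1.2, w.2)) hE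

lemma measurableSet_look (o : Bool) {D : Set (ℕ → ℝ × Bool)} (hD : MeasurableSet D)
    (b : Bool) (t : ℝ) :
    MeasurableSet {r : ℕ → ℝ × Bool | edgeState b r t = o ∧ arrivalsAfter t r ∈ D} :=
  (measurable_prodMk_left (x := (b, t))) (measurableSet_look' o hD)

/-- Conditioning on the first refreshment, at time `x` with result `c`. If `x > t`, the state is
still `b` and the overshoot `x - t` is again exponential; if `x ≤ t`, the edge starts anew from `c`
with `t - x` left. -/
lemma lookMass_eq {μ : ℝ} (hμ : 0 < μ) (β : Measure Bool) [IsProbabilityMeasure β]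
    (b o : Bool) {D : Set (ℕ → ℝ × Bool)} (hD : MeasurableSet D) {t : ℝ} (ht : 0 ≤ t) :
    lookMass μ β o D b t = (if b = o then ENNReal.ofReal (Real.exp (-(μ * t))) else 0) *
        iid ((expMeasure μ).prod β) D +
      ∫⁻ x in Set.Ioc 0 t, ∫⁻ c, lookMass μ β o D c (t - x) ∂β ∂expMeasure μ := by
  have := isProbabilityMeasure_expMeasure hμ
  have h1 : lookMass μ β o D b t = ∫⁻ x, ∫⁻ c, iid ((expMeasure μ).prod β) {r | seqCons (x, c) r ∈
      {r | edgeState b r t = o ∧ arrivalsAfter t r ∈ D}} ∂β ∂expMeasure μ := by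
    unfold lookMass
    rw [iid_apply_eq_lintegral _ (measurableSet_look o hD b t)]
    exact lintegral_prod _ (measurable_measure_prodMk_left
      (measurable_seqCons (measurableSet_look o hD b t))).aemeasurable
  have hclock : ∀ x c, 0 < x → ∀ᵐ r ∂iid ((expMeasure μ).prod β), IsClock (gaps (seqCons (x, c) r)) := by
    intro x c hx
    filter_upwards [ae_isClock_gaps hμ β] with r hr
    exact isClock_iff_seqShift.2 ⟨hx, by convert hr using 1; funext k; simp [gaps, add_comm 1 k]⟩
  have hsh : ∀ (z : ℝ × Bool) (r : ℕ → ℝ × Bool), seqShift 1 (seqCons z r) = r := fun z r => by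
    simp
  have h2 : ∀ x, 0 < x → t < x → ∀ c, iid ((expMeasure μ).prod β) {r | seqCons (x, c) r ∈
      {r | edgeState b r t = o ∧ arrivalsAfter t r ∈ D}} =
      (if b = o then 1 else 0) * iid ((expMeasure μ).prod β) {r | seqCons (x - t, c) r ∈ D} := by
    intro x hx htx c
    have : ({r | seqCons (x, c) r ∈ {r | edgeState b r t = o ∧ arrivalsAfter t r ∈ D}} : Set _)
        =ᵐ[iid ((expMeasure μ).prod β)] {r | b = o ∧ seqCons (x - t, c) r ∈ D} := by
      filter_upwards [hclock x c hx] with r hr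
      refine propext ?_
      change (edgeState b (seqCons (x, c) r) t = o ∧ arrivalsAfter t (seqCons (x, c) r) ∈ D) ↔
        (b = o ∧ seqCons (x - t, c) r ∈ D)
      rw [edgeState_of_lt b hr htx, arrivalsAfter_of_lt hr htx, hsh]
      rfl
    rw [measure_congr this]
    split_ifs with hbo <;> simp [hbo]
  have h3 : ∀ x, 0 < x → x ≤ t → ∀ c, iid ((expMeasure μ).prod β) {r | seqCons (x, c) r ∈
      {r | edgeState b r t = o ∧ arrivalsAfter t r ∈ D}} = lookMass μ β o D c (t - x) := by
    intro x hx hxt c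
    refine measure_congr ?_
    filter_upwards [hclock x c hx] with r hr
    refine propext ?_
    change (edgeState b (seqCons (x, c) r) t = o ∧ arrivalsAfter t (seqCons (x, c) r) ∈ D) ↔
        (edgeState c r (t - x) = o ∧ arrivalsAfter (t - x) r ∈ D)
    rw [edgeState_of_le b hr hxt, arrivalsAfter_of_le hr hxt, hsh]
    rfl
  rw [h1, ← lintegral_add_compl _ (measurableSet_Ioi (a := t)), Set.compl_Ioi]
  congr 1
  · have h4 : ∫⁻ x in Set.Ioi t, ∫⁻ c, iid ((expMeasure μ).prod β) {r | seqCons (x, c) r ∈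
        {r | edgeState b r t = o ∧ arrivalsAfter t r ∈ D}} ∂β ∂expMeasure μ =
        ∫⁻ x in Set.Ioi t, (fun y => (if b = o then 1 else 0) *
          ∫⁻ c, iid ((expMeasure μ).prod β) {r | seqCons (y, c) r ∈ D} ∂β) (x - t) ∂expMeasure μ := by
      refine setLIntegral_congr_fun measurableSet_Ioi fun x hx => ?_
      have hx' : t < x := hx
      simp only [h2 x (by linarith) hx']
      split_ifs <;> simp
    have hmD : Measurable fun z : ℝ × Bool => iid ((expMeasure μ).prod β) {r | seqCons z r ∈ D} :=
      measurable_measure_prodMk_left (measurable_seqCons hD)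
    rw [h4, setLIntegral_sub_expMeasure hμ ht (hmD.lintegral_prod_right'.const_mul _),
      lintegral_const_mul _ hmD.lintegral_prod_right', ← lintegral_prod _ hmD.aemeasurable,
      ← iid_apply_eq_lintegral _ hD]
    split_ifs <;> simp
  · have h5 : (expMeasure μ).restrict (Set.Iic t) = (expMeasure μ).restrict (Set.Ioc 0 t) := by
      refine Measure.restrict_congr_set ?_
      filter_upwards [ae_pos_expMeasure hμ] with x hx
      exact propext ⟨fun h => ⟨hx, h⟩, fun h => h.2⟩
    rw [h5]
    refine setLIntegral_congr_fun measurableSet_Ioc fun x hx => ?_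
    simp only [h3 x hx.1 hx.2]

/-- Stationarity of `β`: averaging `lookMass_eq` over an initial state with law `β` closes the
renewal equation, whose bounded solutions are constant. -/
lemma lintegral_lookMass {μ : ℝ} (hμ : 0 < μ) (β : Measure Bool) [IsProbabilityMeasure β]
    (o : Bool) {D : Set (ℕ → ℝ × Bool)} (hD : MeasurableSet D) {t : ℝ} (ht : 0 ≤ t) :
    ∫⁻ c, lookMass μ β o D c t ∂β = β {o} * iid ((expMeasure μ).prod β) D := by
  have := isProbabilityMeasure_expMeasure hμ
  refine eq_of_renewal_equation (w := fun t => ∫⁻ c, lookMass μ β o D c t ∂β) hμ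
    (fun t => ?_) ?_ (fun t ht => ?_) ht
  · calc ∫⁻ c, lookMass μ β o D c t ∂β ≤ ∫⁻ _, 1 ∂β := lintegral_mono fun c => prob_le_one
      _ = 1 := by rw [lintegral_const, measure_univ, mul_one]
  · exact mul_le_one' prob_le_one prob_le_one
  · rw [lintegral_congr fun c => lookMass_eq hμ β c o hD ht]
    rw [lintegral_add_right _ measurable_const, lintegral_const, measure_univ, mul_one,
      lintegral_mul_const _ (Measurable.of_discrete), expMeasure_Ioi hμ t ht]
    have : (fun c : Bool => if c = o then ENNReal.ofReal (Real.exp (-(μ * t))) else 0) =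
        ({o} : Set Bool).indicator fun _ => ENNReal.ofReal (Real.exp (-(μ * t))) := by
      funext c; simp [Set.indicator_apply]
    rw [this, lintegral_indicator_const (measurableSet_singleton o)]
    ring

lemma iid_edgeState_arrivalsAfter (p : unitInterval) {μ : ℝ} (hμ : 0 < μ) (b o : Bool) {a : ℝ}
    (ha : 0 ≤ a) {D : Set (ℕ → ℝ × Bool)} (hD : MeasurableSet D) :
    iid ((expMeasure μ).prod (bernoulliMeasure true false p))
      {r | edgeState b r a = o ∧ arrivalsAfter a r ∈ D} =
    edgeKernel p μ a b o * iid ((expMeasure μ).prod (bernoulliMeasure true false p)) D := by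
  refine (lookMass_eq hμ _ b o hD ha).trans ?_
  -- After the first refreshment the state has the stationary law, so the integrand of the renewal
  -- equation is constant.
  rw [setLIntegral_congr_fun (g := fun _ => bernoulliMeasure true false p {o} *
    iid ((expMeasure μ).prod (bernoulliMeasure true false p)) D) measurableSet_Ioc
    fun x hx => lintegral_lookMass hμ _ o hD (by linarith [hx.2]), setLIntegral_const,
    expMeasure_Ioc hμ a, expMeasure_Iic hμ a ha, edgeKernel]
  ring

lemma clockRule_hasKernel (p : unitInterval) {μ : ℝ} (hμ : 0 < μ) :
    clockRule.HasKernel (iid ((expMeasure μ).prod (bernoulliMeasure true false p)))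
      (Measure.dirac ()) (edgeKernel p μ) := by
  have := isProbabilityMeasure_expMeasure hμ
  intro b o a ha D hD
  rw [← iid_edgeState_arrivalsAfter p hμ b o ha hD]
  have : {q : (ℕ → ℝ × Bool) × Unit | clockRule.look b a q.1 q.2 = o ∧
      clockRule.next a q.1 q.2 ∈ D} =
      {r | edgeState b r a = o ∧ arrivalsAfter a r ∈ D} ×ˢ Set.univ := by
    ext q; simp [clockRule]
  rw [this, Measure.prod_prod, measure_univ, mul_one]

end DynPerc

/-! ### Replacing refreshments by lifetimes -/

namespace DynPerc

open scoped ENNReal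

variable {d : ℕ}

/-- The inputs made of directions and waiting times `w` and of the randomness `s` of the looks. -/
def inputs {S : Type*} (w : ℕ → ℝ × Direction d) (s : ℕ → S) : ℕ → Input d S :=
  fun k => ((w k).2, s k, (w (k + 1)).1)

/-- The state at the first attempted step. -/
def initialState {R : Type*} (η₀ : BondConfig d) (w : ℕ → ℝ × Direction d) (r : Edge d → R) :
    State d R :=
  (0, fun e => (η₀ e, (w 0).1, r e))

/-- The recorded state, age and remaining refreshments of each edge reproduce the percolation at all
later times. Unlooked edges merely age; at a look, `edgeState_add` restarts the record. -/
lemma clockRule_run_invariant (η₀ : BondConfig d) (ω : Sample d) (hw : IsClock (gaps ω.2))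
    (hr : ∀ e, IsClock (gaps (ω.1 e))) (n : ℕ) :
    let z := clockRule.run n (initialState η₀ ω.2 ω.1) (inputs ω.2 fun _ => ())
    z.1 = positionAfter η₀ ω n ∧ ∀ e, 0 ≤ (z.2 e).2.1 ∧ IsClock (gaps (z.2 e).2.2) ∧
      ∀ s, 0 ≤ s → bondConfig η₀ ω (arrivalTime (gaps ω.2) n + s) e =
        edgeState (z.2 e).1 (z.2 e).2.2 ((z.2 e).2.1 + s) := by
  induction n with
  | zero =>
    refine ⟨rfl, fun e => ⟨(hw.pos 0).le, hr e, fun s hs => ?_⟩⟩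
    rw [arrivalTime_zero]
    rfl
  | succ n ih =>
    intro z
    set z' := clockRule.run n (initialState η₀ ω.2 ω.1) (inputs ω.2 fun _ => ()) with hz'
    have hz : z = clockRule.step z' (inputs ω.2 (fun _ => ()) n) := LookRule.run_succ' _ _ _ _
    obtain ⟨hpos, hmem⟩ := ih
    have hg : 0 < (ω.2 (n + 1)).1 := hw.pos (n + 1)
    have hout : clockRule.outcome z' (inputs ω.2 (fun _ => ()) n) =
        bondConfig η₀ ω (arrivalTime (gaps ω.2) n)
          (edgeToward (positionAfter η₀ ω n) (ω.2 n).2) := by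
      have := (hmem (edgeToward z'.1 (ω.2 n).2)).2.2 0 le_rfl
      simp only [add_zero] at this
      rw [← hpos, this]
      rfl
    refine ⟨?_, fun e => ?_⟩
    · rw [hz]
      simp only [LookRule.step, hout, moved, hpos]
      rfl
    · have hT : ∀ s, arrivalTime (gaps ω.2) (n + 1) + s =
          arrivalTime (gaps ω.2) n + ((ω.2 (n + 1)).1 + s) := fun s => by
        rw [arrivalTime_succ]; simp [gaps]; ring
      obtain ⟨h0, hc, hb⟩ := hmem e
      rw [hz]
      by_cases he : e = edgeToward z'.1 (ω.2 n).2
      · have hadd := edgeState_add (z'.2 e).1 hc (a := (z'.2 e).2.1)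
        have hzz : (clockRule.step z' (inputs ω.2 (fun _ => ()) n)).2 e =
            (edgeState (z'.2 e).1 (z'.2 e).2.2 (z'.2 e).2.1, |(ω.2 (n + 1)).1|,
              arrivalsAfter (z'.2 e).2.1 (z'.2 e).2.2) := by
          subst he
          simp [LookRule.step, LookRule.outcome, inputs, clockRule]
        rw [hzz, abs_of_pos hg]
        refine ⟨hg.le, hadd.1, fun s hs => ?_⟩
        rw [hT, hb _ (by linarith), hadd.2 _ (by linarith)]
      · have hzz : (clockRule.step z' (inputs ω.2 (fun _ => ()) n)).2 e =
            ((z'.2 e).1, (z'.2 e).2.1 + |(ω.2 (n + 1)).1|, (z'.2 e).2.2) := by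
          simp [LookRule.step, inputs, he]
        rw [hzz, abs_of_pos hg]
        refine ⟨by simp only; linarith, hc, fun s hs => ?_⟩
        rw [hT, hb _ (by linarith)]
        simp only
        congr 1; ring

/-- The rule in which the result of every look stays in force during a lifetime. When it has
expired, a coin is tossed at the next look. -/
noncomputable def lifeRule : LookRule ℝ (Bool × ℝ) where
  look b a r s := if a < r then b else s.1
  next _ _ s := s.2

lemma lifeRule_isMeasurable : lifeRule.IsMeasurable where
  look := by
    refine Measurable.ite ?_ (by fun_prop) (by fun_prop)
    exact measurableSet_lt (by fun_prop) (by fun_prop)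
  next := by unfold lifeRule; fun_prop

/-- The old result is kept exactly when the lifetime exceeds the age `a`, which has probability
`exp(-μ a)`. Every look draws a new lifetime, even if the old one is still running, so the new
lifetime is independent of the result. -/
lemma lifeRule_hasKernel (p : unitInterval) {μ : ℝ} (hμ : 0 < μ) :
    lifeRule.HasKernel (expMeasure μ) ((bernoulliMeasure true false p).prod (expMeasure μ))
      (edgeKernel p μ) := by
  have := isProbabilityMeasure_expMeasure hμ
  intro b o a ha D hD
  have : {q : ℝ × (Bool × ℝ) | lifeRule.look b a q.1 q.2 = o ∧ lifeRule.next a q.1 q.2 ∈ D} =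
      (Set.Ioi a ×ˢ ((if b = o then Set.univ else ∅) ×ˢ D)) ∪ (Set.Iic a ×ˢ ({o} ×ˢ D)) := by
    ext ⟨l, c, L⟩
    simp only [lifeRule, Set.mem_ofPred_eq, Set.mem_union, Set.mem_prod, Set.mem_Ioi, Set.mem_Iic,
      Set.mem_singleton_iff]
    rcases lt_or_ge a l with h | h
    · simp only [h, if_true, h.not_ge, true_and, false_and, or_false]
      split_ifs with hb <;> simp [hb]
    · simp [h.not_gt, h]
  rw [this, measure_union _ (measurableSet_Iic.prod ((measurableSet_singleton o).prod hD))]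
  · simp only [Measure.prod_prod]
    rw [expMeasure_Ioi hμ a ha, expMeasure_Iic hμ a ha, edgeKernel]
    split_ifs <;> simp <;> ring
  · rw [Set.disjoint_left]
    rintro ⟨l, c, L⟩ ⟨h1, _⟩ ⟨h2, _⟩
    exact absurd (show a < l from h1) (not_lt.2 h2)

/-- The law of a coin and of a lifetime. -/
noncomputable abbrev lookLaw (p : unitInterval) (μ : ℝ) : Measure (Bool × ℝ) :=
  (bernoulliMeasure true false p).prod (expMeasure μ)

/-- The law of a waiting time and of a direction. -/
noncomputable abbrev attemptLaw (d : ℕ) : Measure (ℝ × Direction d) :=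
  (expMeasure 1).prod (uniformOn Set.univ)

lemma measurable_initialState_inputs {R S : Type*} [MeasurableSpace R] [MeasurableSpace S]
    (η₀ : BondConfig d) :
    Measurable fun q : (ℕ → ℝ × Direction d) × (Edge d → R) × (ℕ → S) =>
      (initialState η₀ q.1 q.2.1, inputs q.1 q.2.2) := by
  unfold initialState inputs
  fun_prop

instance isProbabilityMeasure_uniformOn_direction [NeZero d] :
    IsProbabilityMeasure (uniformOn (Set.univ : Set (Direction d))) :=
  isProbabilityMeasure_uniformOn Set.finite_univ Set.univ_nonempty

/-- An event that concerns the successive positions only has probability one when it has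
probability one for the walk driven by lifetimes. -/
lemma ae_positionAfter_mem [NeZero d] (p : unitInterval) {μ : ℝ} (hμ : 0 < μ)
    (η₀ : BondConfig d) {A : Set (ℕ → Vertex d)} (hA : MeasurableSet A)
    (h : ∀ᵐ w ∂iid (attemptLaw d),
      ∀ᵐ q ∂(Measure.infinitePi fun _ : Edge d => expMeasure μ).prod (iid (lookLaw p μ)),
        (fun n => (lifeRule.run n (initialState η₀ w q.1) (inputs w q.2)).1) ∈ A) :
    ∀ᵐ ω ∂law d p μ, positionAfter η₀ ω ∈ A := by
  have := isProbabilityMeasure_expMeasure hμ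
  have := isProbabilityMeasure_expMeasure one_pos
  set F : Sample d → ℕ → Vertex d := fun ω n =>
    (clockRule.run n (initialState η₀ ω.2 ω.1) (inputs ω.2 fun _ => ())).1 with hF
  have hFm : Measurable F := by
    have h1 : Measurable fun ω : Sample d =>
        (initialState η₀ ω.2 ω.1, inputs ω.2 fun _ : ℕ => ()) :=
      (measurable_initialState_inputs η₀).comp
        (by fun_prop : Measurable fun ω : Sample d => (ω.2, ω.1, fun _ : ℕ => ()))
    exact measurable_pi_iff.2 fun n => measurable_fst.comp ((clockRule_isMeasurable.run n).comp h1)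
  have hclock1 : ∀ᵐ r ∂Measure.infinitePi fun _ : Edge d =>
      iid ((expMeasure μ).prod (bernoulliMeasure true false p)), ∀ e, IsClock (gaps (r e)) :=
    ae_all_iff.2 fun e => (measurePreserving_eval_infinitePi (fun _ : Edge d =>
      iid ((expMeasure μ).prod (bernoulliMeasure true false p))) e).quasiMeasurePreserving.ae
      (ae_isClock_gaps hμ _)
  have hclock2 : ∀ᵐ w ∂iid (attemptLaw d), IsClock (gaps w) := ae_isClock_gaps one_pos _
  have hFA : ∀ᵐ ω ∂law d p μ, F ω ∈ A := by
    unfold law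
    refine (Measure.ae_prod_iff_ae_ae (p := fun ω => F ω ∈ A) (hFm hA)).2 ?_
    -- The waiting times and directions are fixed first, since `measure_path_eq` compares laws for
    -- given `w`.
    refine (Measure.ae_ae_comm (p := fun r w => F (r, w) ∈ A) (hFm hA)).2 ?_
    filter_upwards [h, hclock2] with w hw hwc
    have hlife := lifeRule_hasKernel p hμ
    have heq := (clockRule_hasKernel p hμ).measure_path_eq clockRule_isMeasurable hlife
      lifeRule_isMeasurable (0 : Vertex d) (fun e => (η₀ e, (w 0).1)) (fun e => (hwc.pos 0).le)
      (fun k => (w k).2) (fun k => (w (k + 1)).1)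
    have h1 : ∀ᵐ y ∂(((Measure.infinitePi fun _ : Edge d => expMeasure μ).prod
        (iid (lookLaw p μ))).map (lifeRule.path 0 (fun e => (η₀ e, (w 0).1))
        (fun k => (w k).2) (fun k => (w (k + 1)).1))), y ∈ A :=
      (ae_map_iff (p := (· ∈ A)) (lifeRule_isMeasurable.path _ _ _ _).aemeasurable hA).2 hw
    rw [← heq] at h1
    have h2 := (ae_map_iff (p := (· ∈ A))
      (clockRule_isMeasurable.path _ _ _ _).aemeasurable hA).1 h1
    filter_upwards [Measure.ae_ae_of_ae_prod h2] with r hr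
    -- The looks of `clockRule` carry no randomness, and there is only one sequence in `Unit`.
    exact hr.exists.choose_spec
  unfold law at hFA ⊢
  filter_upwards [hFA, Measure.quasiMeasurePreserving_fst.ae hclock1,
    Measure.quasiMeasurePreserving_snd.ae hclock2] with ω h1 h2 h3
  convert h1 using 1
  funext n
  exact (clockRule_run_invariant η₀ ω h3 h2 n).1.symm

/-- The law of the inputs of the walk driven by lifetimes. -/
noncomputable abbrev inputLaw (d : ℕ) (p : unitInterval) (μ : ℝ) : Measure (Input d (Bool × ℝ)) :=
  (uniformOn Set.univ).prod ((lookLaw p μ).prod (expMeasure 1))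

/-- Input `k` carries the waiting time `k + 1`, the one after attempt `k`. Waiting time `0` is the
age of all edges at the first look and belongs to `initialState`, whence the shift by one. -/
lemma measurePreserving_inputs [NeZero d] (p : unitInterval) {μ : ℝ} (hμ : 0 < μ) :
    MeasurePreserving (fun q : (ℕ → ℝ × Direction d) × (ℕ → Bool × ℝ) => inputs q.1 q.2)
      ((iid (attemptLaw d)).prod (iid (lookLaw p μ))) (iid (inputLaw d p μ)) := by
  have := isProbabilityMeasure_expMeasure hμ
  have := isProbabilityMeasure_expMeasure one_pos
  set U : Measure (Direction d) := uniformOn Set.univ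
  have hm : Measurable (fun q : (ℕ → ℝ × Direction d) × (ℕ → Bool × ℝ) => inputs q.1 q.2) := by
    unfold inputs; fun_prop
  refine ⟨hm, ?_⟩
  have hzip : MeasurePreserving
      (fun q : ((ℕ → ℝ) × (ℕ → Direction d)) × (ℕ → Bool × ℝ) =>
        ((fun n => (q.1.1 n, q.1.2 n)), q.2))
      (((iid (expMeasure 1)).prod (iid U)).prod (iid (lookLaw p μ)))
      ((iid (attemptLaw d)).prod (iid (lookLaw p μ))) :=
    (measurePreserving_zip (expMeasure 1) U).prod (MeasurePreserving.id _)
  have hgv : MeasurePreserving (fun q : (ℕ → ℝ) × (ℕ → Direction d) => (q.2, seqShift 1 q.1))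
      ((iid (expMeasure 1)).prod (iid U)) ((iid U).prod (iid (expMeasure 1))) :=
    ((MeasurePreserving.id (iid U)).prod (measurePreserving_seqShift (expMeasure 1) 1)).comp
      Measure.measurePreserving_swap
  have hre : MeasurePreserving
      (fun q : ((ℕ → ℝ) × (ℕ → Direction d)) × (ℕ → Bool × ℝ) => (q.1.2, q.2, seqShift 1 q.1.1))
      (((iid (expMeasure 1)).prod (iid U)).prod (iid (lookLaw p μ)))
      ((iid U).prod ((iid (lookLaw p μ)).prod (iid (expMeasure 1)))) := by
    have h1 := hgv.prod (MeasurePreserving.id (iid (lookLaw p μ)))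
    have h2 := (measurePreserving_prodAssoc (iid U) (iid (expMeasure 1)) (iid (lookLaw p μ))).comp h1
    exact ((MeasurePreserving.id (iid U)).prod Measure.measurePreserving_swap).comp h2
  have hall := (measurePreserving_zip U ((lookLaw p μ).prod (expMeasure 1))).comp
    (((MeasurePreserving.id (iid U)).prod
      (measurePreserving_zip (lookLaw p μ) (expMeasure 1))).comp hre)
  rw [← hzip.map_eq, Measure.map_map hm hzip.measurable, ← hall.map_eq]
  congr 1
  funext q k
  simp [inputs, add_comm 1 k]

end DynPerc

namespace DynPerc

open scoped ENNReal

variable {d : ℕ}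

/-! ### Regeneration, coupling and reflection, path by path -/

section Pathwise

/-- The inputs of the walk driven by lifetimes. -/
abbrev LifeInput (d : ℕ) : Type := Input d (Bool × ℝ)

/-- The state at the origin in which all the lifetimes have expired. -/
def freshState (d : ℕ) : State d ℝ := (0, fun _ => (false, 0, 0))

/-- The walk driven by lifetimes that starts from the fresh state. -/
noncomputable def freshWalk (n : ℕ) (ζ : ℕ → LifeInput d) : Vertex d :=
  (lifeRule.run n (freshState d) ζ).1

@[simp] lemma freshWalk_zero (ζ : ℕ → LifeInput d) : freshWalk 0 ζ = 0 := rfl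

/-- The largest residual lifetime after one more look, when it was `w` before. -/
noncomputable def loadStep (w : ℝ) (i : LifeInput d) : ℝ := max 0 (max w i.2.1.2 - |i.2.2|)

/-- The largest residual lifetime after `n` looks, when it is `w` at the beginning. -/
noncomputable def load : ℕ → ℝ → (ℕ → LifeInput d) → ℝ
  | 0, w, _ => w
  | n + 1, w, ζ => load n (loadStep w (ζ 0)) (seqShift 1 ζ)

@[simp] lemma load_zero (w : ℝ) (ζ : ℕ → LifeInput d) : load 0 w ζ = w := rfl

lemma load_succ (n : ℕ) (w : ℝ) (ζ : ℕ → LifeInput d) :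
    load (n + 1) w ζ = load n (loadStep w (ζ 0)) (seqShift 1 ζ) := rfl

lemma load_add (n m : ℕ) (w : ℝ) (ζ : ℕ → LifeInput d) :
    load (n + m) w ζ = load m (load n w ζ) (seqShift n ζ) := by
  induction n generalizing w ζ with
  | zero => simp
  | succ n ih => rw [show n + 1 + m = (n + m) + 1 by omega, load_succ, ih, load_succ,
      seqShift_seqShift, add_comm 1 n]

lemma load_succ' (n : ℕ) (w : ℝ) (ζ : ℕ → LifeInput d) :
    load (n + 1) w ζ = loadStep (load n w ζ) (ζ n) := by
  rw [load_add, load_succ]; simp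

lemma load_congr (n : ℕ) (w : ℝ) {ζ ζ' : ℕ → LifeInput d} (h : ∀ k < n, ζ k = ζ' k) :
    load n w ζ = load n w ζ' := by
  induction n with
  | zero => rfl
  | succ n ih => rw [load_succ', load_succ', ih fun k hk => h k (by omega), h n (by omega)]

lemma freshWalk_congr (n : ℕ) {ζ ζ' : ℕ → LifeInput d} (h : ∀ k < n, ζ k = ζ' k) :
    freshWalk n ζ = freshWalk n ζ' := by
  rw [freshWalk, lifeRule.run_congr n _ h, freshWalk]

lemma loadStep_nonneg (w : ℝ) (i : LifeInput d) : 0 ≤ loadStep w i := le_max_left _ _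

/-- The residual lifetime of the last look at an edge. -/
def residual (z : State d ℝ) (e : Edge d) : ℝ := (z.2 e).2.2 - (z.2 e).2.1

lemma residual_step_self (z : State d ℝ) (i : LifeInput d) :
    residual (lifeRule.step z i) (edgeToward z.1 i.1) = i.2.1.2 - |i.2.2| := by
  simp [residual, LookRule.step, lifeRule]

lemma residual_step_of_ne (z : State d ℝ) (i : LifeInput d) {e : Edge d}
    (he : e ≠ edgeToward z.1 i.1) :
    residual (lifeRule.step z i) e = residual z e - |i.2.2| := by
  simp [residual, LookRule.step, he]
  ring

/-- `D` covers the lifetimes at the start that `w` does not count. It is zero for the fresh state,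
and it is what remains of the initial lifetimes for a given initial configuration. -/
lemma residual_run_le (z : State d ℝ) {w : ℝ} (ζ : ℕ → LifeInput d) {D : ℕ → Edge d → ℝ}
    (h0 : ∀ e, residual z e ≤ max w (D 0 e)) (hD : ∀ n e, D n e - |(ζ n).2.2| ≤ D (n + 1) e)
    (n : ℕ) (e : Edge d) : residual (lifeRule.run n z ζ) e ≤ max (load n w ζ) (D n e) := by
  induction n generalizing e with
  | zero => exact h0 e
  | succ n ih =>
    rw [LookRule.run_succ', load_succ']
    set z' := lifeRule.run n z ζ
    by_cases he : e = edgeToward z'.1 (ζ n).1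
    · subst he
      rw [residual_step_self, loadStep]
      refine le_max_of_le_left (le_max_of_le_right ?_)
      exact sub_le_sub_right (le_max_right _ _) _
    · rw [residual_step_of_ne _ _ he, loadStep]
      rcases le_max_iff.1 (ih e) with h | h
      · refine le_max_of_le_left (le_max_of_le_right ?_)
        exact sub_le_sub_right (h.trans (le_max_left _ _)) _
      · exact le_max_of_le_right ((sub_le_sub_right h _).trans (hD n e))

/-- Translation of an edge. -/
def translateEdge (x : Vertex d) (e : Edge d) : Edge d := (x + e.1, e.2)

lemma translateEdge_injective (x : Vertex d) : Function.Injective (translateEdge x) := by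
  rintro ⟨a, i⟩ ⟨b, j⟩ h
  simpa [translateEdge] using h

lemma translateEdge_edgeToward (x y : Vertex d) (v : Direction d) :
    translateEdge x (edgeToward y v) = edgeToward (x + y) v := by
  unfold translateEdge edgeToward
  split_ifs <;> simp [add_sub_assoc]

lemma add_moved (x y : Vertex d) (o : Bool) (v : Direction d) :
    x + moved o y v = moved o (x + y) v := by
  unfold moved neighbor
  split_ifs <;> simp [add_sub_assoc, add_assoc]

/-- Two walks with the same inputs stay together, up to a translation by `x`, as long as the
lifetimes in which their states differ have expired at the edges that they look at. -/
lemma run_coupling (x : Vertex d) (zA zB : State d ℝ) (ζ : ℕ → LifeInput d)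
    (D : ℕ → Edge d → ℝ) (hx : zA.1 = x + zB.1)
    (h0 : ∀ e, zA.2 (translateEdge x e) = zB.2 e ∨
      (residual zB e ≤ 0 ∧ residual zA (translateEdge x e) ≤ D 0 (translateEdge x e)))
    (hD : ∀ n e, D n e - |(ζ n).2.2| ≤ D (n + 1) e)
    (hreach : ∀ n, D n (edgeToward (lifeRule.run n zA ζ).1 (ζ n).1) ≤ 0) (n : ℕ) :
    (lifeRule.run n zA ζ).1 = x + (lifeRule.run n zB ζ).1 ∧
    ∀ e, (lifeRule.run n zA ζ).2 (translateEdge x e) = (lifeRule.run n zB ζ).2 e ∨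
      (residual (lifeRule.run n zB ζ) e ≤ 0 ∧
        residual (lifeRule.run n zA ζ) (translateEdge x e) ≤ D n (translateEdge x e)) := by
  induction n with
  | zero => exact ⟨hx, h0⟩
  | succ n ih =>
    have hr := hreach n
    rw [LookRule.run_succ', LookRule.run_succ']
    set a := lifeRule.run n zA ζ
    set b := lifeRule.run n zB ζ
    obtain ⟨hab, hmem⟩ := ih
    set e₀ := edgeToward b.1 (ζ n).1 with he₀
    have hedge : edgeToward a.1 (ζ n).1 = translateEdge x e₀ := by
      rw [hab, he₀, translateEdge_edgeToward]
    have hout : lifeRule.outcome a (ζ n) = lifeRule.outcome b (ζ n) := by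
      unfold LookRule.outcome
      rw [hedge, ← he₀]
      -- Where the memories differ, both lifetimes have expired, and both walks read the same coin.
      -- After that look the memories of this edge agree.
      rcases hmem e₀ with h | ⟨h1, h2⟩
      · rw [h]
      · rw [hedge] at hr
        have h3 := h2.trans hr
        simp only [residual, sub_nonpos] at h1 h3
        simp [lifeRule, h1.not_gt, h3.not_gt]
    refine ⟨?_, fun e => ?_⟩
    · simp only [LookRule.step]
      rw [hout, add_moved, hab]
    · by_cases he : e = e₀
      · left
        subst he
        simp only [LookRule.step, hedge, hout, ← he₀, if_true]
        simp [lifeRule]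
      · have he' : translateEdge x e ≠ edgeToward a.1 (ζ n).1 := by
          rw [hedge]; exact fun h => he (translateEdge_injective x h)
        rcases hmem e with h | ⟨h1, h2⟩
        · left
          simp only [LookRule.step, if_neg he', ← he₀, if_neg he, h]
        · right
          rw [residual_step_of_ne _ _ he', residual_step_of_ne _ _ he]
          refine ⟨?_, (sub_le_sub_right h2 _).trans (hD n _)⟩
          have := abs_nonneg (ζ n).2.2
          linarith

/-- The walk starts afresh when all the lifetimes have expired. -/
lemma freshWalk_add {n : ℕ} {ζ : ℕ → LifeInput d} (h : load n 0 ζ = 0) (m : ℕ) :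
    freshWalk (n + m) ζ = freshWalk n ζ + freshWalk m (seqShift n ζ) := by
  have hres : ∀ e, residual (lifeRule.run n (freshState d) ζ) e ≤ 0 := by
    intro e
    have := residual_run_le (freshState d) (w := 0) ζ (D := fun _ _ => 0)
      (fun e => by simp [residual, freshState]) (fun n e => by simp) n e
    simpa [h] using this
  unfold freshWalk
  rw [LookRule.run_add]
  exact (run_coupling (lifeRule.run n (freshState d) ζ).1 _ (freshState d) (seqShift n ζ)
    (fun _ _ => 0) (by simp [freshState]) (fun e => .inr ⟨by simp [residual, freshState], hres _⟩)
    (fun n e => by simp) (fun n => le_rfl) m).1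

lemma abs_moved_sub_le (o : Bool) (x : Vertex d) (v : Direction d) (i : Fin d) :
    |moved o x v i - x i| ≤ 1 := by
  unfold moved neighbor
  split_ifs
  · by_cases h : i = v.1 <;> simp [h]
  · by_cases h : i = v.1 <;> simp [h]
  · simp

lemma abs_run_sub_le {R S : Type*} (ρ : LookRule R S) (n : ℕ) (z : State d R)
    (ζ : ℕ → Input d S) (i : Fin d) : |(ρ.run n z ζ).1 i - z.1 i| ≤ n := by
  induction n with
  | zero => simp
  | succ n ih =>
    rw [LookRule.run_succ']
    have h1 := abs_moved_sub_le (ρ.outcome (ρ.run n z ζ) (ζ n)) (ρ.run n z ζ).1 (ζ n).1 i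
    have h2 : |(ρ.step (ρ.run n z ζ) (ζ n)).1 i - z.1 i| ≤
        |(ρ.step (ρ.run n z ζ) (ζ n)).1 i - (ρ.run n z ζ).1 i| + |(ρ.run n z ζ).1 i - z.1 i| :=
      abs_sub_le _ _ _
    have h3 : |(ρ.step (ρ.run n z ζ) (ζ n)).1 i - (ρ.run n z ζ).1 i| ≤ 1 := h1
    push_cast
    linarith

lemma abs_freshWalk_le (n : ℕ) (ζ : ℕ → LifeInput d) (i : Fin d) : |freshWalk n ζ i| ≤ n := by
  simpa [freshState, freshWalk] using abs_run_sub_le lifeRule n (freshState d) ζ i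

/-- The additional `1` is due to negative directions, whose edge is labelled by its other endpoint.
-/
lemma abs_edgeToward_le {n : ℕ} {x : Vertex d} (hx : ∀ i, |x i| ≤ n) (v : Direction d)
    (i : Fin d) : |(edgeToward x v).1 i| ≤ n + 1 := by
  have h := hx i
  unfold edgeToward
  split_ifs
  · simp only; linarith
  · have h1 : |(Pi.single v.1 (1 : ℤ) : Vertex d) i| ≤ 1 := by
      by_cases h : i = v.1 <;> simp [h]
    exact (abs_sub _ _).trans (add_le_add h h1)

/-- The walk from the initial bond configuration starts afresh when all the lifetimes have expired,
except for initial lifetimes of edges out of reach. -/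
lemma run_initialState_add (η₀ : BondConfig d) {w : ℕ → ℝ × Direction d} (hw : IsClock (gaps w))
    (s : ℕ → Bool × ℝ) (l : Edge d → ℝ) {n : ℕ} (hn : load n 0 (inputs w s) = 0)
    (hl : ∀ k, n ≤ k → ∀ e : Edge d, (∀ i, |e.1 i| ≤ k + 1) → l e ≤ arrivalTime (gaps w) k)
    (m : ℕ) :
    (lifeRule.run (n + m) (initialState η₀ w l) (inputs w s)).1 =
      (lifeRule.run n (initialState η₀ w l) (inputs w s)).1 +
        freshWalk m (seqShift n (inputs w s)) := by
  have hT : ∀ k (e : Edge d), l e - arrivalTime (gaps w) k - |(inputs w s k).2.2| ≤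
      l e - arrivalTime (gaps w) (k + 1) := by
    intro k e
    have : |(inputs w s k).2.2| = gaps w (k + 1) := abs_of_pos (hw.pos (k + 1))
    rw [arrivalTime_succ, this]
    linarith
  have hres : ∀ e, residual (lifeRule.run n (initialState η₀ w l) (inputs w s)) e ≤
      max 0 (l e - arrivalTime (gaps w) n) := by
    intro e
    have := residual_run_le (initialState η₀ w l) (w := 0) (inputs w s)
      (D := fun k e => l e - arrivalTime (gaps w) k)
      (fun e => by simp [residual, initialState, arrivalTime_zero, gaps]) hT n e
    simpa [hn] using this
  have hpos : ∀ k i, |(lifeRule.run k (initialState η₀ w l) (inputs w s)).1 i| ≤ k := by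
    intro k i
    simpa [initialState] using abs_run_sub_le lifeRule k (initialState η₀ w l) (inputs w s) i
  rw [LookRule.run_add]
  -- Here `D` is what remains of the initial lifetimes at attempt `n + k`; by `hl` it vanishes at
  -- every edge that the walk can then look at.
  refine (run_coupling _ _ (freshState d) (seqShift n (inputs w s))
    (fun k e => max 0 (l e - arrivalTime (gaps w) (n + k))) (by simp [freshState])
    (fun e => .inr ⟨by simp [residual, freshState], hres _⟩) (fun k e => ?_) (fun k => ?_) m).1
  · rcases le_total 0 (l e - arrivalTime (gaps w) (n + k)) with h | h
    · rw [max_eq_right h]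
      exact le_max_of_le_right (hT (n + k) e)
    · rw [max_eq_left h]
      refine le_max_of_le_left ?_
      have := abs_nonneg (seqShift n (inputs w s) k).2.2
      linarith
  · rw [← LookRule.run_add]
    refine max_le le_rfl (sub_nonpos.2 (hl (n + k) (by omega) _ ?_))
    exact fun i => abs_edgeToward_le (hpos (n + k)) _ i

/-- The opposite direction. -/
def flipDirection (v : Direction d) : Direction d := (v.1, !v.2)

/-- The inputs with the opposite direction. -/
def flipInput (i : LifeInput d) : LifeInput d := (flipDirection i.1, i.2)

/-- The reflection of an edge in the origin. -/
def reflectEdge (e : Edge d) : Edge d := (-e.1 - Pi.single e.2 1, e.2)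

lemma reflectEdge_injective : Function.Injective (reflectEdge (d := d)) := by
  rintro ⟨a, i⟩ ⟨b, j⟩ h
  simp only [reflectEdge, Prod.mk.injEq] at h
  obtain ⟨h, rfl⟩ := h
  simpa using h

lemma reflectEdge_edgeToward (x : Vertex d) (v : Direction d) :
    reflectEdge (edgeToward x v) = edgeToward (-x) (flipDirection v) := by
  obtain ⟨i, b⟩ := v
  cases b <;> simp [reflectEdge, edgeToward, flipDirection]

lemma moved_neg (o : Bool) (x : Vertex d) (v : Direction d) :
    moved o (-x) (flipDirection v) = -moved o x v := by
  obtain ⟨i, b⟩ := v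
  cases b <;> cases o <;> simp [moved, neighbor, flipDirection, sub_eq_add_neg, add_comm]

/-- The fresh state is invariant under reflection, and looks commute with it. This is the source of
the symmetry of `stepLaw`. -/
lemma run_flipInput (n : ℕ) (ζ : ℕ → LifeInput d) :
    (lifeRule.run n (freshState d) fun k => flipInput (ζ k)).1 =
      -(lifeRule.run n (freshState d) ζ).1 ∧
    ∀ e, (lifeRule.run n (freshState d) fun k => flipInput (ζ k)).2 (reflectEdge e) =
      (lifeRule.run n (freshState d) ζ).2 e := by
  induction n with
  | zero => simp [freshState]
  | succ n ih =>
    rw [LookRule.run_succ', LookRule.run_succ']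
    set a := lifeRule.run n (freshState d) fun k => flipInput (ζ k)
    set b := lifeRule.run n (freshState d) ζ
    obtain ⟨h1, h2⟩ := ih
    have hedge : edgeToward a.1 (flipInput (ζ n)).1 = reflectEdge (edgeToward b.1 (ζ n).1) := by
      rw [h1, reflectEdge_edgeToward]; rfl
    have hout : lifeRule.outcome a (flipInput (ζ n)) = lifeRule.outcome b (ζ n) := by
      unfold LookRule.outcome
      rw [hedge, h2]; rfl
    constructor
    · simp only [LookRule.step, hout, h1]
      exact moved_neg _ _ _
    · intro e
      simp only [LookRule.step, hedge, hout, reflectEdge_injective.eq_iff, h2]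
      rfl

lemma freshWalk_flipInput (n : ℕ) (ζ : ℕ → LifeInput d) :
    freshWalk n (fun k => flipInput (ζ k)) = -freshWalk n ζ := (run_flipInput n ζ).1

lemma load_flipInput (n : ℕ) (w : ℝ) (ζ : ℕ → LifeInput d) :
    load n w (fun k => flipInput (ζ k)) = load n w ζ := by
  induction n with
  | zero => rfl
  | succ n ih => rw [load_succ', load_succ', ih]; rfl

lemma freshWalk_one (ζ : ℕ → LifeInput d) :
    freshWalk 1 ζ = moved (ζ 0).2.1.1 0 (ζ 0).1 := by
  simp [freshWalk, LookRule.run_succ, LookRule.step, LookRule.outcome, lifeRule, freshState]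

end Pathwise

end DynPerc

namespace DynPerc

open scoped ENNReal

/-! ### Convolution powers and a comparison of Green functions -/

section Convolution

variable {A : Type*} [AddCommGroup A]

/-- Convolution of weights on a group. -/
noncomputable def conv (a b : A → ℝ≥0∞) (x : A) : ℝ≥0∞ := ∑' y, a y * b (x - y)

lemma conv_comm (a b : A → ℝ≥0∞) : conv a b = conv b a := by
  funext x
  unfold conv
  rw [← (Equiv.subLeft x).tsum_eq]
  simp [mul_comm]

lemma conv_assoc (a b c : A → ℝ≥0∞) : conv (conv a b) c = conv a (conv b c) := by
  funext x
  unfold conv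
  simp_rw [← ENNReal.tsum_mul_right, ← ENNReal.tsum_mul_left]
  rw [ENNReal.tsum_comm]
  refine tsum_congr fun y => ?_
  rw [← (Equiv.addLeft y).tsum_eq]
  refine tsum_congr fun z => ?_
  simp [mul_assoc, sub_sub]

lemma conv_add_left (a b c : A → ℝ≥0∞) (x : A) :
    conv (fun y => a y + b y) c x = conv a c x + conv b c x := by
  simp [conv, add_mul, ENNReal.tsum_add]

lemma conv_const_mul_left (r : ℝ≥0∞) (a c : A → ℝ≥0∞) (x : A) :
    conv (fun y => r * a y) c x = r * conv a c x := by
  simp [conv, mul_assoc, ENNReal.tsum_mul_left]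

lemma conv_sum_right {ι : Type*} (s : Finset ι) (a : A → ℝ≥0∞) (b : ι → A → ℝ≥0∞) (x : A) :
    conv a (fun y => ∑ i ∈ s, b i y) x = ∑ i ∈ s, conv a (b i) x := by
  unfold conv
  simp_rw [Finset.mul_sum]
  exact Summable.tsum_finsetSum fun _ _ => ENNReal.summable

lemma conv_mono {a a' b b' : A → ℝ≥0∞} (ha : ∀ x, a x ≤ a' x) (hb : ∀ x, b x ≤ b' x) (x : A) :
    conv a b x ≤ conv a' b' x :=
  ENNReal.tsum_le_tsum fun y => mul_le_mul' (ha y) (hb _)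

lemma conv_le_of_le {a b : A → ℝ≥0∞} {M : ℝ≥0∞} (hb : ∀ x, b x ≤ M) (x : A) :
    conv a b x ≤ (∑' y, a y) * M := by
  rw [← ENNReal.tsum_mul_right]
  exact ENNReal.tsum_le_tsum fun y => mul_le_mul' le_rfl (hb _)

lemma tsum_conv_mul (a b g : A → ℝ≥0∞) :
    ∑' x, conv a b x * g x = ∑' y, ∑' z, a y * b z * g (y + z) := by
  unfold conv
  simp_rw [← ENNReal.tsum_mul_right]
  rw [ENNReal.tsum_comm]
  refine tsum_congr fun y => ?_
  rw [← (Equiv.addLeft y).tsum_eq]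
  simp

lemma tsum_conv (a b : A → ℝ≥0∞) : ∑' x, conv a b x = (∑' x, a x) * ∑' x, b x := by
  have := tsum_conv_mul a b 1
  simp only [Pi.one_apply, mul_one] at this
  rw [this, ← ENNReal.tsum_mul_right]
  simp_rw [ENNReal.tsum_mul_left]

variable [DecidableEq A]

/-- Convolution powers. -/
noncomputable def convPow (a : A → ℝ≥0∞) : ℕ → A → ℝ≥0∞
  | 0 => Pi.single 0 1
  | n + 1 => conv a (convPow a n)

lemma conv_single_zero (a : A → ℝ≥0∞) : conv a (Pi.single 0 1) = a := by
  funext x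
  unfold conv
  rw [tsum_eq_single x]
  · simp
  · intro y hy
    rw [Pi.single_eq_of_ne (sub_ne_zero.2 hy.symm), mul_zero]

lemma single_zero_conv (a : A → ℝ≥0∞) : conv (Pi.single 0 1) a = a := by
  rw [conv_comm, conv_single_zero]

lemma convPow_zero (a : A → ℝ≥0∞) : convPow a 0 = Pi.single 0 1 := rfl

lemma convPow_succ (a : A → ℝ≥0∞) (n : ℕ) : convPow a (n + 1) = conv a (convPow a n) := rfl

lemma convPow_add (a : A → ℝ≥0∞) (n m : ℕ) :
    convPow a (n + m) = conv (convPow a n) (convPow a m) := by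
  induction n with
  | zero => rw [zero_add, convPow_zero, single_zero_conv]
  | succ n ih => rw [show n + 1 + m = (n + m) + 1 by omega, convPow_succ, ih, convPow_succ,
      conv_assoc]

lemma convPow_mul (a : A → ℝ≥0∞) (n m : ℕ) :
    convPow a (n * m) = convPow (convPow a n) m := by
  induction m with
  | zero => simp [convPow_zero]
  | succ m ih => rw [Nat.mul_succ, add_comm, convPow_add, ih, convPow_succ]

lemma tsum_convPow (a : A → ℝ≥0∞) (n : ℕ) : ∑' x, convPow a n x = (∑' x, a x) ^ n := by
  induction n with
  | zero => rw [convPow_zero, tsum_pi_single, pow_zero]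
  | succ n ih => rw [convPow_succ, tsum_conv, ih, pow_succ']

lemma convPow_neg {a : A → ℝ≥0∞} (ha : ∀ x, a (-x) = a x) (n : ℕ) (x : A) :
    convPow a n (-x) = convPow a n x := by
  induction n generalizing x with
  | zero => simp [convPow_zero, Pi.single_apply]
  | succ n ih =>
    rw [convPow_succ]
    unfold conv
    rw [← (Equiv.neg A).tsum_eq]
    refine tsum_congr fun y => ?_
    rw [Equiv.neg_apply, ha, ← ih]
    congr 2; abel

/-- The left side is the contribution of a single path. -/
lemma prod_le_convPow_sum (a : A → ℝ≥0∞) (n : ℕ) (y : Fin n → A) :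
    ∏ i, a (y i) ≤ convPow a n (∑ i, y i) := by
  induction n with
  | zero => simp [convPow_zero]
  | succ n ih =>
    rw [Fin.prod_univ_succ, Fin.sum_univ_succ, convPow_succ]
    refine le_trans ?_ (ENNReal.le_tsum (y 0))
    refine mul_le_mul' le_rfl ?_
    rw [add_sub_cancel_left]
    exact ih _

/-- When a weight `F` of mass at most one dominates `ε U`, then its Green function is bounded in
terms of the maxima of the convolution powers of `U`. -/
lemma sum_convPow_conv_le {F U : A → ℝ≥0∞} {ε : ℝ≥0∞} {M : ℕ → ℝ≥0∞} (hF : ∑' x, F x ≤ 1)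
    (hU : ∑' x, U x = 1) (hε0 : ε ≠ 0) (hε : ε ≤ 1) (hFU : ∀ x, ε * U x ≤ F x)
    (hM : ∀ j x, convPow U j x ≤ M j) (K j : ℕ) (x : A) :
    ∑ k ∈ Finset.range K, conv (convPow F k) (convPow U j) x ≤ ε⁻¹ * ∑' i, M (i + j) := by
  have hεt : ε ≠ ∞ := ne_top_of_le_ne_top ENNReal.one_ne_top hε
  -- Decompose `F = ε U + b`, with `b` of mass at most `1 - ε`. In the induction on `K`, a first
  -- step from `U` raises `j` by one and a first step from `b` leaves `j` alone. With `T j = ∑ M (i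
  -- + j)` the bound reproduces itself: `M j + T (j + 1) + (1 - ε) ε⁻¹ T j = ε⁻¹ T j`.
  set b : A → ℝ≥0∞ := fun x => F x - ε * U x with hb
  have hsplit : F = fun x => ε * U x + b x := by
    funext x
    rw [hb]; simp only
    rw [add_tsub_cancel_of_le (hFU x)]
  have hbmass : ∑' x, b x ≤ 1 - ε := by
    refine ENNReal.le_sub_of_add_le_left hεt ?_
    calc ε + ∑' x, b x = ∑' x, (ε * U x + b x) := by
          rw [ENNReal.tsum_add, ENNReal.tsum_mul_left, hU, mul_one]
      _ ≤ 1 := by rw [← hsplit]; exact hF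
  have hT : ∀ j, M j + ∑' i, M (i + (j + 1)) = ∑' i, M (i + j) := by
    intro j
    rw [tsum_eq_zero_add' (f := fun i => M (i + j)) ENNReal.summable]
    simp only [zero_add]
    congr 1
    refine tsum_congr fun i => ?_
    congr 1; omega
  induction K generalizing j x with
  | zero => simp
  | succ K ih =>
    rw [Finset.sum_range_succ', add_comm, convPow_zero, single_zero_conv]
    have hstep : ∀ k, conv (convPow F (k + 1)) (convPow U j) x =
        ε * conv (convPow F k) (convPow U (j + 1)) x +
          conv b (conv (convPow F k) (convPow U j)) x := by
      intro k
      have h1 : conv (convPow F (k + 1)) (convPow U j) x =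
          conv F (conv (convPow F k) (convPow U j)) x := by rw [convPow_succ, conv_assoc]
      have h2 : conv U (conv (convPow F k) (convPow U j)) =
          conv (convPow F k) (convPow U (j + 1)) := by
        rw [← conv_assoc, conv_comm U, conv_assoc, convPow_succ]
      rw [h1]
      conv_lhs => rw [hsplit]
      rw [conv_add_left, conv_const_mul_left, ← hsplit, h2]
    simp_rw [hstep]
    rw [Finset.sum_add_distrib, ← Finset.mul_sum, ← conv_sum_right]
    calc convPow U j x + (ε * ∑ k ∈ Finset.range K, conv (convPow F k) (convPow U (j + 1)) x +
          conv b (fun y => ∑ k ∈ Finset.range K, conv (convPow F k) (convPow U j) y) x)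
        ≤ M j + (ε * (ε⁻¹ * ∑' i, M (i + (j + 1))) + (1 - ε) * (ε⁻¹ * ∑' i, M (i + j))) := by
          refine add_le_add (hM j x) (add_le_add (mul_le_mul' le_rfl (ih _ _)) ?_)
          exact (conv_le_of_le (fun y => ih j y) x).trans (mul_le_mul' hbmass le_rfl)
      _ = ε⁻¹ * ∑' i, M (i + j) := by
          rw [← mul_assoc, ENNReal.mul_inv_cancel hε0 hεt, one_mul, ← add_assoc, hT,
            ← mul_assoc]
          nth_rewrite 1 [← one_mul (∑' i, M (i + j))]
          rw [← add_mul]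
          congr 1
          rw [ENNReal.sub_mul (fun _ _ => ENNReal.inv_ne_top.2 hε0), one_mul,
            ENNReal.mul_inv_cancel hε0 hεt, add_tsub_cancel_of_le (ENNReal.one_le_inv.2 hε)]

/-- Write `k = r q + s` with `s < r`: the powers of the `r`-step weight are controlled by
`sum_convPow_conv_le`, and the remaining `s` steps have mass at most one. -/
lemma tsum_convPow_le {f U : A → ℝ≥0∞} {r : ℕ} (hr : r ≠ 0) {ε : ℝ≥0∞} {M : ℕ → ℝ≥0∞}
    (hf : ∑' x, f x ≤ 1) (hU : ∑' x, U x = 1) (hε0 : ε ≠ 0) (hε : ε ≤ 1)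
    (hFU : ∀ x, ε * U x ≤ convPow f r x) (hM : ∀ j x, convPow U j x ≤ M j) (x : A) :
    ∑' k, convPow f k x ≤ r * (ε⁻¹ * ∑' i, M i) := by
  have hmass : ∀ n, ∑' x, convPow f n x ≤ 1 := fun n => by
    rw [tsum_convPow]; exact pow_le_one₀ zero_le hf
  have hG : ∀ y, ∑' q, convPow (convPow f r) q y ≤ ε⁻¹ * ∑' i, M i := by
    intro y
    refine ENNReal.tsum_le_of_sum_range_le fun K => ?_
    have := sum_convPow_conv_le (hmass r) hU hε0 hε hFU hM K 0 y
    simpa [convPow_zero, conv_single_zero] using this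
  have : NeZero r := ⟨hr⟩
  rw [← (Nat.divModEquiv r).symm.tsum_eq,
    ENNReal.tsum_prod (f := fun q s => convPow f ((Nat.divModEquiv r).symm (q, s)) x), ENNReal.tsum_comm, tsum_fintype]
  calc ∑ s : Fin r, ∑' q, convPow f ((Nat.divModEquiv r).symm (q, s)) x
      ≤ ∑ s : Fin r, ε⁻¹ * ∑' i, M i := by
        refine Finset.sum_le_sum fun s _ => ?_
        have : ∀ q, convPow f ((Nat.divModEquiv r).symm (q, s)) x =
            conv (convPow f s) (convPow (convPow f r) q) x := by
          intro q
          rw [← convPow_mul, ← convPow_add]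
          congr 1
          simp [Nat.divModEquiv]; ring
        simp_rw [this]
        unfold conv
        rw [ENNReal.tsum_comm]
        simp_rw [ENNReal.tsum_mul_left]
        refine (ENNReal.tsum_le_tsum fun y => mul_le_mul' le_rfl (hG _)).trans ?_
        rw [ENNReal.tsum_mul_right]
        exact mul_le_of_le_one_left' (hmass s)
    _ = r * (ε⁻¹ * ∑' i, M i) := by simp

end Convolution

end DynPerc

namespace DynPerc

open scoped ENNReal

/-! ### The walk on cube vertices and the bounded Green function for `d ≥ 3` -/

section Cube

/-- The distribution of the simple random walk on `ℤ`. -/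
noncomputable def coinWalk : ℕ → ℤ → ℝ≥0∞
  | 0, z => if z = 0 then 1 else 0
  | j + 1, z => 2⁻¹ * coinWalk j (z - 1) + 2⁻¹ * coinWalk j (z + 1)

/-- Pascal's rule along the walk. Where one of the two neighbours carries no mass, monotonicity of
binomial coefficients suffices, as only an upper bound is needed. -/
lemma coinWalk_le_choose (j : ℕ) (z : ℤ) :
    coinWalk j z = 0 ∨ ∃ k : ℕ, z = 2 * k - j ∧ coinWalk j z ≤ j.choose k * (2⁻¹) ^ j := by
  induction j generalizing z with
  | zero =>
    by_cases hz : z = 0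
    · exact .inr ⟨0, by simp [hz], by simp [coinWalk, hz]⟩
    · exact .inl (by simp [coinWalk, hz])
  | succ j ih =>
    simp only [coinWalk]
    have hpow : ∀ c : ℝ≥0∞, 2⁻¹ * (c * (2⁻¹) ^ j) = c * (2⁻¹) ^ (j + 1) := fun c => by
      rw [pow_succ]; ring
    rcases ih (z - 1) with h1 | ⟨k, hk, h1⟩ <;> rcases ih (z + 1) with h2 | ⟨k', hk', h2⟩
    · exact .inl (by rw [h1, h2]; simp)
    · refine .inr ⟨k', by push_cast; linarith, ?_⟩
      rw [h1, mul_zero, zero_add]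
      refine (mul_le_mul' le_rfl h2).trans ?_
      rw [hpow]
      exact mul_le_mul' (by exact_mod_cast Nat.choose_le_succ j k') le_rfl
    · refine .inr ⟨k + 1, by push_cast; linarith, ?_⟩
      rw [h2, mul_zero, add_zero]
      refine (mul_le_mul' le_rfl h1).trans ?_
      rw [hpow]
      gcongr
      rw [Nat.choose_succ_succ]
      omega
    · obtain rfl : k' = k + 1 := by omega
      refine .inr ⟨k + 1, by push_cast; linarith, ?_⟩
      refine (add_le_add (mul_le_mul' le_rfl h1) (mul_le_mul' le_rfl h2)).trans ?_
      rw [hpow, hpow, ← add_mul, Nat.choose_succ_succ]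
      push_cast
      exact le_rfl

/-- The induction step reduces to `(2n + 1)(2n + 3) ≤ (2n + 2)²`. -/
lemma centralBinom_sq_le (n : ℕ) : (2 * n + 1) * n.centralBinom ^ 2 ≤ 16 ^ n := by
  induction n with
  | zero => simp
  | succ n ih =>
    have h := Nat.succ_mul_centralBinom_succ n
    have h2 : (n + 1) ^ 2 * ((2 * (n + 1) + 1) * (n + 1).centralBinom ^ 2) ≤
        (n + 1) ^ 2 * 16 ^ (n + 1) := by
      calc (n + 1) ^ 2 * ((2 * (n + 1) + 1) * (n + 1).centralBinom ^ 2)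
          = (2 * n + 3) * ((n + 1) * (n + 1).centralBinom) ^ 2 := by ring
        _ = (4 * (2 * n + 3) * (2 * n + 1)) * ((2 * n + 1) * n.centralBinom ^ 2) := by
          rw [h]; ring
        _ ≤ (4 * (2 * n + 3) * (2 * n + 1)) * 16 ^ n := Nat.mul_le_mul le_rfl ih
        _ ≤ (16 * (n + 1) ^ 2) * 16 ^ n := Nat.mul_le_mul (by nlinarith) le_rfl
        _ = (n + 1) ^ 2 * 16 ^ (n + 1) := by ring
    exact Nat.le_of_mul_le_mul_left h2 (by positivity)

lemma choose_half_sq_le (j : ℕ) : (j + 1) * (j.choose (j / 2)) ^ 2 ≤ 4 ^ j := by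
  rcases Nat.even_or_odd' j with ⟨n, rfl | rfl⟩
  · have := centralBinom_sq_le n
    rw [Nat.centralBinom_eq_two_mul_choose] at this
    rw [Nat.mul_div_cancel_left n two_pos, pow_mul]
    simpa using this
  · have h := centralBinom_sq_le (n + 1)
    -- The middle coefficient of an odd row is half of the next central one.
    have h1 : (n + 1).centralBinom = 2 * (2 * n + 1).choose n := by
      rw [Nat.centralBinom_eq_two_mul_choose, show 2 * (n + 1) = (2 * n + 1) + 1 by ring,
        Nat.choose_succ_succ, ← Nat.choose_symm_half n, two_mul]
      simp
      ring
    rw [show (2 * n + 1) / 2 = n by omega]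
    rw [h1] at h
    have h2 : 4 * ((2 * n + 1 + 1) * ((2 * n + 1).choose n) ^ 2) ≤ 4 * 4 ^ (2 * n + 1) := by
      calc _ ≤ (2 * (n + 1) + 1) * (2 * (2 * n + 1).choose n) ^ 2 := by
            rw [mul_pow, ← mul_assoc, ← mul_assoc]
            exact Nat.mul_le_mul (by omega) le_rfl
        _ ≤ 16 ^ (n + 1) := h
        _ = 4 * 4 ^ (2 * n + 1) := by rw [show 16 = 4 ^ 2 by norm_num, ← pow_mul]; ring
    exact Nat.le_of_mul_le_mul_left h2 (by norm_num)

lemma coinWalk_le (j : ℕ) (z : ℤ) : coinWalk j z ≤ ENNReal.ofReal (1 / √(j + 1)) := by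
  rcases coinWalk_le_choose j z with h | ⟨k, -, h⟩
  · rw [h]; exact zero_le
  · refine h.trans ?_
    have h1 : ((j.choose k : ℕ) : ℝ≥0∞) * (2⁻¹) ^ j = ENNReal.ofReal (j.choose k / 2 ^ j) := by
      rw [ENNReal.ofReal_div_of_pos (by positivity), ENNReal.ofReal_natCast,
        ENNReal.ofReal_pow (by norm_num), ENNReal.ofReal_ofNat, ENNReal.div_eq_inv_mul, mul_comm,
        ENNReal.inv_pow]
    rw [h1]
    refine ENNReal.ofReal_le_ofReal ?_
    rw [div_le_div_iff₀ (by positivity) (by positivity), one_mul]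
    have h2 : ((j : ℝ) + 1) * (j.choose k : ℝ) ^ 2 ≤ 4 ^ j := by
      have h3 : (j + 1) * (j.choose k) ^ 2 ≤ 4 ^ j :=
        (Nat.mul_le_mul le_rfl (Nat.pow_le_pow_left (Nat.choose_le_middle k j) 2)).trans
          (choose_half_sq_le j)
      exact_mod_cast h3
    refine le_of_sq_le_sq ?_ (by positivity)
    rw [mul_pow, Real.sq_sqrt (by positivity), ← pow_mul, mul_comm j 2, pow_mul]
    norm_num
    linarith

variable {d : ℕ}

/-- The vertices of the cube `{-1, 1}^d`. -/
def cubeVertex (σ : Fin d → Bool) : Vertex d := fun i => if σ i then 1 else -1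

lemma cubeVertex_injective : Function.Injective (cubeVertex (d := d)) := by
  intro σ τ h
  funext i
  have := congrFun h i
  simp only [cubeVertex] at this
  cases hs : σ i <;> cases ht : τ i <;> simp_all

/-- The uniform distribution on the vertices of the cube. -/
noncomputable def cubeWeight (d : ℕ) (y : Vertex d) : ℝ≥0∞ :=
  ∑ σ : Fin d → Bool, (2⁻¹) ^ d * (Pi.single (cubeVertex σ) 1 : Vertex d → ℝ≥0∞) y

lemma half_pow_mul_two_pow (d : ℕ) : ((2 : ℝ≥0∞) ^ d) * (2⁻¹) ^ d = 1 := by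
  rw [← mul_pow, ENNReal.mul_inv_cancel (by norm_num) (by norm_num), one_pow]

lemma tsum_cubeWeight : ∑' y, cubeWeight d y = 1 := by
  unfold cubeWeight
  rw [Summable.tsum_finsetSum fun _ _ => ENNReal.summable]
  simp_rw [ENNReal.tsum_mul_left, tsum_pi_single]
  simp [half_pow_mul_two_pow]

lemma conv_cubeWeight (g : Vertex d → ℝ≥0∞) (x : Vertex d) :
    conv (cubeWeight d) g x = ∑ σ : Fin d → Bool, (2⁻¹) ^ d * g (x - cubeVertex σ) := by
  unfold conv cubeWeight
  simp_rw [Finset.sum_mul]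
  rw [Summable.tsum_finsetSum fun _ _ => ENNReal.summable]
  refine Finset.sum_congr rfl fun σ _ => ?_
  rw [tsum_eq_single (cubeVertex σ)]
  · simp
  · intro y hy
    rw [Pi.single_eq_of_ne hy]; simp

/-- A uniform vertex of the cube has independent fair signs as coordinates. This factorisation is
why the cube serves for comparison instead of the nearest-neighbour walk. -/
lemma convPow_cubeWeight (j : ℕ) (x : Vertex d) :
    convPow (cubeWeight d) j x = ∏ i, coinWalk j (x i) := by
  induction j generalizing x with
  | zero =>
    rw [convPow_zero, Pi.single_apply]
    simp only [coinWalk]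
    split_ifs with h
    · simp [h]
    · obtain ⟨i, hi⟩ := Function.ne_iff.1 h
      exact (Finset.prod_eq_zero (Finset.mem_univ i) (if_neg hi)).symm
  | succ j ih =>
    rw [convPow_succ, conv_cubeWeight]
    simp only [coinWalk, ih]
    have h1 : ∀ i, 2⁻¹ * coinWalk j (x i - 1) + 2⁻¹ * coinWalk j (x i + 1) =
        ∑ b : Bool, 2⁻¹ * coinWalk j (x i - if b then 1 else -1) := by
      intro i; simp
    simp_rw [h1]
    rw [Finset.prod_univ_sum]
    simp only [Fintype.piFinset_univ]
    refine Finset.sum_congr rfl fun σ _ => ?_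
    rw [Finset.prod_mul_distrib]
    simp [cubeVertex]

lemma convPow_cubeWeight_le (hd : 3 ≤ d) (j : ℕ) (x : Vertex d) :
    convPow (cubeWeight d) j x ≤ ENNReal.ofReal (1 / √(j + 1)) ^ 3 := by
  rw [convPow_cubeWeight]
  calc ∏ i, coinWalk j (x i) ≤ ∏ _i : Fin d, ENNReal.ofReal (1 / √(j + 1)) :=
        Finset.prod_le_prod' fun i _ => coinWalk_le j _
    _ = ENNReal.ofReal (1 / √(j + 1)) ^ d := by simp
    _ ≤ ENNReal.ofReal (1 / √(j + 1)) ^ 3 := by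
        refine pow_le_pow_of_le_one zero_le ?_ hd
        refine ENNReal.ofReal_le_one.2 ?_
        rw [div_le_one (by positivity), Real.one_le_sqrt]
        linarith [(Nat.cast_nonneg j : (0 : ℝ) ≤ j)]

lemma tsum_ofReal_inv_sqrt_pow_ne_top :
    ∑' j : ℕ, ENNReal.ofReal (1 / √(j + 1)) ^ 3 ≠ ∞ := by
  have h1 : ∀ j : ℕ, ENNReal.ofReal (1 / √(j + 1)) ^ 3 =
      ENNReal.ofReal (1 / ((j + 1 : ℕ) : ℝ) ^ (3 / 2 : ℝ)) := by
    intro j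
    rw [← ENNReal.ofReal_pow (by positivity)]
    congr 1
    rw [div_pow, one_pow, Real.sqrt_eq_rpow, ← Real.rpow_natCast, ← Real.rpow_mul (by positivity)]
    norm_num
  simp_rw [h1]
  have h2 : Summable fun j : ℕ => 1 / ((j + 1 : ℕ) : ℝ) ^ (3 / 2 : ℝ) :=
    (summable_nat_add_iff 1).2 (Real.summable_one_div_nat_rpow.2 (by norm_num))
  rw [← ENNReal.ofReal_tsum_of_nonneg (fun j => by positivity) h2]
  exact ENNReal.ofReal_ne_top

/-- The Green function of a weight on `ℤ^d`, `d ≥ 3`, that charges all the unit vectors is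
bounded. -/
lemma exists_tsum_convPow_le (hd : 3 ≤ d) {f : Vertex d → ℝ≥0∞} (hf : ∑' x, f x ≤ 1)
    {ε : ℝ≥0∞} (hε : ε ≠ 0) (hfε : ∀ (i : Fin d) (s : Bool),
      ε ≤ f (Pi.single i (if s then 1 else -1))) :
    ∃ M : ℝ≥0∞, M ≠ ∞ ∧ ∀ x, ∑' k, convPow f k x ≤ M := by
  -- A vertex of the cube is a sum of `d` signed unit vectors, so `d` steps of `f` dominate a
  -- multiple of a cube step.
  have hpow : ∀ σ : Fin d → Bool, ε ^ d ≤ convPow f d (cubeVertex σ) := by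
    intro σ
    have h1 : cubeVertex σ = ∑ i, (Pi.single i (if σ i then 1 else -1) : Vertex d) :=
      (Finset.univ_sum_single (cubeVertex σ)).symm
    rw [h1]
    refine le_trans ?_ (prod_le_convPow_sum f d _)
    calc ε ^ d = ∏ _i : Fin d, ε := by simp
      _ ≤ _ := Finset.prod_le_prod' fun i _ => hfε i (σ i)
  have hlow : ∀ x, ε ^ d * cubeWeight d x ≤ convPow f d x := by
    intro x
    unfold cubeWeight
    by_cases hx : ∃ σ, cubeVertex σ = x
    · obtain ⟨σ, rfl⟩ := hx
      refine le_trans ?_ (hpow σ)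
      refine mul_le_of_le_one_right' ?_
      rw [Finset.sum_eq_single σ]
      · simp only [Pi.single_eq_same, mul_one]
        exact pow_le_one₀ zero_le (by simp)
      · intro τ _ hτ
        rw [Pi.single_eq_of_ne (cubeVertex_injective.ne hτ.symm), mul_zero]
      · simp
    · push Not at hx
      rw [Finset.sum_eq_zero]
      · simp
      · intro σ _
        rw [Pi.single_eq_of_ne (hx σ).symm, mul_zero]
  have hε1 : ε ^ d ≤ 1 := by
    calc ε ^ d = ∑' x, ε ^ d * cubeWeight d x := by
          rw [ENNReal.tsum_mul_left, tsum_cubeWeight, mul_one]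
      _ ≤ ∑' x, convPow f d x := ENNReal.tsum_le_tsum hlow
      _ ≤ 1 := by rw [tsum_convPow]; exact pow_le_one₀ zero_le hf
  refine ⟨_, ?_, fun x => tsum_convPow_le (by omega) hf tsum_cubeWeight (pow_ne_zero d hε) hε1 hlow
    (convPow_cubeWeight_le hd) x⟩
  exact ENNReal.mul_ne_top (by simp) (ENNReal.mul_ne_top
    (ENNReal.inv_ne_top.2 (pow_ne_zero d hε)) tsum_ofReal_inv_sqrt_pow_ne_top)

end Cube

end DynPerc

namespace DynPerc

open scoped ENNReal

/-! ### Variance and the infinite Green function for `d ≤ 2` -/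

section SecondMoment

variable {d : ℕ}

/-- The square of the Euclidean norm. -/
def sqNorm (x : Vertex d) : ℝ≥0∞ := ((∑ i, (x i).natAbs ^ 2 : ℕ) : ℝ≥0∞)

lemma sqNorm_add_add_sqNorm (y z : Vertex d) :
    sqNorm (y + z) + sqNorm (-y + z) = 2 * sqNorm y + 2 * sqNorm z := by
  unfold sqNorm
  have : (∑ i, ((y + z) i).natAbs ^ 2) + (∑ i, ((-y + z) i).natAbs ^ 2) =
      2 * (∑ i, (y i).natAbs ^ 2) + 2 * ∑ i, (z i).natAbs ^ 2 := by
    simp only [Finset.mul_sum, ← Finset.sum_add_distrib]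
    refine Finset.sum_congr rfl fun i _ => ?_
    zify
    simp only [sq_abs, Pi.add_apply, Pi.neg_apply]
    ring
  exact_mod_cast this

/-- Additivity of the variance. By symmetry of `f` the sum may be averaged over `y` and `-y`, and
the parallelogram law then removes the cross term without subtraction. -/
lemma tsum_conv_mul_sqNorm {f g : Vertex d → ℝ≥0∞} (hf : ∀ x, f (-x) = f x) :
    ∑' x, conv f g x * sqNorm x =
      (∑' x, f x * sqNorm x) * (∑' x, g x) + (∑' x, f x) * ∑' x, g x * sqNorm x := by
  have h1 : ∑' x, conv f g x * sqNorm x = ∑' y, ∑' z, f y * g z * sqNorm (-y + z) := by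
    rw [tsum_conv_mul, ← (Equiv.neg (Vertex d)).tsum_eq]
    simp [hf]
  have h2 : 2 * ∑' x, conv f g x * sqNorm x =
      2 * ((∑' x, f x * sqNorm x) * (∑' x, g x) + (∑' x, f x) * ∑' x, g x * sqNorm x) := by
    calc 2 * ∑' x, conv f g x * sqNorm x
        = ∑' y, ∑' z, f y * g z * sqNorm (y + z) + ∑' y, ∑' z, f y * g z * sqNorm (-y + z) := by
          rw [← h1, ← tsum_conv_mul, two_mul]
      _ = ∑' y, ∑' z, (2 * (f y * sqNorm y * g z) + 2 * (f y * (g z * sqNorm z))) := by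
          rw [← ENNReal.tsum_add]
          refine tsum_congr fun y => ?_
          rw [← ENNReal.tsum_add]
          refine tsum_congr fun z => ?_
          rw [← mul_add, sqNorm_add_add_sqNorm]
          ring
      _ = _ := by
          simp_rw [ENNReal.tsum_add, ENNReal.tsum_mul_left, ENNReal.tsum_mul_right]
          rw [mul_add]
  exact (ENNReal.mul_right_inj (by norm_num) (by norm_num)).1 h2

lemma tsum_convPow_mul_sqNorm {f : Vertex d → ℝ≥0∞} (hf : ∀ x, f (-x) = f x)
    (hf1 : ∑' x, f x = 1) (n : ℕ) :
    ∑' x, convPow f n x * sqNorm x = n * ∑' x, f x * sqNorm x := by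
  induction n with
  | zero =>
    rw [convPow_zero, tsum_eq_single 0]
    · simp [sqNorm]
    · intro x hx; simp [Pi.single_eq_of_ne hx]
  | succ n ih =>
    rw [convPow_succ, tsum_conv_mul_sqNorm hf, tsum_convPow, hf1, ih]
    push_cast
    ring

lemma sq_le_sqNorm {R : ℕ} {x : Vertex d}
    (hx : x ∉ Finset.Icc (fun _ => -(R : ℤ)) (fun _ => (R : ℤ))) : ((R ^ 2 : ℕ) : ℝ≥0∞) ≤ sqNorm x := by
  unfold sqNorm
  have : ∃ i, R ≤ (x i).natAbs := by
    by_contra! h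
    refine hx (Finset.mem_Icc.2 ⟨fun i => ?_, fun i => ?_⟩) <;> have := h i <;> simp only <;> omega
  obtain ⟨i, hi⟩ := this
  have h1 : R ^ 2 ≤ ∑ i, (x i).natAbs ^ 2 :=
    (Nat.pow_le_pow_left hi 2).trans
      (Finset.single_le_sum (f := fun i => (x i).natAbs ^ 2) (fun _ _ => Nat.zero_le _)
        (Finset.mem_univ i))
  exact_mod_cast h1

/-- By Chebyshev, the box of radius `R` holds at least half of the mass of the `n`-step law. By
symmetry the return probability after `2n` steps is the sum of squares of this law, which
Cauchy–Schwarz on the box bounds below. -/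
lemma one_le_mul_convPow_two_mul {f : Vertex d → ℝ≥0∞} (hf : ∀ x, f (-x) = f x)
    (hf1 : ∑' x, f x = 1) {R n : ℕ} (hR : 0 < R)
    (hV : 2 * (n * ∑' x, f x * sqNorm x) ≤ ((R ^ 2 : ℕ) : ℝ≥0∞)) :
    1 ≤ 4 * (((2 * R + 1) ^ d : ℕ) : ℝ≥0∞) * convPow f (2 * n) 0 := by
  set B : Finset (Vertex d) := Finset.Icc (fun _ => -(R : ℤ)) (fun _ => (R : ℤ)) with hB
  have hcard : B.card = (2 * R + 1) ^ d := by
    rw [hB, Pi.card_Icc]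
    simp only [Int.card_Icc, Finset.prod_const, Finset.card_univ, Fintype.card_fin]
    congr 1
    omega
  set a := convPow f n with ha
  have hamass : ∑' x, a x = 1 := by rw [ha, tsum_convPow, hf1, one_pow]
  have hle : ∀ x, a x ≤ 1 := fun x => (ENNReal.le_tsum x).trans hamass.le
  have hne : ∀ x, a x ≠ ∞ := fun x => ne_top_of_le_ne_top ENNReal.one_ne_top (hle x)
  set r : ℝ≥0∞ := ((R ^ 2 : ℕ) : ℝ≥0∞) with hr
  have hr0 : r ≠ 0 := by rw [hr]; exact_mod_cast (pow_pos hR 2).ne'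
  have hrt : r ≠ ∞ := ENNReal.natCast_ne_top _
  have h1 : r ≤ r * ∑ x ∈ B, a x + n * ∑' x, f x * sqNorm x := by
    calc r = ∑' x, a x * r := by rw [ENNReal.tsum_mul_right, hamass, one_mul]
      _ ≤ ∑' x, ((B : Set (Vertex d)).indicator (fun x => r * a x) x + a x * sqNorm x) := by
          refine ENNReal.tsum_le_tsum fun x => ?_
          by_cases hx : x ∈ B
          · rw [Set.indicator_of_mem (by exact hx), mul_comm]
            exact le_self_add
          · rw [Set.indicator_of_notMem (by exact hx), zero_add]
            exact mul_le_mul' le_rfl (sq_le_sqNorm hx)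
      _ = r * ∑ x ∈ B, a x + n * ∑' x, f x * sqNorm x := by
          rw [ENNReal.tsum_add, ha, tsum_convPow_mul_sqNorm hf hf1, Finset.mul_sum,
            ← Finset.tsum_subtype', ← tsum_subtype]
  have h2 : r * 1 ≤ r * (2 * ∑ x ∈ B, a x) := by
    have h3 : r + r ≤ r * (2 * ∑ x ∈ B, a x) + r := by
      calc r + r = 2 * r := (two_mul r).symm
        _ ≤ 2 * (r * ∑ x ∈ B, a x + n * ∑' x, f x * sqNorm x) := mul_le_mul' le_rfl h1
        _ = r * (2 * ∑ x ∈ B, a x) + 2 * (n * ∑' x, f x * sqNorm x) := by ring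
        _ ≤ _ := add_le_add le_rfl hV
    rw [mul_one]
    exact (ENNReal.add_le_add_iff_right hrt).1 h3
  have h3 : 1 ≤ 2 * ∑ x ∈ B, a x := (ENNReal.mul_le_mul_iff_right hr0 hrt).1 h2
  have h4 : (∑ x ∈ B, a x) ^ 2 ≤ B.card * ∑ x ∈ B, a x ^ 2 := by
    have h5 := sq_sum_le_card_mul_sum_sq (s := B) (f := fun x => (a x).toNNReal)
    have h6 : ∀ x, ((a x).toNNReal : ℝ≥0∞) = a x := fun x => ENNReal.coe_toNNReal (hne x)
    have h7 : (((∑ x ∈ B, (a x).toNNReal) ^ 2 : ℝ≥0) : ℝ≥0∞) ≤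
        ((B.card * ∑ x ∈ B, (a x).toNNReal ^ 2 : ℝ≥0) : ℝ≥0∞) := ENNReal.coe_le_coe.2 h5
    push_cast at h7
    simpa only [h6] using h7
  have h5 : ∑ x ∈ B, a x ^ 2 ≤ convPow f (2 * n) 0 := by
    rw [two_mul, convPow_add]
    unfold conv
    refine le_trans (le_of_eq ?_) (ENNReal.sum_le_tsum B)
    refine Finset.sum_congr rfl fun x _ => ?_
    rw [zero_sub, convPow_neg hf, sq]
  calc (1 : ℝ≥0∞) = 1 ^ 2 := (one_pow 2).symm
    _ ≤ (2 * ∑ x ∈ B, a x) ^ 2 := pow_le_pow_left' h3 2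
    _ = 4 * (∑ x ∈ B, a x) ^ 2 := by rw [mul_pow]; norm_num
    _ ≤ 4 * (B.card * convPow f (2 * n) 0) :=
        mul_le_mul' le_rfl (h4.trans (mul_le_mul' le_rfl h5))
    _ = _ := by rw [hcard, mul_assoc]

lemma tsum_inv_natCast_add_one : ∑' n : ℕ, ((n + 1 : ℕ) : ℝ≥0∞)⁻¹ = ∞ := by
  by_contra h
  have h1 : ∀ n : ℕ, ((n + 1 : ℕ) : ℝ≥0∞)⁻¹ = (((n + 1 : ℕ) : ℝ≥0)⁻¹ : ℝ≥0) := by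
    intro n
    rw [ENNReal.coe_inv (by positivity)]
    simp
  simp_rw [h1] at h
  have h2 := NNReal.summable_coe.2 (ENNReal.tsum_coe_ne_top_iff_summable.1 h)
  push_cast at h2
  have h3 : Summable fun n : ℕ => ((n : ℝ))⁻¹ := by
    refine (summable_nat_add_iff 1).1 (h2.congr fun n => ?_)
    simp
  exact Real.not_summable_natCast_inv h3

/-- The Green function of a symmetric law with finite variance on `ℤ^d`, `d ≤ 2`, is infinite at the
origin. -/
lemma tsum_convPow_zero_eq_top (hd : d ≤ 2) {f : Vertex d → ℝ≥0∞} (hf : ∀ x, f (-x) = f x)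
    (hf1 : ∑' x, f x = 1) (hV : ∑' x, f x * sqNorm x ≠ ∞) : ∑' k, convPow f k 0 = ∞ := by
  obtain ⟨K, hK⟩ := ENNReal.exists_nat_gt hV
  have hterm : ∀ n : ℕ, ((8 * (8 * (K + 1)) ^ 2 : ℕ) : ℝ≥0∞)⁻¹ * ((n + 1 : ℕ) : ℝ≥0∞)⁻¹ ≤
      convPow f (2 * (n + 1)) 0 := by
    intro n
    set s := (n + 1).sqrt with hs
    have hs1 : 1 ≤ s := by rw [hs]; exact Nat.le_sqrt.2 (by omega)
    have hsle : s ^ 2 ≤ n + 1 := Nat.sqrt_le' _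
    have hslt : n + 1 < (s + 1) ^ 2 := Nat.lt_succ_sqrt' _
    -- `R` is of order `√n`: large enough for Chebyshev, since `K` bounds the variance, and such
    -- that the box has `O(n)` points when `d ≤ 2`. The return probabilities then dominate a
    -- harmonic series.
    set R := 2 * (K + 1) * (s + 1) with hRdef
    have hR : 2 * (((n + 1 : ℕ) : ℝ≥0∞) * ∑' x, f x * sqNorm x) ≤ ((R ^ 2 : ℕ) : ℝ≥0∞) := by
      calc 2 * (((n + 1 : ℕ) : ℝ≥0∞) * ∑' x, f x * sqNorm x)
          ≤ 2 * (((n + 1 : ℕ) : ℝ≥0∞) * K) := by gcongr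
        _ = ((2 * ((n + 1) * K) : ℕ) : ℝ≥0∞) := by push_cast; ring
        _ ≤ ((R ^ 2 : ℕ) : ℝ≥0∞) := by
            refine Nat.cast_le.2 ?_
            calc 2 * ((n + 1) * K) ≤ 2 * ((s + 1) ^ 2 * K) := by gcongr
              _ = (2 * K) * (s + 1) ^ 2 := by ring
              _ ≤ (2 * (K + 1)) ^ 2 * (s + 1) ^ 2 := Nat.mul_le_mul (by nlinarith) le_rfl
              _ = R ^ 2 := by rw [hRdef]; ring
    have h1 := one_le_mul_convPow_two_mul hf hf1 (R := R) (n := n + 1) (by positivity) hR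
    have hpow : (2 * R + 1) ^ d ≤ (8 * (K + 1)) ^ 2 * (n + 1) * 2 := by
      calc (2 * R + 1) ^ d ≤ (2 * R + 1) ^ 2 := Nat.pow_le_pow_right (by omega) hd
        _ ≤ ((8 * (K + 1) + 1) * s) ^ 2 := Nat.pow_le_pow_left (by
            rw [hRdef]; nlinarith) 2
        _ = (8 * (K + 1) + 1) ^ 2 * s ^ 2 := by ring
        _ ≤ ((8 * (K + 1)) ^ 2 * 2) * (n + 1) := Nat.mul_le_mul (by nlinarith) hsle
        _ = _ := by ring
    set c : ℝ≥0∞ := ((8 * (8 * (K + 1)) ^ 2 : ℕ) : ℝ≥0∞) * ((n + 1 : ℕ) : ℝ≥0∞) with hc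
    have hc0 : c ≠ 0 := by
      rw [hc]; exact mul_ne_zero (by exact_mod_cast (by positivity)) (by positivity)
    have hct : c ≠ ∞ := ENNReal.mul_ne_top (ENNReal.natCast_ne_top _) (ENNReal.natCast_ne_top _)
    have h2 : 1 ≤ c * convPow f (2 * (n + 1)) 0 := by
      refine h1.trans (mul_le_mul' ?_ le_rfl)
      rw [hc]
      calc 4 * (((2 * R + 1) ^ d : ℕ) : ℝ≥0∞) = ((4 * (2 * R + 1) ^ d : ℕ) : ℝ≥0∞) := by
            push_cast; ring
        _ ≤ ((8 * (8 * (K + 1)) ^ 2 * (n + 1) : ℕ) : ℝ≥0∞) := Nat.cast_le.2 (by linarith)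
        _ = _ := by push_cast; ring
    rw [← ENNReal.mul_inv (.inr (ENNReal.natCast_ne_top _)) (.inl (ENNReal.natCast_ne_top _)), ← hc]
    calc c⁻¹ = c⁻¹ * 1 := (mul_one _).symm
      _ ≤ c⁻¹ * (c * convPow f (2 * (n + 1)) 0) := mul_le_mul' le_rfl h2
      _ = convPow f (2 * (n + 1)) 0 := by
          rw [← mul_assoc, ENNReal.inv_mul_cancel hc0 hct, one_mul]
  have hinj : Function.Injective fun n : ℕ => 2 * (n + 1) := fun a b h => by
    simp only at h; omega
  have h2 := (ENNReal.tsum_le_tsum hterm).trans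
    (ENNReal.tsum_comp_le_tsum_of_injective hinj fun k => convPow f k 0)
  rw [ENNReal.tsum_mul_left, tsum_inv_natCast_add_one,
    ENNReal.mul_top (ENNReal.inv_ne_zero.2 (ENNReal.natCast_ne_top _))] at h2
  exact top_le_iff.1 h2

end SecondMoment

end DynPerc

namespace DynPerc

open scoped ENNReal

variable {d : ℕ}

lemma measurable_loadStep : Measurable fun q : ℝ × LifeInput d => loadStep q.1 q.2 := by
  unfold loadStep
  fun_prop

lemma measurable_load (n : ℕ) : Measurable fun q : ℝ × (ℕ → LifeInput d) => load n q.1 q.2 := by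
  induction n with
  | zero => exact measurable_fst
  | succ n ih =>
    simp_rw [load_succ']
    exact measurable_loadStep.comp (ih.prodMk (by fun_prop))

lemma measurable_freshWalk (n : ℕ) : Measurable (freshWalk (d := d) n) :=
  measurable_fst.comp ((lifeRule_isMeasurable.run n).comp measurable_prodMk_left)

lemma loadStep_mono {w w' : ℝ} (h : w ≤ w') (i : LifeInput d) : loadStep w i ≤ loadStep w' i :=
  max_le_max le_rfl (sub_le_sub_right (max_le_max h le_rfl) _)

/-! ### Survival of the lifetimes and a Lyapunov criterion -/

section Tail

/-- The lifetimes have never all expired at the looks number `1, …, n`. -/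
def neverExpired (n : ℕ) (w : ℝ) : Set (ℕ → LifeInput d) :=
  {ζ | ∀ k, 0 < k → k ≤ n → load k w ζ ≠ 0}

lemma measurableSet_neverExpired' (n : ℕ) :
    MeasurableSet {q : ℝ × (ℕ → LifeInput d) | q.2 ∈ neverExpired n q.1} := by
  have : {q : ℝ × (ℕ → LifeInput d) | q.2 ∈ neverExpired n q.1} =
      ⋂ k, ⋂ (_ : 0 < k), ⋂ (_ : k ≤ n), {q | load k q.1 q.2 ≠ 0} := by
    ext; simp [neverExpired]
  rw [this]
  exact .iInter fun k => .iInter fun _ => .iInter fun _ =>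
    (measurable_load k (measurableSet_singleton 0)).compl

lemma measurableSet_neverExpired (n : ℕ) (w : ℝ) :
    MeasurableSet (neverExpired (d := d) n w) :=
  (measurable_prodMk_left (x := w)) (measurableSet_neverExpired' n)

lemma seqCons_mem_neverExpired {n : ℕ} {w : ℝ} {i : LifeInput d} {ζ : ℕ → LifeInput d} :
    seqCons i ζ ∈ neverExpired (n + 1) w ↔
      loadStep w i ≠ 0 ∧ ζ ∈ neverExpired n (loadStep w i) := by
  have h : ∀ k, load (k + 1) w (seqCons i ζ) = load k (loadStep w i) ζ := by
    intro k
    rw [load_succ, seqShift_succ_seqCons, seqShift_zero, seqCons_zero]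
  constructor
  · intro H
    refine ⟨?_, fun k hk hkn => ?_⟩
    · have := H 1 one_pos (by omega)
      rwa [h 0] at this
    · rw [← h]; exact H (k + 1) (by omega) (by omega)
  · rintro ⟨h1, h2⟩ k hk hkn
    obtain ⟨k, rfl⟩ := Nat.exists_eq_succ_of_ne_zero hk.ne'
    rw [Nat.succ_eq_add_one, h]
    rcases Nat.eq_zero_or_pos k with rfl | hk'
    · exact h1
    · exact h2 k hk' (by omega)

variable (m : Measure (LifeInput d)) [IsProbabilityMeasure m]

/-- Surviving one more look costs a factor `ρ` in the mean of `V`, and `V ≥ 1` turns this into a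
bound on the survival probability. -/
lemma iid_neverExpired_le {V : ℝ → ℝ≥0∞} {ρ : ℝ≥0∞} (hV : ∀ w, 1 ≤ V w)
    (hρ : ∀ w, 0 ≤ w → ∫⁻ i in {i | loadStep w i ≠ 0}, V (loadStep w i) ∂m ≤ ρ * V w)
    (hVm : Measurable V) (n : ℕ) {w : ℝ} (hw : 0 ≤ w) :
    iid m (neverExpired n w) ≤ ρ ^ n * V w := by
  induction n generalizing w with
  | zero =>
    rw [pow_zero, one_mul]
    exact prob_le_one.trans (hV w)
  | succ n ih =>
    have hset : MeasurableSet {i : LifeInput d | loadStep w i ≠ 0} :=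
      ((measurable_loadStep.comp measurable_prodMk_left) (measurableSet_singleton 0)).compl
    rw [iid_apply_eq_lintegral m (measurableSet_neverExpired _ _)]
    calc ∫⁻ i, iid m {ζ | seqCons i ζ ∈ neverExpired (n + 1) w} ∂m
        ≤ ∫⁻ i, {i | loadStep w i ≠ 0}.indicator (fun i => ρ ^ n * V (loadStep w i)) i ∂m := by
          refine lintegral_mono fun i => ?_
          simp only [seqCons_mem_neverExpired]
          by_cases h : loadStep w i = 0
          · simp [h]
          · rw [Set.indicator_of_mem (by exact h)]
            simp only [ne_eq, h, not_false_eq_true, true_and, Set.ofPred_mem_eq]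
            exact ih (loadStep_nonneg w i)
      _ = ρ ^ n * ∫⁻ i in {i | loadStep w i ≠ 0}, V (loadStep w i) ∂m := by
          rw [lintegral_indicator hset, lintegral_const_mul]
          exact hVm.comp (measurable_loadStep.comp measurable_prodMk_left)
      _ ≤ ρ ^ n * (ρ * V w) := mul_le_mul' le_rfl (hρ w hw)
      _ = ρ ^ (n + 1) * V w := by rw [pow_succ, mul_assoc]

end Tail

/-! ### The Lyapunov function and exponential tails -/

section Lyapunov

/-- Tilting by half of the rate turns the density of rate `μ` into twice that of rate `μ / 2`. -/
lemma lintegral_exp_half_expMeasure {μ : ℝ} (hμ : 0 < μ) :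
    ∫⁻ x, ENNReal.ofReal (Real.exp (μ / 2 * x)) ∂expMeasure μ = 2 := by
  have h1 : ∀ x, exponentialPDF μ x * ENNReal.ofReal (Real.exp (μ / 2 * x)) =
      2 * exponentialPDF (μ / 2) x := by
    intro x
    rw [exponentialPDF_eq, exponentialPDF_eq, ← ENNReal.ofReal_mul (by split_ifs <;> positivity),
      show (2 : ℝ≥0∞) = ENNReal.ofReal 2 by simp, ← ENNReal.ofReal_mul (by norm_num)]
    congr 1
    split_ifs
    · rw [mul_assoc, ← Real.exp_add]
      rw [show -(μ * x) + μ / 2 * x = -(μ / 2 * x) by ring]; ring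
    · simp
  have h2 : ∫⁻ x, ENNReal.ofReal (Real.exp (μ / 2 * x)) ∂expMeasure μ =
      ∫⁻ x, exponentialPDF μ x * ENNReal.ofReal (Real.exp (μ / 2 * x)) := by
    have : expMeasure μ = volume.withDensity (exponentialPDF μ) := rfl
    rw [this, lintegral_withDensity_eq_lintegral_mul _ (by unfold exponentialPDF; fun_prop)
      (by fun_prop)]
    rfl
  rw [h2]
  simp_rw [h1]
  rw [lintegral_const_mul _ (by unfold exponentialPDF; fun_prop),
    lintegral_exponentialPDF_eq_one (by positivity), mul_one]

variable (p : unitInterval) {μ : ℝ}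

lemma measurePreserving_life_gap [NeZero d] (hμ : 0 < μ) :
    MeasurePreserving (fun i : LifeInput d => (i.2.1.2, i.2.2)) (inputLaw d p μ)
      ((expMeasure μ).prod (expMeasure 1)) := by
  have := isProbabilityMeasure_expMeasure hμ
  have := isProbabilityMeasure_expMeasure one_pos
  have h1 : MeasurePreserving (fun i : LifeInput d => i.2) (inputLaw d p μ)
      ((lookLaw p μ).prod (expMeasure 1)) := measurePreserving_snd
  have h2 : MeasurePreserving (fun q : (Bool × ℝ) × ℝ => (q.1.2, q.2))
      ((lookLaw p μ).prod (expMeasure 1)) ((expMeasure μ).prod (expMeasure 1)) :=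
    measurePreserving_snd.prod (MeasurePreserving.id _)
  exact h2.comp h1

lemma inputLaw_loadStep_eq_zero_pos [NeZero d] (hμ : 0 < μ) {M : ℝ} (hM : 0 ≤ M) :
    0 < inputLaw d p μ {i | loadStep M i = 0} := by
  have := isProbabilityMeasure_expMeasure hμ
  have := isProbabilityMeasure_expMeasure one_pos
  have hsub : (fun i : LifeInput d => (i.2.1.2, i.2.2)) ⁻¹' (Set.Iic (M + 1) ×ˢ Set.Ioi (M + 1)) ⊆
      {i | loadStep M i = 0} := by
    rintro i ⟨h1, h2⟩
    simp only [Set.mem_Iic, Set.mem_Ioi] at h1 h2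
    have h3 : max M i.2.1.2 ≤ |i.2.2| := max_le (by linarith [le_abs_self i.2.2])
      (by linarith [le_abs_self i.2.2])
    simp only [Set.mem_ofPred_eq, loadStep]
    exact max_eq_left (by linarith)
  refine lt_of_lt_of_le ?_ (measure_mono hsub)
  rw [(measurePreserving_life_gap p hμ).measure_preimage
    (measurableSet_Iic.prod measurableSet_Ioi).nullMeasurableSet, Measure.prod_prod,
    expMeasure_Iic hμ _ (by linarith), expMeasure_Ioi one_pos _ (by linarith)]
  refine ENNReal.mul_pos ?_ ?_
  · have h1 : Real.exp (-(μ * (M + 1))) < 1 := by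
      simpa using Real.exp_lt_exp.2 (show -(μ * (M + 1)) < 0 by nlinarith)
    rw [ne_eq, ENNReal.ofReal_eq_zero, not_le]
    linarith
  · rw [ne_eq, ENNReal.ofReal_eq_zero, not_le]
    exact Real.exp_pos _

/-- The exponential of a maximum is at most the sum of the exponentials, and the independent waiting
time contributes its Laplace transform as a factor. -/
lemma lintegral_exp_loadStep_le [NeZero d] (hμ : 0 < μ) (w : ℝ) :
    ∫⁻ i in {i | loadStep w i ≠ 0}, ENNReal.ofReal (Real.exp (μ / 2 * loadStep w i))
        ∂inputLaw d p μ ≤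
      (ENNReal.ofReal (Real.exp (μ / 2 * w)) + 2) *
        ∫⁻ x, ENNReal.ofReal (Real.exp (-(μ / 2 * x))) ∂expMeasure 1 := by
  have := isProbabilityMeasure_expMeasure hμ
  have := isProbabilityMeasure_expMeasure one_pos
  have hset : MeasurableSet {i : LifeInput d | loadStep w i ≠ 0} :=
      ((measurable_loadStep.comp measurable_prodMk_left) (measurableSet_singleton 0)).compl
  have hmeas : Measurable fun q : ℝ × ℝ =>
      (ENNReal.ofReal (Real.exp (μ / 2 * w)) + ENNReal.ofReal (Real.exp (μ / 2 * q.1))) *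
        ENNReal.ofReal (Real.exp (-(μ / 2 * q.2))) := by fun_prop
  calc _ ≤ ∫⁻ i in {i | loadStep w i ≠ 0}, (ENNReal.ofReal (Real.exp (μ / 2 * w)) +
          ENNReal.ofReal (Real.exp (μ / 2 * i.2.1.2))) *
          ENNReal.ofReal (Real.exp (-(μ / 2 * i.2.2))) ∂inputLaw d p μ := by
        refine setLIntegral_mono' hset fun i hi => ?_
        have h1 : loadStep w i = max w i.2.1.2 - |i.2.2| := by
          rcases max_choice 0 (max w i.2.1.2 - |i.2.2|) with h | h
          · exact absurd h hi
          · exact h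
        rw [← ENNReal.ofReal_add (Real.exp_nonneg _) (Real.exp_nonneg _),
          ← ENNReal.ofReal_mul (by positivity)]
        refine ENNReal.ofReal_le_ofReal ?_
        have h2 : μ / 2 * loadStep w i ≤ μ / 2 * max w i.2.1.2 + -(μ / 2 * i.2.2) := by
          rw [h1]; nlinarith [le_abs_self i.2.2]
        refine (Real.exp_le_exp.2 h2).trans ?_
        rw [Real.exp_add]
        refine mul_le_mul_of_nonneg_right ?_ (Real.exp_nonneg _)
        rcases max_choice w i.2.1.2 with h | h <;> rw [h]
        · linarith [Real.exp_nonneg (μ / 2 * i.2.1.2)]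
        · linarith [Real.exp_nonneg (μ / 2 * w)]
    _ ≤ ∫⁻ i, (ENNReal.ofReal (Real.exp (μ / 2 * w)) +
          ENNReal.ofReal (Real.exp (μ / 2 * i.2.1.2))) *
          ENNReal.ofReal (Real.exp (-(μ / 2 * i.2.2))) ∂inputLaw d p μ := setLIntegral_le_lintegral _ _
    _ = ∫⁻ q, (ENNReal.ofReal (Real.exp (μ / 2 * w)) + ENNReal.ofReal (Real.exp (μ / 2 * q.1))) *
          ENNReal.ofReal (Real.exp (-(μ / 2 * q.2))) ∂(expMeasure μ).prod (expMeasure 1) :=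
        (measurePreserving_life_gap p hμ).lintegral_comp hmeas
    _ = _ := by
        rw [lintegral_prod_mul (f := fun l => ENNReal.ofReal (Real.exp (μ / 2 * w)) +
            ENNReal.ofReal (Real.exp (μ / 2 * l)))
          (g := fun g => ENNReal.ofReal (Real.exp (-(μ / 2 * g))))
          (by fun_prop) (by fun_prop), lintegral_add_left measurable_const, lintegral_const,
          measure_univ, mul_one, lintegral_exp_half_expMeasure hμ]

/-- The probability that the lifetimes have not all expired before the `n`-th look decays
exponentially. -/
lemma exists_iid_neverExpired_le [NeZero d] (hμ : 0 < μ) :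
    ∃ ρ C : ℝ≥0, ρ < 1 ∧ ∀ n, iid (inputLaw d p μ) (neverExpired n 0) ≤ C * ρ ^ n := by
  have := isProbabilityMeasure_expMeasure hμ
  have := isProbabilityMeasure_expMeasure one_pos
  have hlam := lintegral_exp_neg_lt_one one_pos (half_pos hμ)
  set lam := ∫⁻ x, ENNReal.ofReal (Real.exp (-(μ / 2 * x))) ∂expMeasure 1 with hlamdef
  have hlamt : lam ≠ ∞ := ne_top_of_lt (hlam.trans ENNReal.one_lt_top)
  set l := lam.toReal with hl
  have hl0 : 0 ≤ l := ENNReal.toReal_nonneg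
  have hl1 : l < 1 := by
    rw [hl, ← ENNReal.toReal_one]; exact (ENNReal.toReal_lt_toReal hlamt ENNReal.one_ne_top).2 hlam
  have hlof : lam = ENNReal.ofReal l := (ENNReal.ofReal_toReal hlamt).symm
  -- beyond `M` the exponential part of the Lyapunov function decreases
  obtain ⟨M, hM0, hM⟩ : ∃ M : ℝ, 0 ≤ M ∧ 2 * l + 1 ≤ (1 - l) / 2 * Real.exp (μ / 2 * M) := by
    have h1 : Tendsto (fun M : ℝ => (1 - l) / 2 * Real.exp (μ / 2 * M)) atTop atTop :=
      (Real.tendsto_exp_atTop.comp (tendsto_id.const_mul_atTop (half_pos hμ))).const_mul_atTop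
        (by linarith)
    obtain ⟨M, h2, h3⟩ := ((eventually_ge_atTop 0).and (h1.eventually_ge_atTop (2 * l + 1))).exists
    exact ⟨M, h2, h3⟩
  -- Below `M`, one look leaves the load positive with probability at most `s < 1`.
  set s := (inputLaw d p μ {i | loadStep M i ≠ 0}).toReal with hs
  have hs1 : s < 1 := by
    have h1 := inputLaw_loadStep_eq_zero_pos (d := d) p hμ hM0
    have hset : MeasurableSet {i : LifeInput d | loadStep M i = 0} :=
      (measurable_loadStep.comp measurable_prodMk_left) (measurableSet_singleton 0)
    have h2 : inputLaw d p μ {i | loadStep M i ≠ 0} < 1 := by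
      change inputLaw d p μ {i | loadStep M i = 0}ᶜ < 1
      rw [prob_compl_eq_one_sub hset]
      exact ENNReal.sub_lt_self ENNReal.one_ne_top one_ne_zero h1.ne'
    rw [hs, ← ENNReal.toReal_one]
    exact (ENNReal.toReal_lt_toReal (measure_ne_top _ _) ENNReal.one_ne_top).2 h2
  have hs0 : 0 ≤ s := ENNReal.toReal_nonneg
  -- `A` is the constant part of the Lyapunov function. It is so large that, below `M`, the gain `A
  -- (1 - s) / 2` pays for the additive term `2 l` of the exponential part.
  set A : ℝ := max 1 (4 * l / (1 - s)) with hA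
  have hA1 : 1 ≤ A := le_max_left _ _
  have hA2 : 2 * l ≤ A * ((1 - s) / 2) := by
    have : 4 * l / (1 - s) ≤ A := le_max_right _ _
    rw [div_le_iff₀ (by linarith)] at this
    linarith
  -- The three entries contract the exponential part, the constant part below `M`, and the constant
  -- part above `M`. In the last case `A` drops by at most `1`, which the exponential part pays for
  -- by the choice of `M`.
  set ρ : ℝ := max (max ((1 + l) / 2) ((1 + s) / 2)) (1 - 1 / A) with hρ
  have hρ1 : ρ < 1 := by
    refine max_lt (max_lt (by linarith) (by linarith)) ?_
    have : 0 < 1 / A := by positivity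
    linarith
  have hρl : (1 + l) / 2 ≤ ρ := (le_max_left _ _).trans (le_max_left _ _)
  have hρs : (1 + s) / 2 ≤ ρ := (le_max_right _ _).trans (le_max_left _ _)
  have hρA : A - 1 ≤ ρ * A := by
    have h1 : 1 - 1 / A ≤ ρ := le_max_right _ _
    calc A - 1 = (1 - 1 / A) * A := by field_simp
      _ ≤ ρ * A := mul_le_mul_of_nonneg_right h1 (by linarith)
  have hρ0 : 0 ≤ ρ := by linarith
  set V : ℝ → ℝ≥0∞ := fun w => ENNReal.ofReal A + ENNReal.ofReal (Real.exp (μ / 2 * w)) with hV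
  have hVm : Measurable V := by rw [hV]; fun_prop
  have hV1 : ∀ w, 1 ≤ V w := fun w =>
    le_add_right (by rw [← ENNReal.ofReal_one]; exact ENNReal.ofReal_le_ofReal hA1)
  have hdrift : ∀ w, 0 ≤ w → ∫⁻ i in {i | loadStep w i ≠ 0}, V (loadStep w i) ∂inputLaw d p μ ≤
      ENNReal.ofReal ρ * V w := by
    intro w hw
    set sw := (inputLaw d p μ {i | loadStep w i ≠ 0}).toReal with hsw
    have hsw0 : 0 ≤ sw := ENNReal.toReal_nonneg
    have h1 : ∫⁻ i in {i | loadStep w i ≠ 0}, V (loadStep w i) ∂inputLaw d p μ ≤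
        ENNReal.ofReal (A * sw + (Real.exp (μ / 2 * w) + 2) * l) := by
      rw [hV]
      simp only
      rw [lintegral_add_left measurable_const, setLIntegral_const,
        ENNReal.ofReal_add (by positivity) (by positivity), ENNReal.ofReal_mul (by positivity),
        ENNReal.ofReal_mul (by positivity), ENNReal.ofReal_add (by positivity) (by positivity),
        ENNReal.ofReal_toReal (measure_ne_top _ _), ← hlof, ENNReal.ofReal_ofNat]
      exact add_le_add le_rfl (lintegral_exp_loadStep_le p hμ w)
    refine h1.trans ?_
    rw [hV]
    simp only
    rw [← ENNReal.ofReal_add (by positivity) (by positivity), ← ENNReal.ofReal_mul hρ0]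
    refine ENNReal.ofReal_le_ofReal ?_
    have hexp := Real.exp_pos (μ / 2 * w)
    rcases le_total w M with hwM | hwM
    · have h2 : sw ≤ s := by
        refine ENNReal.toReal_mono (measure_ne_top _ _) (measure_mono fun i hi h0 => hi ?_)
        exact le_antisymm ((loadStep_mono hwM i).trans h0.le) (loadStep_nonneg w i)
      nlinarith [mul_le_mul_of_nonneg_left h2 (by linarith : (0 : ℝ) ≤ A),
        mul_le_mul_of_nonneg_left hρs (by linarith : (0 : ℝ) ≤ A),
        mul_le_mul_of_nonneg_left hρl hexp.le]
    · have h2 : sw ≤ 1 := by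
        rw [hsw, ← ENNReal.toReal_one]
        exact ENNReal.toReal_mono ENNReal.one_ne_top prob_le_one
      have h3 : Real.exp (μ / 2 * M) ≤ Real.exp (μ / 2 * w) := Real.exp_le_exp.2 (by nlinarith)
      nlinarith [mul_le_mul_of_nonneg_left h2 (by linarith : (0 : ℝ) ≤ A),
        mul_le_mul_of_nonneg_left hρl hexp.le,
        mul_le_mul_of_nonneg_left h3 (by linarith : (0 : ℝ) ≤ (1 - l) / 2)]
  refine ⟨ρ.toNNReal, (V 0).toNNReal, ?_, fun n => ?_⟩
  · rw [← Real.toNNReal_one]; exact (Real.toNNReal_lt_toNNReal_iff one_pos).2 hρ1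
  · have h1 := iid_neverExpired_le (inputLaw d p μ) hV1 hdrift hVm n le_rfl
    rw [ENNReal.coe_toNNReal (by simp [hV]), mul_comm]
    exact h1

end Lyapunov

end DynPerc

namespace DynPerc

open scoped ENNReal

/-! ### Summing a renewal equation -/

section Summation

variable {A : Type*} [AddCommGroup A]

lemma tsum_sum_range_sub (F : ℕ → ℕ → ℝ≥0∞) :
    ∑' n, ∑ k ∈ Finset.range (n + 1), F k (n - k) = ∑' k, ∑' j, F k j := by
  rw [← ENNReal.tsum_prod, ← Finset.HasAntidiagonal.sigmaAntidiagonalEquivProd.tsum_eq, ENNReal.tsum_sigma']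
  refine tsum_congr fun n => ?_
  rw [← Finset.Nat.sum_antidiagonal_eq_sum_range_succ F, tsum_fintype]
  exact (Finset.sum_coe_sort (Finset.HasAntidiagonal.antidiagonal n) fun q : ℕ × ℕ => F q.1 q.2).symm

lemma conv_tsum (f u : ℕ → A → ℝ≥0∞) (x : A) :
    conv (fun y => ∑' k, f k y) (fun y => ∑' j, u j y) x = ∑' k, ∑' j, conv (f k) (u j) x := by
  unfold conv
  simp_rw [← ENNReal.tsum_mul_right, ← ENNReal.tsum_mul_left]
  rw [ENNReal.tsum_comm]
  exact tsum_congr fun k => ENNReal.tsum_comm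

variable [DecidableEq A] {f u : ℕ → A → ℝ≥0∞}

/-- The sum of the solution of a renewal equation. -/
lemma tsum_eq_tsum_convPow (hf : f 0 = 0)
    (h : ∀ n x, u n x = (if n = 0 then Pi.single (M := fun _ => ℝ≥0∞) 0 1 x else 0) +
      ∑ k ∈ Finset.range (n + 1), conv (f k) (u (n - k)) x) (x : A) :
    ∑' n, u n x = ∑' k, convPow (fun y => ∑' n, f n y) k x := by
  set F : A → ℝ≥0∞ := fun y => ∑' n, f n y with hF
  have hG : ∀ x, ∑' n, u n x = Pi.single (M := fun _ => ℝ≥0∞) 0 1 x +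
      conv F (fun y => ∑' n, u n y) x := by
    intro x
    conv_lhs => rw [tsum_congr fun n => h n x]
    rw [ENNReal.tsum_add, tsum_ite_eq, conv_tsum,
      tsum_sum_range_sub fun k j => conv (f k) (u j) x]
  have hsucc : ∀ K x, ∑ k ∈ Finset.range (K + 1), convPow F k x =
      Pi.single (M := fun _ => ℝ≥0∞) 0 1 x +
        conv F (fun y => ∑ k ∈ Finset.range K, convPow F k y) x := by
    intro K x
    rw [Finset.sum_range_succ', conv_sum_right, add_comm]
    rfl
  -- The identity `hG` does not determine a possibly infinite sum, so each side's partial sums are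
  -- compared with the other side.
  refine le_antisymm ?_ ?_
  · rw [ENNReal.tsum_eq_iSup_nat]
    refine iSup_le fun N => ?_
    refine le_trans ?_ (ENNReal.sum_le_tsum (Finset.range N))
    induction N generalizing x with
    | zero => simp
    | succ N ih =>
      -- As `f 0 = 0`, the equations for indices up to `N` involve only `u j` with `j < N` on the
      -- right, and `u` may be truncated.
      set v : ℕ → A → ℝ≥0∞ := fun j => if j < N then u j else 0 with hv
      have hv1 : ∀ y, ∑' j, v j y = ∑ j ∈ Finset.range N, u j y := by
        intro y
        rw [tsum_eq_sum (s := Finset.range N) fun j hj => by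
          simp [hv, Finset.mem_range.not.1 hj]]
        exact Finset.sum_congr rfl fun j hj => by simp [hv, Finset.mem_range.1 hj]
      rw [hsucc]
      refine le_trans ?_ (add_le_add le_rfl (conv_mono (fun _ => le_rfl) ih x))
      simp_rw [← hv1]
      rw [hF, conv_tsum, ← tsum_sum_range_sub fun k j => conv (f k) (v j) x,
        Finset.sum_congr rfl fun n _ => h n x, Finset.sum_add_distrib]
      refine add_le_add (by simp) (le_trans (Finset.sum_le_sum fun n hn => ?_)
        (ENNReal.sum_le_tsum (Finset.range (N + 1))))
      refine Finset.sum_le_sum fun k hk => ?_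
      rcases Nat.eq_zero_or_pos k with rfl | hk0
      · simp [hf, conv]
      · have : n - k < N := by
          rw [Finset.mem_range] at hn hk; omega
        simp [hv, this]
  · rw [ENNReal.tsum_eq_iSup_nat]
    refine iSup_le fun K => ?_
    induction K generalizing x with
    | zero => simp
    | succ K ih =>
      rw [hsucc, hG]
      exact add_le_add le_rfl (conv_mono (fun _ => le_rfl) ih x)

end Summation

variable {d : ℕ}

/-! ### The embedded random walk at regenerations -/

section Regeneration

/-- All the lifetimes have expired after the look number `n`, and the walk is then at `x`. -/
def visit (n : ℕ) (x : Vertex d) : Set (ℕ → LifeInput d) :=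
  {ζ | load n 0 ζ = 0 ∧ freshWalk n ζ = x}

/-- All the lifetimes have expired after the look number `n`, for the first time. -/
def firstRegen (n : ℕ) : Set (ℕ → LifeInput d) :=
  {ζ | 0 < n ∧ (∀ k, 0 < k → k < n → load k 0 ζ ≠ 0) ∧ load n 0 ζ = 0}

/-- The walk is at `x` at the first time when all the lifetimes have expired, and this is after the
look number `n`. -/
def firstVisit (n : ℕ) (x : Vertex d) : Set (ℕ → LifeInput d) :=
  firstRegen n ∩ {ζ | freshWalk n ζ = x}

/-- The walk is at `x` after `n` looks, and the lifetimes have not all expired in between. -/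
def excursion (n : ℕ) (x : Vertex d) : Set (ℕ → LifeInput d) :=
  neverExpired n 0 ∩ {ζ | freshWalk n ζ = x}

lemma measurableSet_load_eq (n : ℕ) :
    MeasurableSet {ζ : ℕ → LifeInput d | load n 0 ζ = 0} :=
  ((measurable_load n).comp measurable_prodMk_left) (measurableSet_singleton 0)

lemma measurableSet_freshWalk_eq (n : ℕ) (x : Vertex d) :
    MeasurableSet {ζ : ℕ → LifeInput d | freshWalk n ζ = x} :=
  measurable_freshWalk n (measurableSet_singleton x)

lemma measurableSet_visit (n : ℕ) (x : Vertex d) : MeasurableSet (visit n x) :=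
  (measurableSet_load_eq n).inter (measurableSet_freshWalk_eq n x)

lemma measurableSet_firstRegen (n : ℕ) : MeasurableSet (firstRegen (d := d) n) := by
  have : firstRegen (d := d) n = {ζ | 0 < n} ∩ ((⋂ k, ⋂ (_ : 0 < k), ⋂ (_ : k < n),
      {ζ | load k 0 ζ = 0}ᶜ) ∩ {ζ | load n 0 ζ = 0}) := by
    ext; simp [firstRegen]
  rw [this]
  exact (MeasurableSet.const _).inter (.inter (.iInter fun k => .iInter fun _ => .iInter fun _ =>
    (measurableSet_load_eq k).compl) (measurableSet_load_eq n))

lemma measurableSet_firstVisit (n : ℕ) (x : Vertex d) : MeasurableSet (firstVisit n x) :=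
  (measurableSet_firstRegen n).inter (measurableSet_freshWalk_eq n x)

lemma measurableSet_excursion (n : ℕ) (x : Vertex d) : MeasurableSet (excursion n x) :=
  (measurableSet_neverExpired n 0).inter (measurableSet_freshWalk_eq n x)

lemma visit_congr {n : ℕ} {x : Vertex d} {ζ ζ' : ℕ → LifeInput d} (h : ∀ k < n, ζ k = ζ' k)
    (hζ : ζ ∈ visit n x) : ζ' ∈ visit n x := by
  rwa [visit, Set.mem_ofPred_eq, ← load_congr n 0 h, ← freshWalk_congr n h]

lemma firstVisit_congr {n : ℕ} {x : Vertex d} {ζ ζ' : ℕ → LifeInput d}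
    (h : ∀ k < n, ζ k = ζ' k) (hζ : ζ ∈ firstVisit n x) : ζ' ∈ firstVisit n x := by
  obtain ⟨⟨h1, h2, h3⟩, h4⟩ := hζ
  refine ⟨⟨h1, fun k hk hkn => ?_, ?_⟩, ?_⟩
  · rw [← load_congr k 0 fun j hj => h j (by omega)]; exact h2 k hk hkn
  · rwa [← load_congr n 0 h]
  · rwa [Set.mem_ofPred_eq, ← freshWalk_congr n h]

lemma load_add_of_eq_zero {n : ℕ} {ζ : ℕ → LifeInput d} (h : load n 0 ζ = 0) (k : ℕ) :
    load (n + k) 0 ζ = load k 0 (seqShift n ζ) := by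
  rw [load_add, h]

/-- Split at the first regeneration `k > 0` and its position `y`; from there on the walk is fresh,
by `freshWalk_add`. -/
lemma visit_eq_iUnion {n : ℕ} (hn : n ≠ 0) (x : Vertex d) :
    visit n x = ⋃ k ∈ Finset.range (n + 1), ⋃ y,
      firstVisit k y ∩ seqShift k ⁻¹' visit (n - k) (x - y) := by
  classical
  ext ζ
  simp only [Set.mem_iUnion, Finset.mem_range, exists_prop]
  constructor
  · rintro ⟨h1, h2⟩
    have hex : ∃ k, 0 < k ∧ load k 0 ζ = 0 := ⟨n, by omega, h1⟩
    have hle : Nat.find hex ≤ n := Nat.find_min' hex ⟨by omega, h1⟩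
    obtain ⟨h3, h4⟩ := Nat.find_spec hex
    have hmin : ∀ k, 0 < k → k < Nat.find hex → load k 0 ζ ≠ 0 :=
      fun k hk hk' h => Nat.find_min hex hk' ⟨hk, h⟩
    generalize Nat.find hex = k at *
    obtain ⟨j, rfl⟩ := Nat.exists_eq_add_of_le hle
    refine ⟨k, by omega, freshWalk k ζ, ⟨⟨h3, hmin, h4⟩, rfl⟩, ?_⟩
    rw [Nat.add_sub_cancel_left]
    refine ⟨by rwa [← load_add_of_eq_zero h4], ?_⟩
    rw [← h2, freshWalk_add h4, add_sub_cancel_left]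
  · rintro ⟨k, hk, y, ⟨⟨h1, h2, h3⟩, h4⟩, h5, h6⟩
    obtain ⟨j, rfl⟩ := Nat.exists_eq_add_of_le (Nat.lt_succ_iff.1 hk)
    rw [Nat.add_sub_cancel_left] at h5 h6
    rw [Set.mem_ofPred_eq] at h4
    exact ⟨by rwa [load_add_of_eq_zero h3], by rw [freshWalk_add h3, h6, h4, add_sub_cancel]⟩

/-- Split at the last regeneration up to `n`, which exists since `load` starts at zero. -/
lemma freshWalk_eq_subset (n : ℕ) (x : Vertex d) :
    {ζ | freshWalk n ζ = x} ⊆ ⋃ k ∈ Finset.range (n + 1), ⋃ y,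
      visit k y ∩ seqShift k ⁻¹' excursion (n - k) (x - y) := by
  classical
  intro ζ hζ
  simp only [Set.mem_iUnion, Finset.mem_range, exists_prop]
  set k := Nat.findGreatest (fun k => load k 0 ζ = 0) n with hk
  have hkn : k ≤ n := Nat.findGreatest_le n
  have hk0 : load k 0 ζ = 0 := Nat.findGreatest_spec (P := fun k => load k 0 ζ = 0)
    (Nat.zero_le n) rfl
  have hmax : ∀ j, k < j → j ≤ n → load j 0 ζ ≠ 0 := fun j hj hjn =>
    Nat.findGreatest_is_greatest hj hjn
  obtain ⟨j, hj⟩ := Nat.exists_eq_add_of_le hkn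
  refine ⟨k, by omega, freshWalk k ζ, ⟨hk0, rfl⟩, fun i hi hin => ?_, ?_⟩
  · rw [← load_add_of_eq_zero hk0]
    exact hmax _ (by omega) (by omega)
  · rw [Set.mem_ofPred_eq] at hζ ⊢
    rw [show n - k = j by omega, ← hζ, hj, freshWalk_add hk0, add_sub_cancel_left]

variable (m : Measure (LifeInput d))

lemma tsum_iid_inter_freshWalk (n : ℕ) {B : Set (ℕ → LifeInput d)} (hB : MeasurableSet B) :
    ∑' x, iid m (B ∩ {ζ | freshWalk n ζ = x}) = iid m B := by
  rw [← measure_iUnion]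
  · congr 1
    ext ζ
    simp
  · intro y z hyz
    exact Set.disjoint_left.2 fun ζ h1 h2 => hyz (h1.2.symm.trans h2.2)
  · exact fun x => hB.inter (measurableSet_freshWalk_eq n x)

lemma tsum_iid_firstVisit (n : ℕ) : ∑' x, iid m (firstVisit n x) = iid m (firstRegen n) :=
  tsum_iid_inter_freshWalk m n (measurableSet_firstRegen n)

lemma tsum_iid_excursion (n : ℕ) : ∑' x, iid m (excursion n x) = iid m (neverExpired n 0) :=
  tsum_iid_inter_freshWalk m n (measurableSet_neverExpired n 0)

lemma iid_neverExpired_succ (n : ℕ) :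
    iid m (neverExpired (n + 1) 0) + iid m (firstRegen (n + 1)) = iid m (neverExpired n 0) := by
  rw [← measure_union _ (measurableSet_firstRegen _)]
  · congr 1
    ext ζ
    constructor
    · rintro (h | ⟨-, h, -⟩) k hk hkn
      · exact h k hk (by omega)
      · exact h k hk (by omega)
    · intro h
      by_cases h0 : load (n + 1) 0 ζ = 0
      · exact .inr ⟨by omega, fun k hk hkn => h k hk (by omega), h0⟩
      · refine .inl fun k hk hkn => ?_
        rcases Nat.lt_or_ge k (n + 1) with h1 | h1
        · exact h k hk (by omega)
        · rwa [show k = n + 1 by omega]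
  · exact Set.disjoint_left.2 fun ζ h1 h2 => h1 (n + 1) (by omega) le_rfl h2.2.2

/-- The law of the displacement between successive times when all the lifetimes have expired. -/
noncomputable def stepLaw (x : Vertex d) : ℝ≥0∞ := ∑' n, iid m (firstVisit n x)

lemma tsum_stepLaw_eq : ∑' x, stepLaw m x = ∑' n, iid m (firstRegen n) := by
  unfold stepLaw
  rw [ENNReal.tsum_comm]
  exact tsum_congr fun n => tsum_iid_firstVisit m n

/-- In `n + 1` attempts each coordinate moves by at most `n + 1`, and a first regeneration at `n +
1` requires survival up to `n`. -/
lemma stepLaw_mul_sqNorm_le :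
    ∑' x, stepLaw m x * sqNorm x ≤ ∑' n : ℕ, (d * (n + 1) ^ 2 : ℕ) * iid m (neverExpired n 0) := by
  unfold stepLaw
  simp_rw [← ENNReal.tsum_mul_right]
  rw [ENNReal.tsum_comm, tsum_eq_zero_add' ENNReal.summable]
  have h0 : ∑' x, iid m (firstVisit 0 x) * sqNorm x = 0 := by simp [firstVisit, firstRegen]
  rw [h0, zero_add]
  refine ENNReal.tsum_le_tsum fun n => ?_
  calc ∑' x, iid m (firstVisit (n + 1) x) * sqNorm x
      ≤ ∑' x, (d * (n + 1) ^ 2 : ℕ) * iid m (firstVisit (n + 1) x) := by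
        refine ENNReal.tsum_le_tsum fun x => ?_
        rw [mul_comm]
        rcases (firstVisit (n + 1) x).eq_empty_or_nonempty with h | ⟨ζ, -, hζ⟩
        · simp [h]
        · refine mul_le_mul' ?_ le_rfl
          rw [sqNorm, Nat.cast_le]
          refine (Finset.sum_le_card_nsmul _ _ ((n + 1) ^ 2) fun i _ => ?_).trans (by simp)
          have h1 := abs_freshWalk_le (n + 1) ζ i
          rw [Set.mem_ofPred_eq] at hζ
          rw [hζ] at h1
          rw [abs_le] at h1
          exact Nat.pow_le_pow_left (by omega) 2
    _ = (d * (n + 1) ^ 2 : ℕ) * iid m (firstRegen (n + 1)) := by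
        rw [ENNReal.tsum_mul_left, tsum_iid_firstVisit]
    _ ≤ _ := by
        refine mul_le_mul' le_rfl ?_
        rw [← iid_neverExpired_succ m n]
        exact le_add_self

variable [IsProbabilityMeasure m]

lemma iid_visit_zero (x : Vertex d) :
    iid m (visit 0 x) = Pi.single (M := fun _ => ℝ≥0∞) 0 1 x := by
  by_cases hx : x = 0
  · subst hx; simp [visit]
  · simp [visit, hx, Ne.symm hx]

lemma iid_visit (n : ℕ) (x : Vertex d) :
    iid m (visit n x) = (if n = 0 then Pi.single (M := fun _ => ℝ≥0∞) 0 1 x else 0) +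
      ∑ k ∈ Finset.range (n + 1),
        conv (fun y => iid m (firstVisit k y)) (fun y => iid m (visit (n - k) y)) x := by
  rcases eq_or_ne n 0 with rfl | hn
  · simp [iid_visit_zero, conv, firstVisit, firstRegen]
  · rw [if_neg hn, zero_add, visit_eq_iUnion hn, measure_biUnion_finset]
    · refine Finset.sum_congr rfl fun k _ => ?_
      rw [measure_iUnion]
      · exact tsum_congr fun y => iid_inter_seqShift m k (measurableSet_firstVisit k y)
          (measurableSet_visit _ _) fun ζ ζ' h => firstVisit_congr h
      · intro y z hyz
        exact Set.disjoint_left.2 fun ζ h1 h2 => hyz (h1.1.2.symm.trans h2.1.2)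
      · exact fun y => (measurableSet_firstVisit k y).inter
          (measurable_seqShift k (measurableSet_visit _ _))
    · intro k _ l _ hkl
      refine Set.disjoint_left.2 fun ζ h1 h2 => ?_
      simp only [Set.mem_iUnion] at h1 h2
      obtain ⟨y, ⟨⟨hk0, hk, hk'⟩, -⟩, -⟩ := h1
      obtain ⟨z, ⟨⟨hl0, hl, hl'⟩, -⟩, -⟩ := h2
      rcases lt_or_gt_of_ne hkl with h | h
      · exact hl k hk0 h hk'
      · exact hk l hl0 h hl'
    · exact fun k _ => .iUnion fun y => (measurableSet_firstVisit k y).inter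
          (measurable_seqShift k (measurableSet_visit _ _))

lemma iid_freshWalk_eq_le (n : ℕ) (x : Vertex d) :
    iid m {ζ | freshWalk n ζ = x} ≤ ∑ k ∈ Finset.range (n + 1),
        conv (fun y => iid m (visit k y)) (fun y => iid m (excursion (n - k) y)) x := by
  refine (measure_mono (freshWalk_eq_subset n x)).trans
    ((measure_biUnion_finset_le _ _).trans (Finset.sum_le_sum fun k _ => ?_))
  refine (measure_iUnion_le _).trans_eq (tsum_congr fun y => ?_)
  exact iid_inter_seqShift m k (measurableSet_visit k y) (measurableSet_excursion _ _)
    fun ζ ζ' h => visit_congr h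

lemma sum_iid_firstRegen (n : ℕ) :
    ∑ k ∈ Finset.range (n + 1), iid m (firstRegen k) + iid m (neverExpired n 0) = 1 := by
  induction n with
  | zero =>
    have h1 : neverExpired (d := d) 0 0 = Set.univ := by
      ext ζ; simp only [neverExpired, Set.mem_ofPred_eq, Set.mem_univ, iff_true]; omega
    simp [firstRegen, h1]
  | succ n ih =>
    rw [Finset.sum_range_succ, add_assoc, add_comm (iid m (firstRegen (n + 1))),
      iid_neverExpired_succ, ih]

lemma tsum_stepLaw_le_one : ∑' x, stepLaw m x ≤ 1 := by
  rw [tsum_stepLaw_eq, ENNReal.tsum_eq_iSup_nat]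
  refine iSup_le fun n => ?_
  rw [← sum_iid_firstRegen m n]
  refine le_add_right (Finset.sum_le_sum_of_subset (Finset.range_mono (by omega)))

lemma tsum_stepLaw (h : Tendsto (fun n => iid m (neverExpired n 0)) atTop (nhds 0)) :
    ∑' x, stepLaw m x = 1 := by
  rw [tsum_stepLaw_eq]
  have h1 := ((tendsto_add_atTop_iff_nat 1).2
    (ENNReal.tendsto_nat_tsum fun n => iid m (firstRegen n))).add h
  rw [add_zero] at h1
  refine tendsto_nhds_unique h1 ?_
  simp_rw [sum_iid_firstRegen]
  exact tendsto_const_nhds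

/-- Expected visits at regenerations form the Green function of the walk with step law `stepLaw`. -/
lemma tsum_iid_visit (x : Vertex d) :
    ∑' n, iid m (visit n x) = ∑' k, convPow (stepLaw m) k x :=
  tsum_eq_tsum_convPow (f := fun n y => iid m (firstVisit n y))
    (by funext y; simp [firstVisit, firstRegen]) (iid_visit m) x

/-- Every visit belongs to the excursion after some regeneration, so the Green function at all
attempts is at most a convolution of the regenerative one with the excursions, whose total mass is
the first factor. -/
lemma tsum_iid_freshWalk_eq_le {M : ℝ≥0∞} (hM : ∀ x, ∑' k, convPow (stepLaw m) k x ≤ M)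
    (x : Vertex d) :
    ∑' n, iid m {ζ | freshWalk n ζ = x} ≤ (∑' n, iid m (neverExpired n 0)) * M := by
  calc _ ≤ ∑' n, ∑ k ∈ Finset.range (n + 1),
        conv (fun y => iid m (visit k y)) (fun y => iid m (excursion (n - k) y)) x :=
        ENNReal.tsum_le_tsum fun n => iid_freshWalk_eq_le m n x
    _ = conv (fun y => ∑' n, iid m (visit n y)) (fun y => ∑' n, iid m (excursion n y)) x := by
        rw [conv_tsum, tsum_sum_range_sub fun k j =>
          conv (fun y => iid m (visit k y)) (fun y => iid m (excursion j y)) x]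
    _ = conv (fun y => ∑' n, iid m (excursion n y)) (fun y => ∑' n, iid m (visit n y)) x := by
        rw [conv_comm]
    _ ≤ (∑' y, ∑' n, iid m (excursion n y)) * M :=
        conv_le_of_le (fun y => (tsum_iid_visit m y).trans_le (hM y)) x
    _ = _ := by
        rw [ENNReal.tsum_comm]
        simp_rw [tsum_iid_excursion]

end Regeneration

end DynPerc

namespace DynPerc

open scoped ENNReal

/-! ### Recurrence of renewal events -/

section RenewalEvents

variable {S : Type*} [MeasurableSpace S] {C : ℕ → Set (ℕ → S)}

lemma measurableSet_forall_notMem (hCm : ∀ n, MeasurableSet (C n)) (n : ℕ) :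
    MeasurableSet {ζ | ∀ k, n < k → ζ ∉ C k} := by
  have : {ζ | ∀ k, n < k → ζ ∉ C k} = ⋂ k, ⋂ (_ : n < k), (C k)ᶜ := by ext; simp
  rw [this]
  exact .iInter fun k => .iInter fun _ => (hCm k).compl

variable (m : Measure S) [IsProbabilityMeasure m]

/-- The probability that the renewal event number `n` occurs and is the last one. -/
lemma iid_last_renewal (hCm : ∀ n, MeasurableSet (C n))
    (hloc : ∀ n (ζ ζ' : ℕ → S), (∀ k < n, ζ k = ζ' k) → ζ ∈ C n → ζ' ∈ C n)
    (hren : ∀ n k ζ, ζ ∈ C n → (ζ ∈ C (n + k) ↔ seqShift n ζ ∈ C k)) (n : ℕ) :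
    iid m (C n ∩ {ζ | ∀ k, n < k → ζ ∉ C k}) =
      iid m (C n) * iid m {ζ | ∀ k, 0 < k → ζ ∉ C k} := by
  rw [← iid_inter_seqShift m n (hCm n) (measurableSet_forall_notMem hCm 0) (hloc n)]
  congr 1
  ext ζ
  simp only [Set.mem_inter_iff, Set.mem_ofPred_eq, Set.mem_preimage, and_congr_right_iff]
  intro hζ
  constructor
  · intro h k hk
    rw [← hren n k ζ hζ]
    exact h _ (by omega)
  · intro h k hk
    obtain ⟨j, rfl⟩ := Nat.exists_eq_add_of_le hk.le
    rw [hren n j ζ hζ]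
    exact h j (by omega)

/-- The events that `n` is the last renewal are disjoint, and their probabilities are those of `C n`
times the probability of no renewal. An infinite sum of the former leaves only the value zero for
the latter. -/
lemma iid_no_renewal_eq_zero (hCm : ∀ n, MeasurableSet (C n))
    (hloc : ∀ n (ζ ζ' : ℕ → S), (∀ k < n, ζ k = ζ' k) → ζ ∈ C n → ζ' ∈ C n)
    (hren : ∀ n k ζ, ζ ∈ C n → (ζ ∈ C (n + k) ↔ seqShift n ζ ∈ C k))
    (hsum : ∑' n, iid m (C n) = ∞) : iid m {ζ | ∀ k, 0 < k → ζ ∉ C k} = 0 := by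
  by_contra h0
  have h1 : ∑' n, iid m (C n ∩ {ζ | ∀ k, n < k → ζ ∉ C k}) ≤ 1 := by
    rw [← measure_iUnion]
    · exact prob_le_one
    · intro k l hkl
      refine Set.disjoint_left.2 fun ζ hk hl => ?_
      rcases lt_or_gt_of_ne hkl with h | h
      · exact hk.2 l h hl.1
      · exact hl.2 k h hk.1
    · exact fun n => (hCm n).inter (measurableSet_forall_notMem hCm n)
  simp_rw [iid_last_renewal m hCm hloc hren] at h1
  rw [ENNReal.tsum_mul_right, hsum, ENNReal.top_mul h0] at h1
  exact absurd h1 (by simp)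

lemma ae_frequently_renewal (hCm : ∀ n, MeasurableSet (C n))
    (hloc : ∀ n (ζ ζ' : ℕ → S), (∀ k < n, ζ k = ζ' k) → ζ ∈ C n → ζ' ∈ C n)
    (hren : ∀ n k ζ, ζ ∈ C n → (ζ ∈ C (n + k) ↔ seqShift n ζ ∈ C k)) (h0 : C 0 = Set.univ)
    (h : iid m {ζ | ∀ k, 0 < k → ζ ∉ C k} = 0) : ∀ᵐ ζ ∂iid m, ∃ᶠ n in atTop, ζ ∈ C n := by
  have h1 : ∀ᵐ ζ ∂iid m, ∀ n, ζ ∉ C n ∩ {ζ | ∀ k, n < k → ζ ∉ C k} := by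
    rw [ae_all_iff]
    intro n
    rw [← measure_eq_zero_iff_ae_notMem, iid_last_renewal m hCm hloc hren, h, mul_zero]
  filter_upwards [h1] with ζ hζ
  rw [Nat.frequently_atTop_iff_infinite]
  intro hfin
  obtain ⟨n, hn, hmax⟩ := hfin.exists_maximal ⟨0, by simp [h0]⟩
  exact hζ n ⟨hn, fun k hk hkC => absurd (hmax hkC hk.le) (by omega)⟩

end RenewalEvents

lemma measurableSet_frequently_atTop {α : Type*} [MeasurableSpace α] {C : ℕ → Set α}
    (hC : ∀ n, MeasurableSet (C n)) : MeasurableSet {x | ∃ᶠ n in atTop, x ∈ C n} := by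
  have : {x | ∃ᶠ n in atTop, x ∈ C n} = ⋂ N, ⋃ n, ⋃ (_ : N ≤ n), C n := by
    ext; simp [frequently_atTop]
  rw [this]
  exact .iInter fun N => .iUnion fun n => .iUnion fun _ => hC n

lemma tsum_pow_mul_pow_ne_top (r : ℕ) {ρ : ℝ≥0} (hρ : ρ < 1) :
    ∑' n : ℕ, ((n + 1) ^ r : ℕ) * (ρ : ℝ≥0∞) ^ n ≠ ∞ := by
  have h : Summable fun n : ℕ => ((n + 1 : ℕ) : ℝ≥0) ^ r * ρ ^ n := by
    rw [← NNReal.summable_coe]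
    push_cast
    by_cases hρ0 : ρ = 0
    · subst hρ0
      exact summable_of_ne_finset_zero (s := {0}) fun n hn => by simp_all
    · have h2 := (summable_nat_add_iff 1).2 (summable_pow_mul_geometric_of_norm_lt_one (R := ℝ) r
        (r := ρ) (by simpa using hρ))
      refine (h2.mul_left (ρ : ℝ)⁻¹).congr fun n => ?_
      have : (ρ : ℝ) ≠ 0 := by exact_mod_cast hρ0
      push_cast
      rw [pow_succ]
      field_simp
  refine ne_top_of_le_ne_top (ENNReal.tsum_coe_ne_top_iff_summable.2 h)
    (ENNReal.tsum_le_tsum fun n => le_of_eq ?_)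
  push_cast
  ring

variable {d : ℕ}

lemma measurePreserving_flipDirection :
    MeasurePreserving (flipDirection (d := d)) (uniformOn Set.univ) (uniformOn Set.univ) := by
  refine ⟨(measurable_of_finite _), Measure.ext_of_singleton fun v => ?_⟩
  rw [Measure.map_apply (measurable_of_finite _) (measurableSet_singleton v), uniformOn_univ,
    uniformOn_univ]
  have : flipDirection ⁻¹' {v} = {flipDirection v} := by
    ext ⟨i, b⟩
    obtain ⟨j, c⟩ := v
    simp only [flipDirection, Set.mem_preimage, Set.mem_singleton_iff, Prod.mk.injEq]
    cases b <;> cases c <;> simp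
  simp [this]

lemma neighbor_zero (v : Direction d) :
    neighbor 0 v = Pi.single v.1 (if v.2 then 1 else -1) := by
  unfold neighbor
  split_ifs <;> simp [Pi.single_neg]

variable [NeZero d] (p : unitInterval) {μ : ℝ}

/-! ### Recurrence and transience of the fresh walk -/

section Walk

lemma isProbabilityMeasure_lookLaw (hμ : 0 < μ) : IsProbabilityMeasure (lookLaw p μ) := by
  have := isProbabilityMeasure_expMeasure hμ
  unfold lookLaw
  infer_instance

lemma isProbabilityMeasure_inputLaw (hμ : 0 < μ) : IsProbabilityMeasure (inputLaw d p μ) := by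
  have := isProbabilityMeasure_lookLaw p hμ
  have := isProbabilityMeasure_expMeasure one_pos
  unfold inputLaw
  infer_instance

lemma tsum_pow_mul_iid_neverExpired_ne_top (hμ : 0 < μ) (r : ℕ) :
    ∑' n : ℕ, ((n + 1) ^ r : ℕ) * iid (inputLaw d p μ) (neverExpired n 0) ≠ ∞ := by
  obtain ⟨ρ, C, hρ, h⟩ := exists_iid_neverExpired_le (d := d) p hμ
  refine ne_top_of_le_ne_top (ENNReal.mul_ne_top (ENNReal.coe_ne_top (r := C))
    (tsum_pow_mul_pow_ne_top r hρ)) ?_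
  rw [← ENNReal.tsum_mul_left]
  refine ENNReal.tsum_le_tsum fun n => (mul_le_mul' le_rfl (h n)).trans_eq ?_
  ring

lemma tsum_iid_neverExpired_ne_top (hμ : 0 < μ) :
    ∑' n : ℕ, iid (inputLaw d p μ) (neverExpired n 0) ≠ ∞ := by
  simpa using tsum_pow_mul_iid_neverExpired_ne_top (d := d) p hμ 0

lemma tendsto_iid_neverExpired (hμ : 0 < μ) :
    Tendsto (fun n => iid (inputLaw d p μ) (neverExpired n 0)) atTop (nhds 0) :=
  ENNReal.tendsto_atTop_zero_of_tsum_ne_top (tsum_iid_neverExpired_ne_top p hμ)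

lemma tsum_stepLaw_mul_sqNorm_ne_top (hμ : 0 < μ) :
    ∑' x, stepLaw (inputLaw d p μ) x * sqNorm x ≠ ∞ := by
  have := isProbabilityMeasure_inputLaw (d := d) p hμ
  refine ne_top_of_le_ne_top ?_ (stepLaw_mul_sqNorm_le (inputLaw d p μ))
  simp_rw [Nat.cast_mul d, mul_assoc]
  rw [ENNReal.tsum_mul_left]
  exact ENNReal.mul_ne_top (ENNReal.natCast_ne_top d)
    (tsum_pow_mul_iid_neverExpired_ne_top p hμ 2)

lemma measurePreserving_flipInput (hμ : 0 < μ) :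
    MeasurePreserving (fun (ζ : ℕ → LifeInput d) k => flipInput (ζ k))
      (iid (inputLaw d p μ)) (iid (inputLaw d p μ)) := by
  have := isProbabilityMeasure_inputLaw (d := d) p hμ
  have := isProbabilityMeasure_lookLaw p hμ
  have := isProbabilityMeasure_expMeasure one_pos
  have h : MeasurePreserving (flipInput (d := d)) (inputLaw d p μ) (inputLaw d p μ) :=
    measurePreserving_flipDirection.prod (MeasurePreserving.id _)
  refine ⟨measurable_pi_iff.2 fun k => h.measurable.comp (measurable_pi_apply k), ?_⟩
  rw [Measure.infinitePi_map_pi _ fun _ => h.measurable, h.map_eq]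

lemma stepLaw_neg (hμ : 0 < μ) (x : Vertex d) :
    stepLaw (inputLaw d p μ) (-x) = stepLaw (inputLaw d p μ) x := by
  refine tsum_congr fun n => ?_
  rw [← (measurePreserving_flipInput p hμ).measure_preimage
    (measurableSet_firstVisit n x).nullMeasurableSet]
  congr 1
  ext ζ
  simp [firstVisit, firstRegen, load_flipInput, freshWalk_flipInput, neg_eq_iff_eq_neg]

variable {p}

/-- One scenario suffices: direction `v`, an open coin, a lifetime at most `1` and a waiting time
above `1`. The walker moves and regenerates at once. -/
lemma iid_visit_one_pos (hμ : 0 < μ) (hp : 0 < p) (v : Direction d) :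
    0 < iid (inputLaw d p μ) (visit 1 (neighbor 0 v)) := by
  have := isProbabilityMeasure_inputLaw (d := d) p hμ
  have := isProbabilityMeasure_lookLaw p hμ
  have := isProbabilityMeasure_expMeasure hμ
  have := isProbabilityMeasure_expMeasure one_pos
  set Q : Set (LifeInput d) := {v} ×ˢ (({true} ×ˢ Set.Iic 1) ×ˢ Set.Ioi 1) with hQ
  have hQm : MeasurableSet Q := (measurableSet_singleton v).prod
    (((measurableSet_singleton true).prod measurableSet_Iic).prod measurableSet_Ioi)
  have hsub : (fun ζ : ℕ → LifeInput d => ζ 0) ⁻¹' Q ⊆ visit 1 (neighbor 0 v) := by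
    rintro ζ ⟨h1, ⟨h2, h3⟩, h4⟩
    simp only [Set.mem_singleton_iff, Set.mem_Iic, Set.mem_Ioi] at h1 h2 h3 h4
    refine ⟨?_, ?_⟩
    · rw [load_succ, load_zero, loadStep]
      refine max_eq_left (sub_nonpos.2 (max_le (abs_nonneg _) ?_))
      linarith [le_abs_self (ζ 0).2.2]
    · rw [freshWalk_one, h1, h2]; simp [moved]
  refine lt_of_lt_of_le ?_ (measure_mono hsub)
  rw [(measurePreserving_eval_infinitePi (fun _ : ℕ => inputLaw d p μ) 0).measure_preimage
    hQm.nullMeasurableSet, hQ, inputLaw, Measure.prod_prod, Measure.prod_prod, lookLaw,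
    Measure.prod_prod, expMeasure_Iic hμ _ zero_le_one, expMeasure_Ioi one_pos _ zero_le_one,
    uniformOn_univ]
  have h1 : Real.exp (-(μ * 1)) < 1 := by simpa using hμ
  refine ENNReal.mul_pos ?_ (mul_ne_zero (mul_ne_zero ?_ ?_) ?_)
  · simp [ENNReal.mul_eq_top]
  · have hp' : unitInterval.toNNReal p ≠ 0 := by
      have : (0 : ℝ) < p := hp
      exact fun h => this.ne' (congrArg NNReal.toReal h)
    simp [bernoulliMeasure, hp']
  · rw [ne_eq, ENNReal.ofReal_eq_zero, not_le]; linarith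
  · rw [ne_eq, ENNReal.ofReal_eq_zero, not_le]; exact Real.exp_pos _

lemma exists_le_stepLaw (hμ : 0 < μ) (hp : 0 < p) : ∃ ε : ℝ≥0∞, ε ≠ 0 ∧
    ∀ (i : Fin d) (s : Bool), ε ≤ stepLaw (inputLaw d p μ) (Pi.single i (if s then 1 else -1)) := by
  have hpos : ∀ v : Direction d, 0 < stepLaw (inputLaw d p μ) (neighbor 0 v) := by
    intro v
    refine (iid_visit_one_pos hμ hp v).trans_le (le_trans (measure_mono fun ζ hζ => ?_)
      (ENNReal.le_tsum 1))
    exact ⟨⟨one_pos, fun k hk hk' => by omega, hζ.1⟩, hζ.2⟩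
  obtain ⟨v, hv⟩ := Finite.exists_min fun v : Direction d =>
    stepLaw (inputLaw d p μ) (neighbor 0 v)
  refine ⟨_, (hpos v).ne', fun i s => ?_⟩
  have := hv (i, s)
  rwa [neighbor_zero (i, s)] at this

/-- In dimension at least three the walk leaves every finite set. -/
lemma ae_tendsto_freshWalk (hμ : 0 < μ) (hp : 0 < p) (hd : 3 ≤ d) :
    ∀ᵐ ζ ∂iid (inputLaw d p μ), Tendsto (fun n => freshWalk n ζ) atTop cofinite := by
  have := isProbabilityMeasure_inputLaw (d := d) p hμ
  obtain ⟨ε, hε, hstep⟩ := exists_le_stepLaw (d := d) hμ hp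
  obtain ⟨M, hM, hG⟩ := exists_tsum_convPow_le hd (tsum_stepLaw_le_one (inputLaw d p μ)) hε hstep
  have h : ∀ᵐ ζ ∂iid (inputLaw d p μ), ∀ x, ∀ᶠ n in atTop, ζ ∉ {ζ | freshWalk n ζ = x} := by
    rw [ae_all_iff]
    -- Borel–Cantelli: the expected number of visits to each vertex is finite.
    refine fun x => ae_eventually_notMem (ne_top_of_le_ne_top ?_
      (tsum_iid_freshWalk_eq_le (inputLaw d p μ) hG x))
    exact ENNReal.mul_ne_top (tsum_iid_neverExpired_ne_top p hμ) hM
  filter_upwards [h] with ζ hζ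
  exact le_cofinite_iff_eventually_ne.2 fun x => hζ x

lemma ae_frequently_load_eq_zero (hμ : 0 < μ) :
    ∀ᵐ ζ ∂iid (inputLaw d p μ), ∃ᶠ n in atTop, load n 0 ζ = 0 := by
  have := isProbabilityMeasure_inputLaw (d := d) p hμ
  refine ae_frequently_renewal (C := fun n => {ζ : ℕ → LifeInput d | load n 0 ζ = 0}) (inputLaw d p μ)
    (fun n => measurableSet_load_eq n) ?_ ?_ ?_ ?_
  · intro n ζ ζ' h hζ
    rwa [Set.mem_ofPred_eq, ← load_congr n 0 h]
  · intro n k ζ hζ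
    rw [Set.mem_ofPred_eq, Set.mem_ofPred_eq, load_add_of_eq_zero hζ]
  · simp
  · refine le_antisymm (ge_of_tendsto' (tendsto_iid_neverExpired (d := d) p hμ) fun n => ?_) zero_le
    exact measure_mono fun ζ hζ k hk _ => hζ k hk

/-- Regenerating at the origin is a renewal event, because the future is then a fresh walk from the
same place. -/
lemma ae_frequently_visit_zero (hμ : 0 < μ) (hd : d ≤ 2) :
    ∀ᵐ ζ ∂iid (inputLaw d p μ), ∃ᶠ n in atTop, ζ ∈ visit n 0 := by
  have := isProbabilityMeasure_inputLaw (d := d) p hμ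
  have hloc : ∀ n (ζ ζ' : ℕ → LifeInput d), (∀ k < n, ζ k = ζ' k) → ζ ∈ visit n 0 → ζ' ∈ visit n 0 :=
    fun n ζ ζ' h => visit_congr h
  have hren : ∀ n k (ζ : ℕ → LifeInput d), ζ ∈ visit n 0 →
      (ζ ∈ visit (n + k) 0 ↔ seqShift n ζ ∈ visit k 0) := by
    rintro n k ζ ⟨h1, h2⟩
    rw [visit, visit, Set.mem_ofPred_eq, Set.mem_ofPred_eq, load_add_of_eq_zero h1,
      freshWalk_add h1, h2, zero_add]
  refine ae_frequently_renewal (inputLaw d p μ) (fun n => measurableSet_visit n 0) hloc hren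
    (by simp [visit]) (iid_no_renewal_eq_zero _ (fun n => measurableSet_visit n 0) hloc hren ?_)
  rw [tsum_iid_visit]
  exact tsum_convPow_zero_eq_top hd (stepLaw_neg p hμ)
    (tsum_stepLaw _ (tendsto_iid_neverExpired p hμ)) (tsum_stepLaw_mul_sqNorm_ne_top p hμ)

/-- Concatenation at regenerations makes the reachable vertices a submonoid, and it contains all
signed unit vectors. -/
lemma exists_iid_visit_pos (hμ : 0 < μ) (hp : 0 < p) (x : Vertex d) :
    ∃ n, 0 < iid (inputLaw d p μ) (visit n x) := by
  have := isProbabilityMeasure_inputLaw (d := d) p hμ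
  let H : AddSubmonoid (Vertex d) :=
    { carrier := {x | ∃ n, 0 < iid (inputLaw d p μ) (visit n x)}
      zero_mem' := ⟨0, by simp [iid_visit_zero]⟩
      add_mem' := by
        rintro x y ⟨n, hn⟩ ⟨k, hk⟩
        refine ⟨n + k, lt_of_lt_of_le (ENNReal.mul_pos hn.ne' hk.ne') ?_⟩
        rw [← iid_inter_seqShift _ n (measurableSet_visit n x) (measurableSet_visit k y)
          fun ζ ζ' h => visit_congr h]
        refine measure_mono ?_
        rintro ζ ⟨⟨h1, h2⟩, h3, h4⟩
        exact ⟨by rwa [load_add_of_eq_zero h1], by rw [freshWalk_add h1, h2, h4]⟩ }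
  have h1 : ∀ v, neighbor 0 v ∈ H := fun v => ⟨1, iid_visit_one_pos hμ hp v⟩
  change x ∈ H
  rw [← Finset.univ_sum_single x]
  refine sum_mem fun i _ => ?_
  have hplus := h1 (i, true)
  have hminus := h1 (i, false)
  simp only [neighbor_zero, ↓reduceIte, Bool.false_eq_true] at hplus hminus
  obtain ⟨n, h | h⟩ := (x i).eq_nat_or_neg
  · have := H.nsmul_mem hplus n
    rwa [← Pi.single_smul, nsmul_eq_mul, mul_one, ← h] at this
  · have := H.nsmul_mem hminus n
    rwa [← Pi.single_smul, nsmul_eq_mul, mul_neg_one, ← h] at this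

/-- In dimensions one and two the walk visits every vertex infinitely often. -/
lemma ae_frequently_freshWalk_eq (hμ : 0 < μ) (hp : 0 < p) (hd : d ≤ 2) :
    ∀ᵐ ζ ∂iid (inputLaw d p μ), ∀ x, ∃ᶠ n in atTop, freshWalk n ζ = x := by
  have := isProbabilityMeasure_inputLaw (d := d) p hμ
  rw [ae_all_iff]
  intro x
  obtain ⟨n, hn⟩ := exists_iid_visit_pos (d := d) hμ hp (-x)
  set B : Set (ℕ → LifeInput d) := {ζ | ∃ᶠ n in atTop, freshWalk n ζ = x} with hB
  have hBm : MeasurableSet B := 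
    measurableSet_frequently_atTop fun n => measurableSet_freshWalk_eq n x
  -- Regenerating at `-x` has positive probability and is independent of the sequel. Since the
  -- origin is revisited almost surely, a fresh walk from there must hit displacement `x` infinitely
  -- often.
  have h1 : iid (inputLaw d p μ) (visit n (-x) ∩ seqShift n ⁻¹' Bᶜ) = 0 := by
    refine measure_mono_null ?_ (ae_iff.1 (ae_frequently_visit_zero (p := p) hμ hd))
    rintro ζ ⟨⟨h1, h2⟩, h3⟩ h4
    refine h3 ?_
    rw [hB, Set.mem_ofPred_eq, frequently_atTop]
    intro N
    obtain ⟨k, hk, -, hk'⟩ := frequently_atTop.1 h4 (n + N)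
    obtain ⟨j, rfl⟩ := Nat.exists_eq_add_of_le (show n ≤ k by omega)
    refine ⟨j, by omega, ?_⟩
    rw [freshWalk_add h1, h2] at hk'
    exact (neg_add_eq_zero.1 hk').symm
  rw [iid_inter_seqShift _ n (measurableSet_visit n _) hBm.compl fun ζ ζ' h => visit_congr h] at h1
  exact ae_iff.2 ((mul_eq_zero.1 h1).resolve_left hn.ne')

end Walk

end DynPerc

/-! ### From the fresh walk to an arbitrary initial configuration -/

namespace DynPerc

open scoped ENNReal

variable {d : ℕ}

/-- The edges that the walk may look at in its attempt number `k`. -/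
noncomputable def nearEdges (d k : ℕ) : Finset (Edge d) :=
  (Fintype.piFinset fun _ => Finset.Icc (-(k + 1) : ℤ) (k + 1)) ×ˢ Finset.univ

lemma mem_nearEdges {k : ℕ} {e : Edge d} : e ∈ nearEdges d k ↔ ∀ i, |e.1 i| ≤ k + 1 := by
  simp [nearEdges, abs_le]

lemma card_nearEdges_le (k : ℕ) : (nearEdges d k).card ≤ 3 ^ d * d * (k + 1) ^ d := by
  have h : ((k : ℤ) + 1 + 1 - -(k + 1)).toNat = 2 * k + 3 := by omega
  rw [nearEdges, Finset.card_product, Fintype.card_piFinset_const, Int.card_Icc, h,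
    Finset.card_univ, Fintype.card_fin, mul_right_comm, ← mul_pow]
  exact Nat.mul_le_mul_right d (Nat.pow_le_pow_left (by omega) _)

lemma measurableSet_tendsto_cofinite :
    MeasurableSet {y : ℕ → Vertex d | Tendsto y atTop cofinite} := by
  have : {y : ℕ → Vertex d | Tendsto y atTop cofinite} =
      ⋂ x, {y | ∃ᶠ n in atTop, y n = x}ᶜ := by
    ext y
    simp only [Set.mem_ofPred_eq, Set.mem_iInter, Set.mem_compl_iff, not_frequently]
    exact le_cofinite_iff_eventually_ne
  rw [this]
  exact .iInter fun x => (measurableSet_frequently_atTop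
    fun n => measurable_pi_apply n (measurableSet_singleton x)).compl

section Comparison

variable [NeZero d] (p : unitInterval) {μ : ℝ}

/-- The number of edges within reach grows polynomially, while the mean of the exponential decays
geometrically. This is the Borel–Cantelli sum for the initial lifetimes at given attempt times. -/
lemma ae_tsum_exp_neg_arrivalTime_ne_top (hμ : 0 < μ) :
    ∀ᵐ w ∂iid (attemptLaw d), ∑' k, ((nearEdges d k).card : ℝ≥0∞) *
      ENNReal.ofReal (Real.exp (-(μ * arrivalTime (gaps w) k))) ≠ ∞ := by
  have := isProbabilityMeasure_expMeasure one_pos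
  have hlam := lintegral_exp_neg_lt_one one_pos hμ
  set lam := ∫⁻ x, ENNReal.ofReal (Real.exp (-(μ * x))) ∂expMeasure 1
  have hm : ∀ k, Measurable fun gap : ℕ → ℝ => ((nearEdges d k).card : ℝ≥0∞) *
      ENNReal.ofReal (Real.exp (-(μ * arrivalTime gap k))) := fun k => by
    have := measurable_arrivalTime k
    fun_prop
  have h : ∀ᵐ gap ∂iid (expMeasure 1), ∑' k, ((nearEdges d k).card : ℝ≥0∞) *
      ENNReal.ofReal (Real.exp (-(μ * arrivalTime gap k))) ≠ ∞ := by
    refine (ae_lt_top (Measurable.tsum hm) ?_).mono fun _ => ne_of_lt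
    rw [lintegral_tsum fun k => (hm k).aemeasurable]
    have h1 : ∀ k, ∫⁻ gap, ((nearEdges d k).card : ℝ≥0∞) *
        ENNReal.ofReal (Real.exp (-(μ * arrivalTime gap k))) ∂iid (expMeasure 1) ≤
        (3 ^ d * d : ℕ) * (((k + 1) ^ d : ℕ) * lam ^ k) := by
      intro k
      have := measurable_arrivalTime k
      rw [lintegral_const_mul _ (by fun_prop), lintegral_exp_neg_arrivalTime one_pos, ← mul_assoc,
        ← Nat.cast_mul]
      refine mul_le_mul' (Nat.cast_le.2 (card_nearEdges_le k)) ?_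
      exact pow_le_pow_right_of_le_one' hlam.le (by omega)
    refine ne_top_of_le_ne_top ?_ (ENNReal.tsum_le_tsum h1)
    rw [ENNReal.tsum_mul_left]
    refine ENNReal.mul_ne_top (ENNReal.natCast_ne_top _) ?_
    obtain ⟨ρ, hρ⟩ : ∃ ρ : ℝ≥0, (ρ : ℝ≥0∞) = lam :=
      ⟨lam.toNNReal, ENNReal.coe_toNNReal (ne_top_of_lt hlam)⟩
    rw [← hρ] at hlam ⊢
    exact tsum_pow_mul_pow_ne_top d (by exact_mod_cast hlam)
  exact (measurePreserving_gaps one_pos _).quasiMeasurePreserving.ae h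

/-- From some attempt on, all the edges that the walk can look at have refreshed. -/
lemma ae_eventually_le_arrivalTime (hμ : 0 < μ) :
    ∀ᵐ w ∂iid (attemptLaw d), ∀ᵐ l ∂Measure.infinitePi fun _ : Edge d => expMeasure μ,
      ∀ᶠ k : ℕ in atTop, ∀ e : Edge d, (∀ i, |e.1 i| ≤ k + 1) →
        l e ≤ arrivalTime (gaps w) k := by
  have := isProbabilityMeasure_expMeasure hμ
  filter_upwards [ae_tsum_exp_neg_arrivalTime_ne_top hμ, ae_isClock_gaps one_pos _] with w hw hc
  have h1 : ∀ k, Measure.infinitePi (fun _ : Edge d => expMeasure μ)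
      (⋃ e ∈ nearEdges d k, {l | arrivalTime (gaps w) k < l e}) ≤
      ((nearEdges d k).card : ℝ≥0∞) *
        ENNReal.ofReal (Real.exp (-(μ * arrivalTime (gaps w) k))) := by
    intro k
    rw [← nsmul_eq_mul]
    refine (measure_biUnion_finset_le _ _).trans (Finset.sum_le_card_nsmul _ _ _ fun e _ => ?_)
    have h2 := (measurePreserving_eval_infinitePi (fun _ : Edge d => expMeasure μ) e).measure_preimage
      (measurableSet_Ioi (a := arrivalTime (gaps w) k)).nullMeasurableSet
    refine h2.le.trans_eq (expMeasure_Ioi hμ _ ?_)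
    exact Finset.sum_nonneg fun j _ => (hc.pos j).le
  filter_upwards [ae_eventually_notMem (ne_top_of_le_ne_top hw (ENNReal.tsum_le_tsum h1))] with l hl
  filter_upwards [hl] with k hk e he
  by_contra h
  exact hk (Set.mem_biUnion (mem_nearEdges.2 he) (not_le.1 h))

/-- Almost sure properties of the tails of the walk that starts from the fresh state hold for the
tails of the random walk on dynamical percolation. -/
lemma ae_positionAfter_mem_of_freshWalk (hμ : 0 < μ) (η₀ : BondConfig d)
    {A B : Set (ℕ → Vertex d)} (hA : MeasurableSet A)
    (hB : ∀ᵐ ζ ∂iid (inputLaw d p μ), (fun n => freshWalk n ζ) ∈ B)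
    (hAB : ∀ y z n, z ∈ B → (∀ k, y (n + k) = y n + z k) → y ∈ A) :
    ∀ᵐ ω ∂law d p μ, positionAfter η₀ ω ∈ A := by
  have := isProbabilityMeasure_inputLaw (d := d) p hμ
  have := isProbabilityMeasure_lookLaw p hμ
  have := isProbabilityMeasure_expMeasure hμ
  have := isProbabilityMeasure_expMeasure one_pos
  have hload := Measure.ae_ae_of_ae_prod ((measurePreserving_inputs (d := d) p hμ).quasiMeasurePreserving.ae
    (ae_frequently_load_eq_zero hμ))
  have hshift : ∀ᵐ ζ ∂iid (inputLaw d p μ), ∀ n, (fun k => freshWalk k (seqShift n ζ)) ∈ B :=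
    ae_all_iff.2 fun n => (measurePreserving_seqShift (inputLaw d p μ) n).quasiMeasurePreserving.ae hB
  have hwalk := Measure.ae_ae_of_ae_prod
    ((measurePreserving_inputs (d := d) p hμ).quasiMeasurePreserving.ae hshift)
  refine ae_positionAfter_mem p hμ η₀ hA ?_
  filter_upwards [hload, hwalk, ae_eventually_le_arrivalTime hμ, ae_isClock_gaps one_pos _]
    with w h1 h2 h3 h4
  filter_upwards [Measure.quasiMeasurePreserving_snd.ae h1,
    Measure.quasiMeasurePreserving_snd.ae h2, Measure.quasiMeasurePreserving_fst.ae h3]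
    with q h1 h2 h3
  -- Initial lifetimes within reach have expired from `N` on, and `load` vanishes infinitely often,
  -- so some `n ≥ N` serves both purposes.
  obtain ⟨N, hN⟩ := eventually_atTop.1 h3
  obtain ⟨n, hn, hload⟩ := frequently_atTop.1 h1 N
  exact hAB _ _ n (h2 n) fun k => run_initialState_add η₀ h4 q.2 q.1 hload
    (fun k hk => hN k (hn.trans hk)) k

lemma ae_frequently_positionAfter_eq_zero {p : unitInterval} (hμ : 0 < μ) (hp : 0 < p) (hd : d ≤ 2)
    (η₀ : BondConfig d) : ∀ᵐ ω ∂law d p μ, ∃ᶠ n in atTop, positionAfter η₀ ω n = 0 := by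
  refine ae_positionAfter_mem_of_freshWalk (A := {y | ∃ᶠ n in atTop, y n = 0})
    (B := {z | ∀ x, ∃ᶠ n in atTop, z n = x}) p hμ η₀
    (measurableSet_frequently_atTop fun n => measurable_pi_apply n (measurableSet_singleton 0))
    (ae_frequently_freshWalk_eq hμ hp hd) fun y z n hz h => ?_
  refine frequently_atTop.2 fun N => ?_
  obtain ⟨k, hk, hk'⟩ := frequently_atTop.1 (hz (-y n)) N
  exact ⟨n + k, by omega, by rw [h, hk', add_neg_cancel]⟩

lemma ae_tendsto_positionAfter {p : unitInterval} (hμ : 0 < μ) (hp : 0 < p) (hd : 3 ≤ d)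
    (η₀ : BondConfig d) : ∀ᵐ ω ∂law d p μ, Tendsto (positionAfter η₀ ω) atTop cofinite := by
  refine ae_positionAfter_mem_of_freshWalk (A := {y | Tendsto y atTop cofinite})
    (B := {z | Tendsto z atTop cofinite}) p hμ η₀ measurableSet_tendsto_cofinite
    (ae_tendsto_freshWalk hμ hp hd) fun y z n hz h => ?_
  rw [Set.mem_ofPred_eq, ← tendsto_add_atTop_iff_nat n]
  have : (fun k => y (k + n)) = fun k => y n + z k := funext fun k => by rw [add_comm k, h]
  rw [this]
  exact (add_right_injective (y n)).tendsto_cofinite.comp hz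

end Comparison

/-! ### Passage to continuous time -/

section ContinuousTime

lemma ae_isClock_law [NeZero d] (p : unitInterval) {μ : ℝ} (hμ : 0 < μ) :
    ∀ᵐ ω ∂law d p μ, IsClock (gaps ω.2) := by
  have := isProbabilityMeasure_expMeasure hμ
  have := isProbabilityMeasure_expMeasure one_pos
  exact Measure.quasiMeasurePreserving_snd.ae (ae_isClock_gaps one_pos _)

lemma exists_walker_eq {η₀ : BondConfig d} {ω : Sample d} (hω : IsClock (gaps ω.2)) {x : Vertex d}
    (h : ∃ᶠ n in atTop, positionAfter η₀ ω n = x) (s₀ : ℝ≥0) :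
    ∃ s : ℝ≥0, s₀ ≤ s ∧ walker η₀ ω s = x := by
  obtain ⟨N, hN⟩ := eventually_atTop.1 (hω.tendsto.eventually_ge_atTop (s₀ : ℝ))
  obtain ⟨n, hn, hx⟩ := frequently_atTop.1 h (N + 1)
  obtain ⟨n, rfl⟩ := Nat.exists_eq_add_of_le' (show 1 ≤ n by omega)
  have hs := hN n (by omega)
  -- Arrivals are numbered from `0`, so the position after `n + 1` attempts is the one at arrival
  -- `n`.
  refine ⟨⟨arrivalTime (gaps ω.2) n, s₀.2.trans hs⟩, hs, ?_⟩
  rw [← hx, ← arrivalCount_eq_of_lt hω le_rfl (hω.strictMono n.lt_succ_self)]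
  rfl

lemma tendsto_walker {η₀ : BondConfig d} {ω : Sample d} (hω : IsClock (gaps ω.2))
    {l : Filter (Vertex d)} (h : Tendsto (positionAfter η₀ ω) atTop l) :
    Tendsto (fun t : ℝ≥0 => walker η₀ ω t) atTop l := by
  refine h.comp (tendsto_atTop.2 fun N => ?_)
  filter_upwards [eventually_ge_atTop (arrivalTime (gaps ω.2) N).toNNReal] with t ht
  exact (Nat.le_succ N).trans (le_arrivalCount hω (Real.toNNReal_le_iff_le_coe.1 ht))

end ContinuousTime

/-! ### The degenerate case `p = 0` -/

section Closed

lemma ae_choice_eq_false {μ : ℝ} (hμ : 0 < μ) :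
    ∀ᵐ ω ∂law d 0 μ, ∀ e n, (ω.1 e n).2 = false := by
  have := isProbabilityMeasure_expMeasure hμ
  have h1 : ∀ᵐ b ∂bernoulliMeasure true false 0, b = false := by
    simp [bernoulliMeasure]
  have h2 : ∀ᵐ q ∂(expMeasure μ).prod (bernoulliMeasure true false 0), q.2 = false :=
    Measure.quasiMeasurePreserving_snd.ae h1
  have h3 : ∀ᵐ r ∂iid ((expMeasure μ).prod (bernoulliMeasure true false 0)),
      ∀ n, (r n).2 = false :=
    ae_all_iff.2 fun n => (measurePreserving_eval_infinitePi (fun _ : ℕ =>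
      (expMeasure μ).prod (bernoulliMeasure true false 0)) n).quasiMeasurePreserving.ae h2
  have h4 : ∀ᵐ r ∂Measure.infinitePi fun _ : Edge d =>
      iid ((expMeasure μ).prod (bernoulliMeasure true false 0)), ∀ e n, (r e n).2 = false :=
    ae_all_iff.2 fun e => (measurePreserving_eval_infinitePi (fun _ : Edge d =>
      iid ((expMeasure μ).prod (bernoulliMeasure true false 0))) e).quasiMeasurePreserving.ae h3
  exact Measure.quasiMeasurePreserving_fst.ae h4

lemma edgeState_false {r : ℕ → ℝ × Bool} (h : ∀ n, (r n).2 = false) (t : ℝ) :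
    edgeState false r t = false := by
  unfold edgeState
  split <;> simp [h]

lemma positionAfter_eq_zero {η₀ : BondConfig d} {ω : Sample d}
    (hη₀ : ∀ v : Direction d, η₀ (edgeToward 0 v) = false) (hω : ∀ e n, (ω.1 e n).2 = false)
    (n : ℕ) : positionAfter η₀ ω n = 0 := by
  induction n with
  | zero => rfl
  | succ n ih => simp [positionAfter, ih, bondConfig, hη₀, edgeState_false (hω _)]

end Closed

end DynPerc

theorem mainTheorem3 (d : ℕ) [NeZero d] (p : unitInterval) (μ : ℝ) (hμ : 0 < μ)
    (η₀ : DynPerc.BondConfig d) :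
    ((d = 1 ∨ d = 2) →
      (0 < p ∨ ∀ v : DynPerc.Direction d, η₀ (DynPerc.edgeToward 0 v) = false) →
      ∀ s₀ : ℝ≥0, ∀ᵐ ω ∂(DynPerc.law d p μ), ∃ s : ℝ≥0, s₀ ≤ s ∧ DynPerc.walker η₀ ω s = 0) ∧
    (3 ≤ d → 0 < p →
      ∀ᵐ ω ∂(DynPerc.law d p μ),
        Tendsto (fun t : ℝ≥0 => DynPerc.walker η₀ ω t) atTop cofinite) := by
  refine ⟨fun hd h s₀ => ?_, fun hd hp => ?_⟩
  · rcases (zero_le (a := p)).eq_or_lt with rfl | hp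
    · have hη₀ := h.resolve_left (lt_irrefl 0)
      filter_upwards [DynPerc.ae_choice_eq_false hμ] with ω hω
      exact ⟨s₀, le_rfl, DynPerc.positionAfter_eq_zero hη₀ hω _⟩
    · filter_upwards [DynPerc.ae_isClock_law p hμ,
        DynPerc.ae_frequently_positionAfter_eq_zero hμ hp (by omega) η₀] with ω h1 h2
      exact DynPerc.exists_walker_eq h1 h2 s₀
  · filter_upwards [DynPerc.ae_isClock_law p hμ,
      DynPerc.ae_tendsto_positionAfter hμ hp hd η₀] with ω h1 h2
    exact DynPerc.tendsto_walker h1 h2
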